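/- **Setting.** Let $X$ be a real Hilbert space with Riesz isomorphism $I\colon X\to X^*$, and let $V,W$ be reflexive real Banach spaces with continuous embeddings $W\hookrightarrow V\hookrightarrow X$. Let $\mathcal O\subset X$ be open, $\hat J\colon \operatorname{Dom}(\hat J)\subset X^*\to X$ a closed linear operator, $B(u)\in L(X)$ for $u\in\mathcal O\cap V$, $J(u):=B(u)\hat J$, let $E,P\in C^3(\mathcal O\cap V;\mathbb R)$, and let $T(s)\colon X\to X$, $s\in\mathbb R$, be affine maps with linear parts $dT(s)u:=T(s)u-T(s)0$. Assume the following. 1. *(Spaces)* There are $\theta\in(0,1]$ and $C>0$ with $\|u\|_V^3\le C\|u\|_X^{2+\theta}\|u\|_W^{1-\theta}$ for all $u\in W$. 2. *(Poisson map)* $\operatorname{Dom}(\hat J)$ is dense in $X^*$; $\hat J$ is injective; $B(u)$ is bijective on $X$ for $u\in\mathcal O\cap V$; $u\mapsto B(u)$ is of class $C^1(\mathcal O\cap V;L(X))\cap C^1(\mathcal O\cap W;L(W))$ (in particular $B(u)$ restricts to a bounded operator on $W$ for $u\in\mathcal O\cap W$); and $\langle J(u)v,w\rangle=-\langle v,J(u)w\rangle$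 for all $v,w\in\operatorname{Dom}(\hat J)$ and $u\in\mathcal O\cap V$. 3. *(Derivative extension)* There are $\nabla E,\nabla P\in C^0(\mathcal O\cap V;X^*)$ such that $\nabla E(u)$ and $\nabla P(u)$ extend $DE(u)$ and $DP(u)$. 4. *(Symmetry group)* (i) $\mathcal O$, $V$, $W$ are invariant under every $T(s)$, and $I^{-1}\operatorname{Dom}(\hat J)$ is invariant under every $dT(s)$. (ii) $T(0)=\mathrm{Id}$ and $T(s+r)=T(s)T(r)$. (iii) $dT(s)$ is unitary on $X$ and isometric on $V$ and on $W$. (iv) $T$ is strongly continuous on $X$, $V$ and $W$. (v) $T(\cdot)0\in C^3(\mathbb R;W)$, and $\|T(s)0\|_W\le\omega(\|T(s)0\|_X)$ for all $s$, for some increasing $\omega\colon[0,\infty)\to[0,\infty)$. (vi) $\hat J I\,dT(s)=dT(s)\hat J I$, and $dT(s)B(u)=B(T(s)u)dT(s)$ for $u\in\mathcal O\cap V$. (vii) Let $T'(0)u=\lim_{s\to0}s^{-1}(T(s)u-u)$ on the set $\operatorname{Dom}(T'(0))$ of $u\in X$ for which the limit exists in $X$, let $dT'(0)$ be the generator of $dT$,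 and let $\operatorname{Dom}(T'(0)|_V)$, $\operatorname{Dom}(T'(0)|_W)$ be the sets of $u$ in $V$, $W$ for which the limit exists in $V$, $W$. For every $u\in\operatorname{Dom}(T'(0)|_V)\cap\mathcal O$, $\nabla P(u)\in\operatorname{Dom}(\hat J)$ and $T'(0)u=J(u)\nabla P(u)$. Moreover $\hat J I\,dT'(0)=dT'(0)\hat J I$ (equality of unbounded operators, domains included). (viii) $\operatorname{Dom}(T'(0)|_W)\cap\operatorname{Rng}(\hat J)$ is dense in $X$. (ix) $E(T(s)u)=E(u)$ for all $u\in\mathcal O\cap V$ and $s\in\mathbb R$. *Solutions.* A *solution* on $[0,t_0)$ of $\frac{du}{dt}=J(u)DE(u)$ with initial data $u_0$ is a $u\in C^0([0,t_0);\mathcal O\cap W)$ with $u(0)=u_0$ such that, for every $w\in\operatorname{Dom}(\hat J)$, $\frac{d}{dt}\langle u(t),w\rangle=-\langle\nabla E(u(t)),J(u(t))w\rangle$ in the sense of distributions on $(0,t_0)$, and such that $E(u(t))$ and $P(u(t))$ are constant in $t$. An element $U\in\mathcal O\cap W$ is a *bound state with parameter $c$* if $t\mapsto T(ct)U$ is of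 class $C^1(\mathbb R;W)$ and is a solution. 5. *(Bound states)* $\mathcal I\subset\mathbb R$ is a non-empty open interval, and for each $c\in\mathcal I$, $U_c\in\mathcal O\cap W$ is a bound state with parameter $c$, such that: $c\mapsto U_c\in W$ is $C^1$; for all $c\in\mathcal I$, $U_c\in\operatorname{Dom}(T'''(0))$ (that is, $s\mapsto T(s)U_c$ is of class $C^3(\mathbb R;X)$), $U_c\in\operatorname{Dom}(\hat J I\,T'(0))$, and both $U_c$ and $\hat J I\,T'(0)U_c$ lie in $\operatorname{Dom}(T'(0)|_W)$; $T'(0)U_c\ne0$; and either $s\mapsto T(s)U_c$ is periodic or $\liminf_{|s|\to\infty}\|T(s)U_c-U_c\|_X>0$. Now fix $c\in\mathcal I$, and put $E_{c'}:=E-c'P$ and $d(c'):=E_{c'}(U_{c'})$ for $c'\in\mathcal I$. For $\nu>0$ let $$\mathcal U_\nu^W:=\{u\in\mathcal O\cap W:\ \inf_{s\in\mathbb R}\|u-T(s)U_c\|_W<\nu\}.$$ 6. *(Spectrum)* $D^2E_c(U_c)$ extends to a bounded operator $H_c\colon X\to X^*$ such that $I^{-1}H_c$ is self-adjoint with spectrum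 $\{-\mu_c^2\}\cup\{0\}\cup\Sigma_c$, where $-\mu_c^2<0$ is a simple eigenvalue, $0$ is a simple eigenvalue with eigenvector $T'(0)U_c$, and $\Sigma_c\subset(0,\infty)$ is bounded away from $0$. 7. *(Local existence)* There are $\nu_1>0$ and $t_0>0$ such that for every $u_0\in\mathcal U_{\nu_1}^W$ there is a unique solution on $[0,t_0)$ with initial data $u_0$. **Theorem (Instability).** If $d''(c)<0$, then $U_c$ is orbitally unstable: there is a $\nu_0>0$ such that for every $0<\nu<\nu_0$ there is initial data $u_0\in\mathcal U_\nu^W$ whose corresponding solution exits $\mathcal U_{\nu_0}^W$ in finite time. That is, there is a finite $\tau\ge0$ such that a solution with initial data $u_0$ exists on $[0,t_1)$ for some $t_1>\tau$, and every solution $u$ with initial data $u_0$ on an interval $[0,t_1)$ with $t_1>\tau$ satisfies $u(t)\notin\mathcal U_{\nu_0}^W$ for some $t\in[0,\tau]$. -/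

import Mathlib

open Set Filter Topology MeasureTheory
open scoped ContDiff

noncomputable section

/-- A real Banach space is reflexive if the canonical map into its bidual is onto. -/
def IsReflexiveSpace (F : Type*) [NormedAddCommGroup F] [NormedSpace ℝ F] : Prop :=
  Function.Surjective (NormedSpace.inclusionInDoubleDual ℝ F)

/-- The data of an abstract Hamiltonian system with a one-parameter symmetry group on a scale of
spaces `W ↪ V ↪ X`.  The laws these data obey are the predicates `SpacesAssumption`, ...,
`SymmetryAssumption` below.  A function on `O ∩ V` (or `O ∩ W`) is represented by a function on all
of `V` (or `W`) whose values off that set are never used. -/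
structure HamiltonianData (X V W : Type*)
    [NormedAddCommGroup X] [InnerProductSpace ℝ X]
    [NormedAddCommGroup V] [NormedSpace ℝ V]
    [NormedAddCommGroup W] [NormedSpace ℝ W] where
  /-- the embedding of `V` in `X` -/
  iV : V →L[ℝ] X
  /-- the embedding of `W` in `V` -/
  iWV : W →L[ℝ] V
  /-- the set in which solutions live -/
  O : Set X
  /-- the state-independent, possibly unbounded, factor of the Poisson map -/
  Jhat : StrongDual ℝ X →ₗ.[ℝ] X
  /-- the bounded, state-dependent factor of the Poisson map -/
  B : V → X →L[ℝ] X
  /-- energy -/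
  E : V → ℝ
  /-- momentum -/
  P : V → ℝ
  /-- extension of `DE` to `X` -/
  gradE : V → StrongDual ℝ X
  /-- extension of `DP` to `X` -/
  gradP : V → StrongDual ℝ X
  /-- the symmetry group, acting by affine maps of `X` -/
  T : ℝ → X →ᵃ[ℝ] X
  /-- restriction of the symmetry group to `V` -/
  TV : ℝ → V → V
  /-- restriction of the symmetry group to `W` -/
  TW : ℝ → W → W

namespace HamiltonianData

variable {X V W : Type*}
    [NormedAddCommGroup X] [InnerProductSpace ℝ X] [CompleteSpace X]
    [NormedAddCommGroup V] [NormedSpace ℝ V]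
    [NormedAddCommGroup W] [NormedSpace ℝ W]

/-- The embedding of `W` in `X`. -/
def iW (S : HamiltonianData X V W) : W →L[ℝ] X := S.iV.comp S.iWV

/-- `O ∩ V`, as a subset of `V`. -/
def OV (S : HamiltonianData X V W) : Set V := S.iV ⁻¹' S.O

/-- `O ∩ W`, as a subset of `W`. -/
def OW (S : HamiltonianData X V W) : Set W := S.iW ⁻¹' S.O

/-- The Poisson map `J(u) = B(u) Ĵ`, with domain `Dom Ĵ`. -/
def J (S : HamiltonianData X V W) (u : V) (w : S.Jhat.domain) : X := S.B u (S.Jhat w)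

/-- `ĴI` as a relation: `I x` lies in `Dom Ĵ` and `Ĵ I x = y`, where `I : X → X*` is the Riesz
isomorphism. -/
def JI (S : HamiltonianData X V W) (x y : X) : Prop :=
  (InnerProductSpace.toDual ℝ X x, y) ∈ S.Jhat.graph

/-- `u ∈ Dom T'(0)` and `T'(0) u = y`; here `T 0 u = u`, so the derivative at `0` is the limit of
`s⁻¹ (T(s)u - u)` in `X`. -/
def Gen (S : HamiltonianData X V W) (u y : X) : Prop :=
  HasDerivAt (fun s : ℝ => S.T s u) y 0

/-- `u ∈ Dom dT'(0)` and `dT'(0) u = y`, with `dT(s)` the linear part of `T(s)`. -/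
def LinGen (S : HamiltonianData X V W) (u y : X) : Prop :=
  HasDerivAt (fun s : ℝ => (S.T s).linear u) y 0

/-- `Dom(T'(0)|_V)`: the limit defining the generator exists in `V`. -/
def domV (S : HamiltonianData X V W) : Set V :=
  {v | DifferentiableAt ℝ (fun s : ℝ => S.TV s v) 0}

/-- `Dom(T'(0)|_W)`: the limit defining the generator exists in `W`. -/
def domW (S : HamiltonianData X V W) : Set W :=
  {w | DifferentiableAt ℝ (fun s : ℝ => S.TW s w) 0}

/-- The spaces `V` and `W` are reflexive Banach spaces, `W ↪ V ↪ X` are continuous embeddings, `O` is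
open, and the interpolation inequality holds. -/
structure SpacesAssumption (S : HamiltonianData X V W) : Prop where
  reflexive_V : IsReflexiveSpace V
  reflexive_W : IsReflexiveSpace W
  injective_iV : Function.Injective S.iV
  injective_iWV : Function.Injective S.iWV
  isOpen_O : IsOpen S.O
  interpolation : ∃ θ C : ℝ, 0 < θ ∧ θ ≤ 1 ∧ 0 < C ∧
    ∀ u : W, ‖S.iWV u‖ ^ 3 ≤ C * ‖S.iW u‖ ^ (2 + θ) * ‖u‖ ^ (1 - θ)

/-- Assumptions on the Poisson map. -/
structure PoissonAssumption (S : HamiltonianData X V W) : Prop where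
  closed : S.Jhat.IsClosed
  dense_domain : Dense (S.Jhat.domain : Set (StrongDual ℝ X))
  injective : Function.Injective S.Jhat
  bijective_B : ∀ u ∈ S.OV, Function.Bijective (S.B u)
  contDiffOn_B : ContDiffOn ℝ 1 S.B S.OV
  /-- `B(u)` restricts to a bounded operator on `W`, of class `C¹` in `u ∈ O ∩ W`. -/
  contDiffOn_BW : ∃ BW : W → W →L[ℝ] W,
    (∀ u ∈ S.OW, ∀ w : W, S.iW (BW u w) = S.B (S.iWV u) (S.iW w)) ∧ ContDiffOn ℝ 1 BW S.OW
  skew : ∀ u ∈ S.OV, ∀ v w : S.Jhat.domain,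
    (w : StrongDual ℝ X) (S.J u v) = -(v : StrongDual ℝ X) (S.J u w)

/-- Energy and momentum are of class `C³` on `O ∩ V`, and their derivatives extend to `X`. -/
structure FunctionalsAssumption (S : HamiltonianData X V W) : Prop where
  contDiffOn_E : ContDiffOn ℝ 3 S.E S.OV
  contDiffOn_P : ContDiffOn ℝ 3 S.P S.OV
  continuousOn_gradE : ContinuousOn S.gradE S.OV
  continuousOn_gradP : ContinuousOn S.gradP S.OV
  gradE_extends : ∀ u ∈ S.OV, ∀ v : V, S.gradE u (S.iV v) = fderiv ℝ S.E u v
  gradP_extends : ∀ u ∈ S.OV, ∀ v : V, S.gradP u (S.iV v) = fderiv ℝ S.P u v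

/-- Assumptions on the symmetry group. -/
structure SymmetryAssumption (S : HamiltonianData X V W) : Prop where
  /-- Invariance of `O`, `V`, `W` under `T`, and of `I⁻¹ Dom Ĵ` under `dT`. -/
  invariant_O : ∀ s : ℝ, ∀ u ∈ S.O, S.T s u ∈ S.O
  invariant_V : ∀ (s : ℝ) (v : V), S.iV (S.TV s v) = S.T s (S.iV v)
  invariant_W : ∀ (s : ℝ) (w : W), S.iW (S.TW s w) = S.T s (S.iW w)
  invariant_dom : ∀ (s : ℝ) (x : X), InnerProductSpace.toDual ℝ X x ∈ S.Jhat.domain →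
    InnerProductSpace.toDual ℝ X ((S.T s).linear x) ∈ S.Jhat.domain
  /-- Flow property. -/
  map_zero : ∀ x : X, S.T 0 x = x
  map_add : ∀ (s r : ℝ) (x : X), S.T (s + r) x = S.T s (S.T r x)
  /-- Unitarity on `X`, isometry on `V` and `W`. -/
  unitary_X : ∀ (s : ℝ) (x y : X), inner ℝ ((S.T s).linear x) ((S.T s).linear y) = inner ℝ x y
  surjective_X : ∀ s : ℝ, Function.Surjective (S.T s).linear
  isometry_V : ∀ (s : ℝ) (v : V), ‖S.TV s v - S.TV s 0‖ = ‖v‖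
  isometry_W : ∀ (s : ℝ) (w : W), ‖S.TW s w - S.TW s 0‖ = ‖w‖
  /-- Strong continuity. -/
  continuous_X : ∀ x : X, Continuous fun s : ℝ => S.T s x
  continuous_V : ∀ v : V, Continuous fun s : ℝ => S.TV s v
  continuous_W : ∀ w : W, Continuous fun s : ℝ => S.TW s w
  /-- Affine part. -/
  contDiff_affine : ContDiff ℝ 3 fun s : ℝ => S.TW s 0
  bound_affine : ∃ g : ℝ → ℝ, MonotoneOn g (Ici 0) ∧ (∀ r : ℝ, 0 ≤ r → 0 ≤ g r) ∧
    ∀ s : ℝ, ‖S.TW s 0‖ ≤ g ‖S.T s 0‖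
  /-- Commutativity with `J`. -/
  commute_Jhat : ∀ (s : ℝ) (x y : X), S.JI x y → S.JI ((S.T s).linear x) ((S.T s).linear y)
  commute_B : ∀ (s : ℝ), ∀ u ∈ S.OV, ∀ x : X,
    (S.T s).linear (S.B u x) = S.B (S.TV s u) ((S.T s).linear x)
  /-- `T'(0)u = J(u)∇P(u)`. -/
  generator : ∀ u ∈ S.OV, u ∈ S.domV →
    ∃ h : S.gradP u ∈ S.Jhat.domain, S.Gen (S.iV u) (S.J u ⟨S.gradP u, h⟩)
  /-- `ĴI dT'(0) = dT'(0) ĴI` as unbounded operators, domains included. -/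
  commute_generator : ∀ x z : X,
    (∃ y, S.LinGen x y ∧ S.JI y z) ↔ (∃ y, S.JI x y ∧ S.LinGen y z)
  /-- Density of `Dom(T'(0)|_W) ∩ Rng Ĵ` in `X`. -/
  dense_range : Dense (S.iW '' S.domW ∩ range S.Jhat)
  /-- Conservation of energy by the group. -/
  energy_invariant : ∀ u ∈ S.OV, ∀ s : ℝ, S.E (S.TV s u) = S.E u

/-- `u ∈ C⁰([0,t₀); O ∩ W)` is a solution of `du/dt = J(u)DE(u)`, `u(0) = u₀`, on `[0,t₀)`:
`d/dt ⟨u(t), w⟩ = -⟨∇E(u(t)), J(u(t))w⟩` in the sense of distributions on `(0,t₀)` for every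
`w ∈ Dom Ĵ`, and energy and momentum are conserved. -/
structure IsSolution (S : HamiltonianData X V W) (t₀ : ℝ) (u₀ : W) (u : ℝ → W) : Prop where
  continuousOn : ContinuousOn u (Ico 0 t₀)
  mem : ∀ t ∈ Ico 0 t₀, u t ∈ S.OW
  initial : u 0 = u₀
  weak : ∀ (w : S.Jhat.domain) (φ : ℝ → ℝ), ContDiff ℝ ∞ φ → HasCompactSupport φ →
    tsupport φ ⊆ Ioo 0 t₀ →
    -∫ t in Ioo 0 t₀, deriv φ t * (w : StrongDual ℝ X) (S.iW (u t)) =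
      ∫ t in Ioo 0 t₀, φ t * -(S.gradE (S.iWV (u t)) (S.J (S.iWV (u t)) w))
  energy : ∀ t ∈ Ico 0 t₀, S.E (S.iWV (u t)) = S.E (S.iWV u₀)
  momentum : ∀ t ∈ Ico 0 t₀, S.P (S.iWV (u t)) = S.P (S.iWV u₀)

/-- `U` is a bound state with parameter `c`: `t ↦ T(ct)U` is of class `C¹` from `ℝ` to `W` and solves
the system for all positive times. -/
def IsBoundState (S : HamiltonianData X V W) (c : ℝ) (U : W) : Prop :=
  ContDiff ℝ 1 (fun t : ℝ => S.TW (c * t) U) ∧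
    ∀ t₀ : ℝ, 0 < t₀ → S.IsSolution t₀ U (fun t => S.TW (c * t) U)

/-- Assumptions on the family `c ↦ U c` of bound states, `c` in the parameter interval `A`. -/
structure BoundStateAssumption (S : HamiltonianData X V W) (A : Set ℝ) (U : ℝ → W) : Prop where
  nonempty : A.Nonempty
  isOpen : IsOpen A
  interval : A.OrdConnected
  mem : ∀ c ∈ A, U c ∈ S.OW
  boundState : ∀ c ∈ A, S.IsBoundState c (U c)
  contDiffOn : ContDiffOn ℝ 1 U A
  /-- `U c ∈ Dom T'''(0)`: the orbit map `s ↦ T(s)U_c` is three times continuously differentiable in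
  `X`. -/
  dom_third : ∀ c ∈ A, ContDiff ℝ 3 fun s : ℝ => S.T s (S.iW (U c))
  dom_W : ∀ c ∈ A, U c ∈ S.domW
  /-- `U c ∈ Dom(ĴI T'(0))` and `ĴI T'(0) U_c ∈ Dom(T'(0)|_W)`. -/
  dom_JI : ∀ c ∈ A, ∃ y : X, S.Gen (S.iW (U c)) y ∧ ∃ z ∈ S.domW, S.JI y (S.iW z)
  /-- `T'(0)U_c ≠ 0`. -/
  nondegenerate : ∀ c ∈ A, ¬ S.Gen (S.iW (U c)) 0
  /-- The orbit is periodic, or `liminf ‖T(s)U_c - U_c‖ > 0` as `|s| → ∞` (stated without `liminf`,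
  since the norms may be unbounded). -/
  periodic_or : ∀ c ∈ A,
    (∃ ℓ : ℝ, 0 < ℓ ∧ Function.Periodic (fun s : ℝ => S.T s (S.iW (U c))) ℓ) ∨
    (∃ η : ℝ, 0 < η ∧ ∀ᶠ s in cocompact ℝ, η ≤ ‖S.T s (S.iW (U c)) - S.iW (U c)‖)

/-- The augmented Hamiltonian `E_c = E - cP`. -/
def augE (S : HamiltonianData X V W) (c : ℝ) (u : V) : ℝ := S.E u - c * S.P u

/-- The moment of instability `d(c) = E_c(U_c)`. -/
def moment (S : HamiltonianData X V W) (U : ℝ → W) (c : ℝ) : ℝ := S.augE c (S.iWV (U c))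

/-- `D²E_c(U_c)` extends to a bounded operator `H : X → X*` such that `A = I⁻¹H` is self-adjoint with
spectrum `{-μ²} ∪ {0} ∪ Σ`, where `-μ² < 0` is a simple eigenvalue with unit eigenvector `χ`, `0` is
a simple eigenvalue with eigenvector `T'(0)U_c`, and `Σ ⊂ (0,∞)` is bounded away from `0`. -/
def SpectralAssumption (S : HamiltonianData X V W) (c : ℝ) (Uc : W) : Prop :=
  ∃ (H : X →L[ℝ] StrongDual ℝ X) (A : X →L[ℝ] X),
    (∀ v w : V, H (S.iV v) (S.iV w) = fderiv ℝ (fderiv ℝ (S.augE c)) (S.iWV Uc) v w) ∧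
    (∀ x : X, InnerProductSpace.toDual ℝ X (A x) = H x) ∧
    IsSelfAdjoint A ∧
    ∃ (μ : ℝ) (χ y : X) (Sig : Set ℝ) (δ : ℝ),
      0 < μ ∧ ‖χ‖ = 1 ∧ S.Gen (S.iW Uc) y ∧ 0 < δ ∧ (∀ r ∈ Sig, δ ≤ r) ∧
      spectrum ℝ A = {-μ ^ 2} ∪ {0} ∪ Sig ∧
      Module.End.eigenspace (A : X →ₗ[ℝ] X) (-μ ^ 2) = Submodule.span ℝ {χ} ∧
      Module.End.eigenspace (A : X →ₗ[ℝ] X) 0 = Submodule.span ℝ {y}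

/-- The tube of radius `ν` in `W` around the orbit of `Uc`. -/
def tubeW (S : HamiltonianData X V W) (Uc : W) (ν : ℝ) : Set W :=
  {u | u ∈ S.OW ∧ ⨅ s : ℝ, ‖u - S.TW s Uc‖ < ν}

/-- Local existence: for some `ν₀, t₀ > 0`, all data in the `ν₀`-tube launch a unique solution on
`[0,t₀)`. -/
def LocalExistence (S : HamiltonianData X V W) (Uc : W) : Prop :=
  ∃ ν₀ t₀ : ℝ, 0 < ν₀ ∧ 0 < t₀ ∧ ∀ u₀ ∈ S.tubeW Uc ν₀,
    (∃ u : ℝ → W, S.IsSolution t₀ u₀ u) ∧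
    ∀ u v : ℝ → W, S.IsSolution t₀ u₀ u → S.IsSolution t₀ u₀ v → EqOn u v (Ico 0 t₀)

/-- The solution with initial data `u₀` exits the set `K` in finite time: for some `τ ≥ 0` it exists
on an interval `[0,t₁)` with `t₁ > τ`, and every such solution has left `K` by the time `τ`. -/
def ExitsInFiniteTime (S : HamiltonianData X V W) (K : Set W) (u₀ : W) : Prop :=
  ∃ τ : ℝ, 0 ≤ τ ∧
    (∃ t₁ : ℝ, τ < t₁ ∧ ∃ u : ℝ → W, S.IsSolution t₁ u₀ u) ∧
    ∀ t₁ : ℝ, τ < t₁ → ∀ u : ℝ → W, S.IsSolution t₁ u₀ u → ∃ t ∈ Icc 0 τ, u t ∉ K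

end HamiltonianData

end

/-! The argument is of Grillakis–Shatah–Strauss type, with a monotone functional read off along a
modulated solution. Write `E_c = E - cP`, `u = U_c`, `y = T'(0)u`, and let `A` be the self-adjoint
operator representing `D²E_c(u)`. Bound states are critical points of `E_c` (`gradE_boundState`).
Differentiating this in `c` shows that `A U_c'` represents `DP(u)` and that `d''(c) = -⟨A U_c',
U_c'⟩`. If `d''(c) < 0`, the form of `A` is positive at `U_c'`, and the negative eigenvector stays
negative after its `A`-component along `U_c'` is removed; the result is tangent to the level set of
`P`. By density it may be replaced by `z = J(u)Ix` with `x` in the domain of the generator of `dT`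
(`exists_negative_direction`), and tangency then reads `⟨y, x⟩ = 0`.

Since `A` has a single negative direction and kernel spanned by `y`, it is coercive on the
complement of `y` up to a multiple of `⟨Az, h⟩²` (`coercive_of_negative_direction`). Start from `u +
rz`, where `E_c = E_c(u) - e` with `e > 0`. While the solution `w` stays near the orbit, choose
`s(t)` so that `h = T(s)w - u` is orthogonal to `y`. Conservation of `E_c` and coercivity give `⟨Az,
h⟩² ≥ c₁e` and bound `‖h‖_X` by `|⟨Az, h⟩|`. The functional `⟨T(s)w, x⟩` has derivative `-⟨Az, h⟩`
up to an error of at most half that size (`drift_estimate`, `IsSolution.hasDerivAt_modulated`). So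
`⟨Az, h⟩` keeps its sign and the functional is monotone with speed at least `√(c₁e)/2`; being
bounded near the orbit, it bounds the time of stay.

The phase `s(t)` is only locally determined, so it is built in short steps
(`IsSolution.growth_step`). Each step restores the initial closeness by `exists_self_improvement`,
where the alternative between periodic and non-recurrent orbits enters. Local existence turns the
bounded stay into an exit (`exits_of_bounded_stay`). -/

set_option linter.unusedSectionVars false

/-! ### Coercivity from spectral assumptions, through Rayleigh quotients -/

section Spectral

variable {X : Type*} [NormedAddCommGroup X] [InnerProductSpace ℝ X]

theorem exists_bound_below_of_notMem_spectrum {A : X →L[ℝ] X} {l : ℝ} (h : l ∉ spectrum ℝ A) :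
    ∃ c : ℝ, 0 < c ∧ ∀ x, c * ‖x‖ ≤ ‖A x - l • x‖ := by
  rw [spectrum.notMem_iff] at h
  obtain ⟨u, hu⟩ := h
  refine ⟨(‖(↑u⁻¹ : X →L[ℝ] X)‖ + 1)⁻¹, by positivity, fun x => ?_⟩
  have h1 : (↑u⁻¹ : X →L[ℝ] X) (l • x - A x) = x := by
    have h2 : (↑u⁻¹ * ↑u : X →L[ℝ] X) x = x := by rw [Units.inv_mul]; rfl
    rw [hu] at h2
    simpa [Algebra.algebraMap_eq_smul_one] using h2
  rw [inv_mul_le_iff₀ (by positivity), norm_sub_rev]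
  calc ‖x‖ = ‖(↑u⁻¹ : X →L[ℝ] X) (l • x - A x)‖ := by rw [h1]
    _ ≤ ‖(↑u⁻¹ : X →L[ℝ] X)‖ * ‖l • x - A x‖ := ContinuousLinearMap.le_opNorm _ _
    _ ≤ (‖(↑u⁻¹ : X →L[ℝ] X)‖ + 1) * ‖l • x - A x‖ := by gcongr; linarith

/-- Cauchy–Schwarz for a symmetric form that is nonnegative on a subspace. -/
theorem inner_sq_le_of_nonneg_on {B : X →L[ℝ] X} (hB : ∀ x y, inner ℝ (B x) y = inner ℝ x (B y))
    {M : Submodule ℝ X} (hpos : ∀ x ∈ M, 0 ≤ inner ℝ (B x) x) {x y : X} (hx : x ∈ M) (hy : y ∈ M) :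
    inner ℝ (B x) y ^ 2 ≤ inner ℝ (B x) x * inner ℝ (B y) y := by
  have h := discrim_le_zero (a := inner ℝ (B y) y) (b := 2 * inner ℝ (B x) y)
    (c := inner ℝ (B x) x) (fun t => ?_)
  · unfold discrim at h; nlinarith
  · have := hpos (x + t • y) (M.add_mem hx (M.smul_mem t hy))
    have e : inner ℝ (B y) x = inner ℝ (B x) y := by rw [hB, real_inner_comm]
    simp only [map_add, map_smul, inner_add_left, inner_add_right, inner_smul_left,
      inner_smul_right, e, RCLike.conj_to_real] at this
    nlinarith

/-- The infimum of the Rayleigh quotient over an invariant subspace is an approximate eigenvalue. -/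
theorem exists_rayleigh_inf {B : X →L[ℝ] X} (hB : ∀ x y, inner ℝ (B x) y = inner ℝ x (B y))
    {M : Submodule ℝ X} (hM : ∀ x ∈ M, B x ∈ M) (hne : ∃ x ∈ M, x ≠ 0) :
    ∃ m : ℝ, (∀ x ∈ M, m * ‖x‖ ^ 2 ≤ inner ℝ (B x) x) ∧
      ¬ ∃ c : ℝ, 0 < c ∧ ∀ x ∈ M, c * ‖x‖ ≤ ‖B x - m • x‖ := by
  set I : Set ℝ := {l | ∀ x ∈ M, l * ‖x‖ ^ 2 ≤ inner ℝ (B x) x} with hI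
  have hb : ∀ x, |inner ℝ (B x) x| ≤ ‖B‖ * ‖x‖ ^ 2 := fun x => by
    calc |inner ℝ (B x) x| ≤ ‖B x‖ * ‖x‖ := abs_real_inner_le_norm _ _
      _ ≤ ‖B‖ * ‖x‖ * ‖x‖ := by gcongr; exact B.le_opNorm x
      _ = _ := by ring
  have hIne : I.Nonempty := ⟨-‖B‖, fun x _ => by have := neg_le_of_abs_le (hb x); linarith⟩
  obtain ⟨x0, hx0, hx0n⟩ := hne
  have hx0p : 0 < ‖x0‖ ^ 2 := by positivity
  have hIb : BddAbove I := ⟨‖B‖, fun l hl => by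
    have h1 := hl x0 hx0
    have h2 := le_of_abs_le (hb x0)
    exact le_of_mul_le_mul_right (h1.trans h2) hx0p⟩
  have hmem : ∀ x ∈ M, sSup I * ‖x‖ ^ 2 ≤ inner ℝ (B x) x := by
    intro x hx
    rcases eq_or_ne x 0 with rfl | hxn
    · simp
    have hp : 0 < ‖x‖ ^ 2 := by positivity
    rw [← le_div_iff₀ hp]
    exact csSup_le hIne fun l hl => by rw [le_div_iff₀ hp]; exact hl x hx
  refine ⟨sSup I, hmem, ?_⟩
  rintro ⟨c, hc, hcb⟩
  set m := sSup I
  set D : X →L[ℝ] X := B - m • ContinuousLinearMap.id ℝ X with hD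
  have hDx : ∀ x, D x = B x - m • x := fun x => by simp [hD]
  have hDs : ∀ x y, inner ℝ (D x) y = inner ℝ x (D y) := fun x y => by
    simp [hDx, inner_sub_left, inner_sub_right, hB, inner_smul_left, inner_smul_right]
  have hDp : ∀ x ∈ M, 0 ≤ inner ℝ (D x) x := fun x hx => by
    have := hmem x hx
    rw [hDx, inner_sub_left, inner_smul_left, real_inner_self_eq_norm_sq]
    simpa using this
  have hK : 0 < ‖D‖ + 1 := by positivity
  -- If `D = B - m` were bounded below by `c` on `M`, the infimum could be raised. Cauchy–Schwarz
  -- for the form of `D`, applied to `x` and `Dx`, gives `‖Dx‖² ≤ (‖D‖ + 1)⟨Dx, x⟩`, so the form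
  -- dominates `c²‖x‖² / (‖D‖ + 1)`.
  have key : m + c ^ 2 / (‖D‖ + 1) ∈ I := by
    intro x hx
    have h1 : ‖D x‖ ^ 2 ≤ (‖D‖ + 1) * inner ℝ (D x) x := by
      have hDM : D x ∈ M := by rw [hDx]; exact M.sub_mem (hM x hx) (M.smul_mem _ hx)
      have h2 := inner_sq_le_of_nonneg_on hDs hDp hx hDM
      rw [real_inner_self_eq_norm_sq] at h2
      have h3 : inner ℝ (D (D x)) (D x) ≤ (‖D‖ + 1) * ‖D x‖ ^ 2 := by
        calc inner ℝ (D (D x)) (D x) ≤ ‖D (D x)‖ * ‖D x‖ := real_inner_le_norm _ _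
          _ ≤ ‖D‖ * ‖D x‖ * ‖D x‖ := by gcongr; exact D.le_opNorm _
          _ ≤ _ := by nlinarith [sq_nonneg ‖D x‖]
      have h4 : (‖D x‖ ^ 2) ^ 2 ≤ ((‖D‖ + 1) * inner ℝ (D x) x) * ‖D x‖ ^ 2 := by
        nlinarith [hDp x hx]
      rcases eq_or_ne (‖D x‖ ^ 2) 0 with h0 | h0
      · rw [h0]; exact mul_nonneg hK.le (hDp x hx)
      · have : 0 < ‖D x‖ ^ 2 := lt_of_le_of_ne (sq_nonneg _) h0.symm
        rw [sq (‖D x‖ ^ 2)] at h4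
        exact le_of_mul_le_mul_right h4 this
    have h5 : (c * ‖x‖) ^ 2 ≤ ‖D x‖ ^ 2 := by
      have := hcb x hx
      rw [← hDx] at this
      gcongr
    have h6 : inner ℝ (D x) x = inner ℝ (B x) x - m * ‖x‖ ^ 2 := by
      rw [hDx, inner_sub_left, inner_smul_left, real_inner_self_eq_norm_sq]; simp
    have h7 : c ^ 2 / (‖D‖ + 1) * ‖x‖ ^ 2 ≤ inner ℝ (D x) x := by
      rw [div_mul_eq_mul_div, div_le_iff₀ hK]
      nlinarith
    nlinarith
  have := le_csSup hIb key
  have h8 : 0 < c ^ 2 / (‖D‖ + 1) := by positivity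
  linarith

/-- Half-width estimate in a gap of the approximate point spectrum. -/
theorem norm_sub_smul_ge_of_gap {D : X →L[ℝ] X} (hD : ∀ x y, inner ℝ (D x) y = inner ℝ x (D y))
    {m r : ℝ} (hgap : ∀ l, |l - m| < r → ∃ c : ℝ, 0 < c ∧ ∀ x, c * ‖x‖ ≤ ‖D x - l • x‖) (x : X) :
    r * ‖x‖ ≤ ‖D x - m • x‖ := by
  by_contra! hlt
  have hr : 0 < r := by
    by_contra! h
    have := mul_nonpos_of_nonpos_of_nonneg h (norm_nonneg x)
    linarith [norm_nonneg (D x - m • x)]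
  set G : X →L[ℝ] X := D - m • ContinuousLinearMap.id ℝ X with hG
  have hGx : ∀ x, G x = D x - m • x := fun x => by simp [hG]
  have hGs : ∀ x y, inner ℝ (G x) y = inner ℝ x (G y) := fun x y => by
    simp [hGx, inner_sub_left, inner_sub_right, hD, inner_smul_left, inner_smul_right]
  have hxn : x ≠ 0 := by rintro rfl; simp at hlt
  obtain ⟨l, hl, hnb⟩ := exists_rayleigh_inf (B := G.comp G) (M := ⊤)
    (fun x y => by simp [hGs]) (fun _ _ => trivial) ⟨x, trivial, hxn⟩
  have hlr : l < r ^ 2 := by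
    have h1 := hl x trivial
    have h2 : inner ℝ ((G.comp G) x) x = ‖D x - m • x‖ ^ 2 := by
      rw [← hGx, ContinuousLinearMap.comp_apply, hGs, real_inner_self_eq_norm_sq]
    rw [h2] at h1
    have h3 : ‖D x - m • x‖ ^ 2 < (r * ‖x‖) ^ 2 := by gcongr
    have : 0 < ‖x‖ ^ 2 := by positivity
    nlinarith
  apply hnb
  -- The Rayleigh infimum `l` of `G²` is an approximate eigenvalue below `r²`. If `l < 0` this
  -- contradicts `G² ≥ 0`; otherwise `G² - l` factors as `(D - (m + √l))(D - (m - √l))`, and both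
  -- factors are bounded below by the gap hypothesis.
  rcases lt_or_ge l 0 with h0 | h0
  · refine ⟨-l, by linarith, fun y _ => ?_⟩
    rcases eq_or_ne y 0 with rfl | hy
    · simp
    have h1 : -l * ‖y‖ ^ 2 ≤ inner ℝ ((G.comp G) y - l • y) y := by
      rw [inner_sub_left, inner_smul_left, real_inner_self_eq_norm_sq,
        ContinuousLinearMap.comp_apply, hGs, real_inner_self_eq_norm_sq]
      have := sq_nonneg ‖G y‖
      simp only [RCLike.conj_to_real]; linarith
    have h2 := h1.trans (real_inner_le_norm _ _)
    have hyp : 0 < ‖y‖ := norm_pos_iff.2 hy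
    nlinarith
  · set s := Real.sqrt l
    have hs : s ^ 2 = l := Real.sq_sqrt h0
    have hs0 : 0 ≤ s := Real.sqrt_nonneg l
    have hsr : s < r := by nlinarith
    obtain ⟨c1, hc1, hb1⟩ := hgap (m + s) (by rw [add_sub_cancel_left, abs_of_nonneg hs0]; exact hsr)
    obtain ⟨c2, hc2, hb2⟩ := hgap (m - s) (by
      rw [show m - s - m = -s by ring, abs_neg, abs_of_nonneg hs0]; exact hsr)
    refine ⟨c1 * c2, by positivity, fun y _ => ?_⟩
    have h1 := hb1 (D y - (m - s) • y)
    have h2 := hb2 y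
    have e : D (D y - (m - s) • y) - (m + s) • (D y - (m - s) • y) = (G.comp G) y - l • y := by
      simp only [ContinuousLinearMap.comp_apply, hGx, map_sub, map_smul, ← hs]
      module
    rw [e] at h1
    calc c1 * c2 * ‖y‖ = c1 * (c2 * ‖y‖) := by ring
      _ ≤ c1 * ‖D y - (m - s) • y‖ := by gcongr
      _ ≤ _ := h1

/-- This replaces the spectral projection at an isolated point. `D²` has a gap `(0, r²)`; the gap
estimate centred at `r²/2` says `‖D²x - (r²/2)x‖ ≥ (r²/2)‖x‖`, and expanding the square leaves
exactly `r‖Dx‖ ≤ ‖D(Dx)‖`. The inequality thus holds on the range of `D`, and by continuity on its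
closure, which contains the orthogonal complement of the kernel. -/
theorem norm_apply_ge_of_isolated [CompleteSpace X] {D : X →L[ℝ] X}
    (hD : ∀ x y, inner ℝ (D x) y = inner ℝ x (D y)) {r : ℝ} (hr : 0 < r)
    (hgap : ∀ l, l ≠ 0 → |l| < r → ∃ c : ℝ, 0 < c ∧ ∀ x, c * ‖x‖ ≤ ‖D x - l • x‖)
    {y : X} (hy : ∀ k, D k = 0 → inner ℝ k y = 0) : r * ‖y‖ ≤ ‖D y‖ := by
  have hgap2 : ∀ l, |l - r ^ 2 / 2| < r ^ 2 / 2 →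
      ∃ c : ℝ, 0 < c ∧ ∀ x, c * ‖x‖ ≤ ‖(D.comp D) x - l • x‖ := by
    intro l hl
    rw [abs_lt] at hl
    have hl0 : 0 < l := by linarith
    set s := Real.sqrt l
    have hs : s ^ 2 = l := Real.sq_sqrt hl0.le
    have hs0 : 0 < s := Real.sqrt_pos.2 hl0
    have hsr : s < r := by nlinarith
    obtain ⟨c1, hc1, hb1⟩ := hgap s hs0.ne' (by rwa [abs_of_pos hs0])
    obtain ⟨c2, hc2, hb2⟩ := hgap (-s) (by linarith) (by rwa [abs_neg, abs_of_pos hs0])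
    refine ⟨c1 * c2, by positivity, fun y => ?_⟩
    have h1 := hb1 (D y - (-s) • y)
    have h2 := hb2 y
    have e : D (D y - (-s) • y) - s • (D y - (-s) • y) = (D.comp D) y - l • y := by
      simp only [ContinuousLinearMap.comp_apply, map_sub, map_smul, ← hs]
      module
    rw [e] at h1
    calc c1 * c2 * ‖y‖ = c1 * (c2 * ‖y‖) := by ring
      _ ≤ c1 * ‖D y - (-s) • y‖ := by gcongr
      _ ≤ _ := h1
  have hran : ∀ x, r * ‖D x‖ ≤ ‖D (D x)‖ := by
    intro x
    have h := norm_sub_smul_ge_of_gap (D := D.comp D) (fun x y => by simp [hD]) hgap2 x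
    have h2 : (r ^ 2 / 2 * ‖x‖) ^ 2 ≤ ‖(D.comp D) x - (r ^ 2 / 2) • x‖ ^ 2 := by gcongr
    rw [norm_sub_sq_real, inner_smul_right, norm_smul, ContinuousLinearMap.comp_apply, hD (D x) x,
      real_inner_self_eq_norm_sq, Real.norm_of_nonneg (by positivity)] at h2
    have h3 : (r * ‖D x‖) ^ 2 ≤ ‖D (D x)‖ ^ 2 := by nlinarith
    exact le_of_sq_le_sq h3 (norm_nonneg _)
  have hcl : y ∈ closure (range D) := by
    have h1 : y ∈ (D.range)ᗮᗮ := by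
      rw [Submodule.mem_orthogonal]
      intro k hk
      apply hy
      have : inner ℝ (D k) (D k) = 0 := by
        rw [hD, real_inner_comm]
        exact (Submodule.mem_orthogonal _ _).1 hk (D (D k)) ⟨D k, rfl⟩
      exact inner_self_eq_zero.1 this
    rw [Submodule.orthogonal_orthogonal_eq_closure] at h1
    have h2 : y ∈ ((D.range).topologicalClosure : Set X) := h1
    rw [Submodule.topologicalClosure_coe] at h2
    have h3 : range D = ((D.range : Submodule ℝ X) : Set X) := (LinearMap.coe_range _).symm
    rwa [h3]
  have hclosed : IsClosed {y : X | r * ‖y‖ ≤ ‖D y‖} :=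
    isClosed_le (by fun_prop) (by fun_prop)
  exact closure_minimal (by rintro _ ⟨x, rfl⟩; exact hran x) hclosed hcl

/-- An operator with spectrum `{-μ²} ∪ {0} ∪ Σ`, whose first two points are simple eigenvalues, is
coercive on the orthogonal complement of the two eigenvectors. -/
theorem coercive_of_spectrum [CompleteSpace X] {A : X →L[ℝ] X} (hA : IsSelfAdjoint A)
    {μ δ : ℝ} {χ y : X} {Sig : Set ℝ} (hμ : 0 < μ) (hδ : 0 < δ) (hSig : ∀ r ∈ Sig, δ ≤ r)
    (hspec : spectrum ℝ A = {-μ ^ 2} ∪ {0} ∪ Sig)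
    (hχ : Module.End.eigenspace (A : X →ₗ[ℝ] X) (-μ ^ 2) = Submodule.span ℝ {χ})
    (hy : Module.End.eigenspace (A : X →ₗ[ℝ] X) 0 = Submodule.span ℝ {y}) {x : X}
    (hxχ : inner ℝ χ x = 0) (hxy : inner ℝ y x = 0) : δ * ‖x‖ ^ 2 ≤ inner ℝ (A x) x := by
  have hs : ∀ x y, inner ℝ (A x) y = inner ℝ x (A y) := hA.isSymmetric
  have hAχ : A χ = (-μ ^ 2) • χ := by
    have : χ ∈ Module.End.eigenspace (A : X →ₗ[ℝ] X) (-μ ^ 2) := by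
      rw [hχ]; exact Submodule.mem_span_singleton_self χ
    exact Module.End.mem_eigenspace_iff.1 this
  have hAy : A y = 0 := by
    have : y ∈ Module.End.eigenspace (A : X →ₗ[ℝ] X) 0 := by
      rw [hy]; exact Submodule.mem_span_singleton_self y
    simpa using Module.End.mem_eigenspace_iff.1 this
  rcases eq_or_ne x 0 with rfl | hxn
  · simp
  let M : Submodule ℝ X := (Submodule.span ℝ {χ, y})ᗮ
  have hMiff : ∀ v, v ∈ M ↔ inner ℝ χ v = 0 ∧ inner ℝ y v = 0 := by
    intro v
    constructor
    · intro h
      exact ⟨h χ (Submodule.subset_span (by simp)), h y (Submodule.subset_span (by simp))⟩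
    · rintro ⟨h1, h2⟩
      rw [Submodule.mem_orthogonal]
      intro u hu
      obtain ⟨a, b, rfl⟩ := Submodule.mem_span_pair.1 hu
      simp [inner_add_left, inner_smul_left, h1, h2]
  obtain ⟨m, hm, hnb⟩ := exists_rayleigh_inf hs (M := M) (fun v hv => by
    rw [hMiff] at hv ⊢
    rw [← hs, ← hs, hAχ, hAy, inner_smul_left, hv.1]; simp) ⟨x, (hMiff x).2 ⟨hxχ, hxy⟩, hxn⟩
  have hmspec : m ∈ spectrum ℝ A := by
    by_contra h
    obtain ⟨c, hc, hb⟩ := exists_bound_below_of_notMem_spectrum h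
    exact hnb ⟨c, hc, fun v _ => hb v⟩
  -- The infimum `m` lies in the spectrum. It cannot be an isolated point whose eigenspace is
  -- orthogonal to `M`, since `A - m` would then be bounded below on `M`. Excluding `-μ²` and `0`
  -- leaves `m ∈ Sig`.
  have hiso : ∀ l0 e r : ℝ, 0 < r → ∀ w : X,
      Module.End.eigenspace (A : X →ₗ[ℝ] X) l0 = Submodule.span ℝ {w} →
      (∀ v ∈ M, inner ℝ w v = 0) → (∀ l ∈ spectrum ℝ A, l ≠ l0 → r ≤ |l - l0|) → m ≠ l0 := by
    rintro l0 - r hr w hw hwM hsp rfl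
    apply hnb
    refine ⟨r, hr, fun v hv => ?_⟩
    have hDx : ∀ x, (A - m • ContinuousLinearMap.id ℝ X) x = A x - m • x := fun x => by simp
    rw [← hDx]
    apply norm_apply_ge_of_isolated _ hr
    · intro l hl hlr
      have : m + l ∉ spectrum ℝ A := fun h => by
        have := hsp _ h (by simpa using hl)
        rw [add_sub_cancel_left] at this
        linarith
      obtain ⟨c, hc, hb⟩ := exists_bound_below_of_notMem_spectrum this
      refine ⟨c, hc, fun z => (hb z).trans_eq ?_⟩
      rw [hDx]; congr 1; module
    · intro k hk
      rw [hDx, sub_eq_zero] at hk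
      have : k ∈ Module.End.eigenspace (A : X →ₗ[ℝ] X) m := Module.End.mem_eigenspace_iff.2 hk
      rw [hw] at this
      obtain ⟨a, rfl⟩ := Submodule.mem_span_singleton.1 this
      rw [inner_smul_left, hwM v hv]; simp
    · intro a b
      simp [inner_sub_left, inner_sub_right, hs, inner_smul_left, inner_smul_right]
  have hμ2 : 0 < μ ^ 2 := by positivity
  have h1 : m ≠ -μ ^ 2 := hiso (-μ ^ 2) 0 (μ ^ 2) hμ2 χ hχ (fun v hv => ((hMiff v).1 hv).1) (by
    intro l hl hne
    rw [hspec] at hl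
    rcases hl with (hl | hl) | hl
    · exact absurd hl hne
    · rw [mem_singleton_iff.1 hl]; simp
    · have := hSig l hl
      rw [abs_of_pos (by linarith)]; linarith)
  have h2 : m ≠ 0 := hiso 0 0 (min (μ ^ 2) δ) (lt_min hμ2 hδ) y hy
    (fun v hv => ((hMiff v).1 hv).2) (by
    intro l hl hne
    rw [hspec] at hl
    rcases hl with (hl | hl) | hl
    · rw [mem_singleton_iff.1 hl]; simp
    · exact absurd hl hne
    · have := hSig l hl
      rw [sub_zero, abs_of_pos (by linarith)]; exact (min_le_right _ _).trans this)
  rw [hspec] at hmspec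
  have hmδ : δ ≤ m := by
    rcases hmspec with (h | h) | h
    · exact absurd h h1
    · exact absurd h h2
    · exact hSig m h
  calc δ * ‖x‖ ^ 2 ≤ m * ‖x‖ ^ 2 := by gcongr
    _ ≤ _ := hm x ((hMiff x).2 ⟨hxχ, hxy⟩)

set_option maxHeartbeats 1000000 in
/-- Coercivity modulo one negative direction, transverse to the kernel. -/
theorem coercive_of_negative_direction [CompleteSpace X] {A : X →L[ℝ] X} (hA : IsSelfAdjoint A)
    {μ δ : ℝ} {χ y z : X} {Sig : Set ℝ} (hμ : 0 < μ) (hδ : 0 < δ) (hSig : ∀ r ∈ Sig, δ ≤ r)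
    (hspec : spectrum ℝ A = {-μ ^ 2} ∪ {0} ∪ Sig) (hχ1 : ‖χ‖ = 1)
    (hχ : Module.End.eigenspace (A : X →ₗ[ℝ] X) (-μ ^ 2) = Submodule.span ℝ {χ})
    (hy : Module.End.eigenspace (A : X →ₗ[ℝ] X) 0 = Submodule.span ℝ {y}) (hy0 : y ≠ 0)
    (hz : inner ℝ (A z) z < 0) :
    ∃ κ C : ℝ, 0 < κ ∧ 0 ≤ C ∧ ∀ h, inner ℝ y h = 0 →
      κ * ‖h‖ ^ 2 - C * inner ℝ (A z) h ^ 2 ≤ inner ℝ (A h) h := by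
  have hs : ∀ x y, inner ℝ (A x) y = inner ℝ x (A y) := hA.isSymmetric
  have hAχ : A χ = (-μ ^ 2) • χ := by
    have : χ ∈ Module.End.eigenspace (A : X →ₗ[ℝ] X) (-μ ^ 2) := by
      rw [hχ]; exact Submodule.mem_span_singleton_self χ
    exact Module.End.mem_eigenspace_iff.1 this
  have hAy : A y = 0 := by
    have : y ∈ Module.End.eigenspace (A : X →ₗ[ℝ] X) 0 := by
      rw [hy]; exact Submodule.mem_span_singleton_self y
    simpa using Module.End.mem_eigenspace_iff.1 this
  have hχχ : inner ℝ χ χ = (1 : ℝ) := by rw [real_inner_self_eq_norm_sq, hχ1]; norm_num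
  have hμ2 : 0 < μ ^ 2 := by positivity
  have hχy : inner ℝ y χ = (0 : ℝ) := by
    have h := hs y χ
    rw [hAy, hAχ, inner_zero_left, inner_smul_right] at h
    rcases mul_eq_zero.1 h.symm with h | h
    · linarith
    · exact h
  let M : Submodule ℝ X := (Submodule.span ℝ {χ, y})ᗮ
  have hMiff : ∀ v, v ∈ M ↔ inner ℝ χ v = 0 ∧ inner ℝ y v = 0 := by
    intro v
    constructor
    · intro h
      exact ⟨h χ (Submodule.subset_span (by simp)), h y (Submodule.subset_span (by simp))⟩
    · rintro ⟨h1, h2⟩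
      rw [Submodule.mem_orthogonal]
      intro u hu
      obtain ⟨a, b, rfl⟩ := Submodule.mem_span_pair.1 hu
      simp [inner_add_left, inner_smul_left, h1, h2]
  have hpos : ∀ v ∈ M, δ * ‖v‖ ^ 2 ≤ inner ℝ (A v) v := fun v hv =>
    coercive_of_spectrum hA hμ hδ hSig hspec hχ hy ((hMiff v).1 hv).1 ((hMiff v).1 hv).2
  have hpos0 : ∀ v ∈ M, 0 ≤ inner ℝ (A v) v := fun v hv =>
    (mul_nonneg hδ.le (sq_nonneg _)).trans (hpos v hv)
  have hdec : ∀ v, inner ℝ y v = 0 → v - (inner ℝ χ v : ℝ) • χ ∈ M := fun v hv => by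
    rw [hMiff, inner_sub_right, inner_sub_right, inner_smul_right, inner_smul_right, hχχ, hχy, hv]
    simp
  have hform : ∀ v w, inner ℝ y v = 0 → inner ℝ y w = 0 → inner ℝ (A v) w =
      -μ ^ 2 * inner ℝ χ v * inner ℝ χ w +
      inner ℝ (A (v - (inner ℝ χ v : ℝ) • χ)) (w - (inner ℝ χ w : ℝ) • χ) := by
    intro v w _ _
    have e1 : inner ℝ (A v) χ = -μ ^ 2 * inner ℝ χ v := by
      rw [hs, hAχ, inner_smul_right, real_inner_comm]
    simp only [map_sub, map_smul, inner_sub_left, inner_sub_right, inner_smul_left,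
      inner_smul_right, e1, hAχ, hχχ, RCLike.conj_to_real]
    ring
  -- As `y` spans the kernel, subtracting its component changes neither `A z` nor the value of the
  -- form, and places `z'` in the complement of `y`, where the form splits as `-μ²⟨χ, ·⟩²` plus a
  -- positive part. Negativity at `z'` is `α < β`.
  set z' := z - ((inner ℝ y z : ℝ) / ‖y‖ ^ 2) • y with hz'
  have hyn : ‖y‖ ^ 2 ≠ 0 := by positivity
  have hyz : inner ℝ y z' = (0 : ℝ) := by
    rw [hz', inner_sub_right, inner_smul_right, real_inner_self_eq_norm_sq]; field_simp; simp
  have hAz : A z' = A z := by simp [hz', hAy]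
  have hqz : inner ℝ (A z') z' = inner ℝ (A z) z := by
    rw [hAz, hs, hAz, ← hs]
  set q := (inner ℝ (A z) z : ℝ) with hq
  set β := μ ^ 2 * (inner ℝ χ z' : ℝ) ^ 2 with hβ
  set mz := z' - (inner ℝ χ z' : ℝ) • χ with hmz
  set α := (inner ℝ (A mz) mz : ℝ) with hα
  have hα0 : 0 ≤ α := hpos0 _ (hdec _ hyz)
  have hαβ : α < β := by
    have := hform z' z' hyz hyz
    rw [hqz] at this
    nlinarith
  have hβ0 : 0 < β := by linarith
  set θ := (β - α) / β with hθ
  have hθ0 : 0 < θ := div_pos (by linarith) hβ0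
  set k := θ / 2 * min δ (μ ^ 2) with hk
  have hmin : 0 < min δ (μ ^ 2) := lt_min hδ hμ2
  have hk0 : 0 < k := by positivity
  -- A reversed Cauchy–Schwarz argument. For `g` that is `A`-orthogonal to `z'`, the positive parts
  -- satisfy `⟨A mz, m⟩ = μ²⟨χ, z'⟩b`, hence `β μ²b² ≤ αγ`: the negative part of `⟨Ag, g⟩` consumes
  -- at most the fraction `α/β < 1` of the positive part `γ`.
  have hg : ∀ g, inner ℝ y g = 0 → inner ℝ (A z) g = 0 → k * ‖g‖ ^ 2 ≤ inner ℝ (A g) g := by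
    intro g hyg hzg
    set b := (inner ℝ χ g : ℝ) with hb
    set m := g - b • χ with hm
    have hmM : m ∈ M := hdec g hyg
    set γ := (inner ℝ (A m) m : ℝ) with hγ
    have h1 : inner ℝ (A g) g = -μ ^ 2 * b * b + γ := hform g g hyg hyg
    have h2 : (0 : ℝ) = -μ ^ 2 * inner ℝ χ z' * b + inner ℝ (A mz) m := by
      rw [← hform z' g hyz hyg, hAz, hzg]
    have h3 := inner_sq_le_of_nonneg_on hs hpos0 (hdec _ hyz) hmM
    have h4 : β * (μ ^ 2 * b ^ 2) ≤ α * γ := by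
      have : (inner ℝ (A mz) m : ℝ) = μ ^ 2 * inner ℝ χ z' * b := by linarith
      rw [this] at h3
      calc β * (μ ^ 2 * b ^ 2) = (μ ^ 2 * inner ℝ χ z' * b) ^ 2 := by rw [hβ]; ring
        _ ≤ _ := h3
    have h5 : δ * ‖m‖ ^ 2 ≤ γ := hpos m hmM
    have hγ0 : 0 ≤ γ := hpos0 m hmM
    have h6 : θ * γ ≤ inner ℝ (A g) g := by
      rw [h1, hθ, div_mul_eq_mul_div, div_le_iff₀ hβ0]; nlinarith
    have h7 : μ ^ 2 * b ^ 2 ≤ γ := by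
      have : β * (μ ^ 2 * b ^ 2) ≤ β * γ := h4.trans (by gcongr)
      exact le_of_mul_le_mul_left this hβ0
    have h8 : ‖g‖ ^ 2 = b ^ 2 + ‖m‖ ^ 2 := by
      have hgm : g = b • χ + m := by rw [hm]; abel
      have h0 : inner ℝ (b • χ) m = (0 : ℝ) := by
        rw [inner_smul_left, ((hMiff m).1 hmM).1]; simp
      rw [hgm, norm_add_sq_real, h0, norm_smul, hχ1]
      simp
    have h9 : min δ (μ ^ 2) * ‖g‖ ^ 2 ≤ 2 * γ := by
      rw [h8]
      have a1 : min δ (μ ^ 2) * b ^ 2 ≤ μ ^ 2 * b ^ 2 := by gcongr; exact min_le_right _ _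
      have a2 : min δ (μ ^ 2) * ‖m‖ ^ 2 ≤ δ * ‖m‖ ^ 2 := by gcongr; exact min_le_left _ _
      linarith
    calc k * ‖g‖ ^ 2 = θ / 2 * (min δ (μ ^ 2) * ‖g‖ ^ 2) := by rw [hk]; ring
      _ ≤ θ / 2 * (2 * γ) := by gcongr
      _ = θ * γ := by ring
      _ ≤ _ := h6
  -- Split `h = a z' + g` with `g` `A`-orthogonal to `z'`, so that `⟨Ah, h⟩ = a²q + ⟨Ag, g⟩` and `a
  -- = ⟨Az, h⟩/q`. The constant pays for `a²q` and for the part `a²‖z'‖²` of `‖h‖²`; the factor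
  -- `1/2` comes from `‖h‖² ≤ 2a²‖z'‖² + 2‖g‖²`.
  refine ⟨k / 2, (-q + k * ‖z'‖ ^ 2) / q ^ 2, by positivity, by
    apply div_nonneg _ (sq_nonneg _)
    have : 0 ≤ k * ‖z'‖ ^ 2 := by positivity
    linarith, fun h hyh => ?_⟩
  have hq0 : q ≠ 0 := hz.ne
  set a := (inner ℝ (A z) h : ℝ) / q with ha
  set g := h - a • z' with hgd
  have hzz : (inner ℝ (A z) z' : ℝ) = q := by rw [← hAz, hqz]
  have g1 : inner ℝ y g = (0 : ℝ) := by
    rw [hgd, inner_sub_right, inner_smul_right, hyh, hyz]; simp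
  have g2 : inner ℝ (A z) g = (0 : ℝ) := by
    rw [hgd, inner_sub_right, inner_smul_right, hzz, ha]; field_simp; simp
  have hh : h = a • z' + g := by rw [hgd]; abel
  have e1 : (inner ℝ (A h) h : ℝ) = a ^ 2 * q + inner ℝ (A g) g := by
    have e2 : (inner ℝ (A g) z' : ℝ) = 0 := by rw [hs, hAz, real_inner_comm, g2]
    rw [hh]
    simp only [map_add, map_smul, inner_add_left, inner_add_right, inner_smul_left,
      inner_smul_right, hAz, hzz, g2, e2, RCLike.conj_to_real]
    ring
  have e3 : ‖h‖ ^ 2 ≤ 2 * (a ^ 2 * ‖z'‖ ^ 2) + 2 * ‖g‖ ^ 2 := by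
    have : ‖h‖ ≤ |a| * ‖z'‖ + ‖g‖ := by
      rw [hh]; refine (norm_add_le _ _).trans ?_; rw [norm_smul, Real.norm_eq_abs]
    have h2 : ‖h‖ ^ 2 ≤ (|a| * ‖z'‖ + ‖g‖) ^ 2 := by gcongr
    have h3 : |a| ^ 2 = a ^ 2 := sq_abs a
    nlinarith [sq_nonneg (|a| * ‖z'‖ - ‖g‖)]
  have e4 := hg g g1 g2
  have e5 : (-q + k * ‖z'‖ ^ 2) / q ^ 2 * inner ℝ (A z) h ^ 2 = (-q + k * ‖z'‖ ^ 2) * a ^ 2 := by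
    rw [ha]; field_simp
  rw [e1, e5]
  nlinarith

end Spectral

/-! ### Distributional and classical derivatives of continuous functions -/

section WeakDerivative

/-- Since `φ` has compact support inside the interval, `φ f` extended by zero is differentiable on
the whole line, and its derivative integrates to zero. -/
theorem integral_deriv_mul_of_hasDerivAt {f g : ℝ → ℝ} {T : ℝ}
    (hg : ContinuousOn g (Ioo 0 T)) (hfg : ∀ t ∈ Ioo 0 T, HasDerivAt f (g t) t)
    {φ : ℝ → ℝ} (hφ : ContDiff ℝ ∞ φ) (hc : HasCompactSupport φ) (hs : tsupport φ ⊆ Ioo 0 T) :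
    -∫ t in Ioo 0 T, deriv φ t * f t = ∫ t in Ioo 0 T, φ t * g t := by
  have hf : ContinuousOn f (Ioo 0 T) := fun t ht => (hfg t ht).continuousAt.continuousWithinAt
  have hd1 : Differentiable ℝ φ := hφ.differentiable (by simp)
  have hφ' : Continuous (deriv φ) := hφ.continuous_deriv (by simp)
  have hs' : tsupport (deriv φ) ⊆ tsupport φ := tsupport_deriv_subset
  have hout : ∀ t, t ∉ Ioo 0 T → φ t = 0 := fun t ht =>
    image_eq_zero_of_notMem_tsupport fun h => ht (hs h)
  have hout' : ∀ t, t ∉ Ioo 0 T → deriv φ t = 0 := fun t ht =>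
    image_eq_zero_of_notMem_tsupport fun h => ht (hs (hs' h))
  have c1 : Continuous fun t => deriv φ t * f t := by
    refine continuous_of_tsupport fun t ht => ?_
    have : t ∈ Ioo 0 T := hs (hs' (tsupport_mul_subset_left ht))
    exact hφ'.continuousAt.mul (hf.continuousAt (isOpen_Ioo.mem_nhds this))
  have c2 : Continuous fun t => φ t * g t := by
    refine continuous_of_tsupport fun t ht => ?_
    have : t ∈ Ioo 0 T := hs (tsupport_mul_subset_left ht)
    exact hφ.continuous.continuousAt.mul (hg.continuousAt (isOpen_Ioo.mem_nhds this))
  have c3 : Continuous fun t => φ t * f t := by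
    refine continuous_of_tsupport fun t ht => ?_
    have : t ∈ Ioo 0 T := hs (tsupport_mul_subset_left ht)
    exact hφ.continuous.continuousAt.mul (hf.continuousAt (isOpen_Ioo.mem_nhds this))
  have i1 := c1.integrable_of_hasCompactSupport (μ := volume) (hc.deriv.mul_right)
  have i2 := c2.integrable_of_hasCompactSupport (μ := volume) (hc.mul_right)
  have i3 := c3.integrable_of_hasCompactSupport (μ := volume) (hc.mul_right)
  have hder : ∀ t, HasDerivAt (fun t => φ t * f t) (deriv φ t * f t + φ t * g t) t := by
    intro t
    by_cases ht : t ∈ Ioo 0 T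
    · exact (hd1 t).hasDerivAt.mul (hfg t ht)
    · have h0 : t ∉ tsupport φ := fun h => ht (hs h)
      rw [hout t ht, hout' t ht, zero_mul, zero_mul, add_zero]
      refine (hasDerivAt_const t (0 : ℝ)).congr_of_eventuallyEq ?_
      filter_upwards [(isClosed_tsupport φ).isOpen_compl.mem_nhds h0] with x hx
      rw [image_eq_zero_of_notMem_tsupport hx, zero_mul]
  have h := integral_eq_zero_of_hasDerivAt_of_integrable hder (i1.add i2) i3
  rw [integral_add i1 i2] at h
  rw [setIntegral_eq_integral_of_forall_compl_eq_zero (fun t ht => by rw [hout' t ht, zero_mul]),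
    setIntegral_eq_integral_of_forall_compl_eq_zero (fun t ht => by rw [hout t ht, zero_mul])]
  linarith

/-- The du Bois-Reymond lemma for continuous functions. -/
theorem eqOn_const_of_integral_deriv_mul_eq_zero {k : ℝ → ℝ} {T : ℝ} (hT : 0 < T)
    (hk : ContinuousOn k (Ioo 0 T))
    (h : ∀ φ : ℝ → ℝ, ContDiff ℝ ∞ φ → HasCompactSupport φ → tsupport φ ⊆ Ioo 0 T →
      ∫ t, deriv φ t * k t = 0) : ∃ C, ∀ t ∈ Ioo 0 T, k t = C := by
  let b : ContDiffBump (T / 2) := ⟨T / 8, T / 4, by positivity, by linarith⟩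
  set ψ := b.normed volume with hψ
  have hψs : ContDiff ℝ ∞ ψ := b.contDiff_normed
  have hψc : HasCompactSupport ψ := b.hasCompactSupport_normed
  have hψi : ∫ t, ψ t = 1 := b.integral_normed
  have hψt : tsupport ψ = Icc (T / 4) (3 * T / 4) := by
    rw [hψ, b.tsupport_normed_eq, Real.closedBall_eq_Icc]
    congr 1 <;> simp only [b] <;> ring
  have hmulc : ∀ η : ℝ → ℝ, Continuous η → tsupport η ⊆ Ioo 0 T →
      Continuous fun t => η t * k t := fun η hη hηs => continuous_of_tsupport fun t ht =>
    hη.continuousAt.mul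
      (hk.continuousAt (isOpen_Ioo.mem_nhds (hηs (tsupport_mul_subset_left ht))))
  have hψsub : tsupport ψ ⊆ Ioo 0 T := by
    rw [hψt]; intro t ht; exact ⟨by linarith [ht.1], by linarith [ht.2]⟩
  set C := ∫ t, ψ t * k t with hC
  refine ⟨C, ?_⟩
  have hae : ∀ᵐ t ∂(volume : Measure ℝ), t ∈ Ioo 0 T → k t - C = 0 := by
    refine isOpen_Ioo.ae_eq_zero_of_integral_contDiff_smul_eq_zero
      ((hk.sub continuousOn_const).locallyIntegrableOn measurableSet_Ioo) ?_
    intro η hη hηc hηs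
    set c := ∫ t, η t with hc
    have hηi : Integrable η := hη.continuous.integrable_of_hasCompactSupport hηc
    have hψint : Integrable ψ := hψs.continuous.integrable_of_hasCompactSupport hψc
    -- Subtracting a multiple of the normalised bump `ψ` makes the test function mean-free, so its
    -- primitive `φ` has compact support in the interval and is itself an admissible test function.
    set ξ : ℝ → ℝ := fun t => η t - c * ψ t with hξ
    have hξs : ContDiff ℝ ∞ ξ := hη.sub (contDiff_const.mul hψs)
    have hξi : Integrable ξ := hηi.sub (hψint.const_mul c)
    have hξ0 : ∫ t, ξ t = 0 := by
      rw [hξ, integral_sub hηi (hψint.const_mul c), integral_const_mul, hψi, mul_one, sub_self]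
    set K := tsupport η ∪ tsupport ψ with hKd
    have hKc : IsCompact K := hηc.union hψc
    have hKne : K.Nonempty := ⟨T / 4, Or.inr (by rw [hψt]; constructor <;> linarith)⟩
    have hKs : K ⊆ Ioo 0 T := union_subset hηs hψsub
    have ha := hKs (hKc.sInf_mem hKne)
    have hb := hKs (hKc.sSup_mem hKne)
    set a := sInf K
    set b' := sSup K
    have hKab : ∀ t ∈ K, a ≤ t ∧ t ≤ b' := fun t ht =>
      ⟨csInf_le hKc.bddBelow ht, le_csSup hKc.bddAbove ht⟩
    have hξz : ∀ t, t ∉ K → ξ t = 0 := fun t ht => by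
      rw [hξ]; dsimp only
      rw [image_eq_zero_of_notMem_tsupport fun h => ht (Or.inl h),
        image_eq_zero_of_notMem_tsupport fun h => ht (Or.inr h)]; ring
    set φ : ℝ → ℝ := fun t => ∫ s in a..t, ξ s with hφ
    have hφd : ∀ t, HasDerivAt φ (ξ t) t := fun t =>
      intervalIntegral.integral_hasDerivAt_right (hξs.continuous.intervalIntegrable _ _)
        hξs.continuous.stronglyMeasurable.stronglyMeasurableAtFilter hξs.continuous.continuousAt
    have hφ' : deriv φ = ξ := funext fun t => (hφd t).deriv
    have hφs : ContDiff ℝ ∞ φ := by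
      rw [contDiff_infty_iff_deriv]
      exact ⟨fun t => (hφd t).differentiableAt, hφ' ▸ hξs⟩
    have hφz : ∀ t, t ∉ Icc a b' → φ t = 0 := by
      intro t ht
      rcases lt_or_ge t a with h1 | h1
      · have : ∀ s ∈ uIcc a t, s ≠ a → ξ s = 0 := by
          intro s hs hne
          rw [uIcc_of_ge h1.le] at hs
          exact hξz s fun hK => hne (le_antisymm hs.2 (hKab s hK).1)
        rw [hφ]; dsimp only
        rw [intervalIntegral.integral_congr_ae (g := fun _ => 0), intervalIntegral.integral_zero]
        have h2 : ∀ᵐ s ∂(volume : Measure ℝ), s ≠ a := by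
          simp [ae_iff]
        filter_upwards [h2] with s hs hs2
        exact this s (uIoc_subset_uIcc hs2) hs
      · have h2 : b' < t := by
          by_contra! h3; exact ht ⟨h1, h3⟩
        rw [hφ]; dsimp only
        rw [intervalIntegral.integral_of_le h1, ← integral_Icc_eq_integral_Ioc,
          setIntegral_eq_integral_of_forall_compl_eq_zero, hξ0]
        intro s hs
        exact hξz s fun hK => hs ⟨(hKab s hK).1, (hKab s hK).2.trans h2.le⟩
    have hφt : tsupport φ ⊆ Icc a b' := closure_minimal (fun t ht => by
      by_contra hn; exact ht (hφz t hn)) isClosed_Icc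
    have hz := h φ hφs (HasCompactSupport.of_support_subset_isCompact isCompact_Icc
      (subset_closure.trans hφt)) (fun t ht => ⟨ha.1.trans_le (hφt ht).1, (hφt ht).2.trans_lt hb.2⟩)
    rw [hφ'] at hz
    have i1 := (hmulc η hη.continuous hηs).integrable_of_hasCompactSupport (μ := volume)
      (hηc.mul_right)
    have i2 := (hmulc ψ hψs.continuous hψsub).integrable_of_hasCompactSupport (μ := volume)
      (hψc.mul_right)
    have e1 : ∫ t, ξ t * k t = (∫ t, η t * k t) - c * C := by
      rw [hC, ← integral_const_mul, ← integral_sub i1 (i2.const_mul c)]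
      congr 1; ext t; simp only [hξ]; ring
    have e2 : ∫ t, η t • (k t - C) = (∫ t, η t * k t) - c * C := by
      rw [hc, ← integral_mul_const, ← integral_sub i1 (hηi.mul_const C)]
      congr 1; ext t; simp only [smul_eq_mul]; ring
    rw [e2, ← e1, hz]
  have hres : ∀ᵐ t ∂(volume.restrict (Ioo 0 T)), k t = C := by
    rw [ae_restrict_iff' measurableSet_Ioo]
    filter_upwards [hae] with t ht hm
    linarith [ht hm]
  exact Measure.eqOn_open_of_ae_eq hres isOpen_Ioo hk continuousOn_const

/-- The difference of `f` and a primitive of `g` has vanishing weak derivative, hence is constant.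
This lets weak solutions be differentiated classically when tested against the domain of `Ĵ`. -/
theorem hasDerivAt_of_weak {f g : ℝ → ℝ} {T : ℝ} (hT : 0 < T)
    (hf : ContinuousOn f (Ioo 0 T)) (hg : ContinuousOn g (Ioo 0 T))
    (h : ∀ φ : ℝ → ℝ, ContDiff ℝ ∞ φ → HasCompactSupport φ → tsupport φ ⊆ Ioo 0 T →
      -∫ t in Ioo 0 T, deriv φ t * f t = ∫ t in Ioo 0 T, φ t * g t) :
    ∀ t ∈ Ioo 0 T, HasDerivAt f (g t) t := by
  set F : ℝ → ℝ := fun t => ∫ s in (T / 2)..t, g s with hF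
  have hm : T / 2 ∈ Ioo 0 T := ⟨by linarith, by linarith⟩
  have hFd : ∀ t ∈ Ioo 0 T, HasDerivAt F (g t) t := by
    intro t ht
    have hsub : uIcc (T / 2) t ⊆ Ioo 0 T := ordConnected_Ioo.uIcc_subset hm ht
    exact intervalIntegral.integral_hasDerivAt_right ((hg.mono hsub).intervalIntegrable)
      (hg.stronglyMeasurableAtFilter isOpen_Ioo t ht) (hg.continuousAt (isOpen_Ioo.mem_nhds ht))
  have hFc : ContinuousOn F (Ioo 0 T) := fun t ht => (hFd t ht).continuousAt.continuousWithinAt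
  obtain ⟨C, hC⟩ := eqOn_const_of_integral_deriv_mul_eq_zero (k := fun t => f t - F t) hT
    (hf.sub hFc) (by
      intro φ hφ hc hs
      have h1 := h φ hφ hc hs
      have h2 := integral_deriv_mul_of_hasDerivAt hg hFd hφ hc hs
      have hφ' : Continuous (deriv φ) := hφ.continuous_deriv (by simp)
      have hs' : tsupport (deriv φ) ⊆ tsupport φ := tsupport_deriv_subset
      have hout' : ∀ t, t ∉ Ioo 0 T → deriv φ t = 0 := fun t ht =>
        image_eq_zero_of_notMem_tsupport fun h => ht (hs (hs' h))
      have hmulc : ∀ k : ℝ → ℝ, ContinuousOn k (Ioo 0 T) →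
          Integrable fun t => deriv φ t * k t := fun k hk =>
        (continuous_of_tsupport fun t ht => hφ'.continuousAt.mul (hk.continuousAt
          (isOpen_Ioo.mem_nhds (hs (hs' (tsupport_mul_subset_left ht)))))
        : Continuous _).integrable_of_hasCompactSupport hc.deriv.mul_right
      rw [setIntegral_eq_integral_of_forall_compl_eq_zero
        (fun t ht => by rw [hout' t ht, zero_mul])] at h1 h2
      have e : ∫ t, deriv φ t * (f t - F t) =
          (∫ t, deriv φ t * f t) - ∫ t, deriv φ t * F t := by
        rw [← integral_sub (hmulc f hf) (hmulc F hFc)]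
        congr 1; ext t; ring
      rw [e]; linarith)
  intro t ht
  have := (hFd t ht).add_const C
  refine this.congr_of_eventuallyEq ?_
  filter_upwards [isOpen_Ioo.mem_nhds ht] with s hs
  linarith [hC s hs]

end WeakDerivative

/-! ### The symmetry group on `X` and its restrictions to `V` and `W` -/

namespace HamiltonianData

variable {X V W F : Type*}
    [NormedAddCommGroup X] [InnerProductSpace ℝ X] [CompleteSpace X]
    [NormedAddCommGroup V] [NormedSpace ℝ V]
    [NormedAddCommGroup W] [NormedSpace ℝ W]
    [NormedAddCommGroup F] [NormedSpace ℝ F]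
    {S : HamiltonianData X V W}

section Group

theorem T_sub (s : ℝ) (u v : X) : S.T s u - S.T s v = (S.T s).linear (u - v) :=
  ((S.T s).linearMap_vsub u v).symm

theorem T_eq (s : ℝ) (u : X) : S.T s u = (S.T s).linear u + S.T s 0 := by
  have := T_sub (S := S) s u 0
  rw [sub_zero] at this
  rw [← this]; abel

theorem lin_zero (h : S.SymmetryAssumption) (x : X) : (S.T 0).linear x = x := by
  have := T_sub (S := S) 0 x 0
  rw [h.map_zero, h.map_zero, sub_zero] at this
  exact this.symm

theorem lin_add (h : S.SymmetryAssumption) (s r : ℝ) (x : X) :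
    (S.T (s + r)).linear x = (S.T s).linear ((S.T r).linear x) := by
  have h1 := T_sub (S := S) (s + r) x 0
  rw [h.map_add, h.map_add, T_sub, T_sub, sub_zero] at h1
  exact h1.symm

theorem lin_lin_neg (h : S.SymmetryAssumption) (s : ℝ) (x : X) :
    (S.T s).linear ((S.T (-s)).linear x) = x := by
  rw [← lin_add h, add_neg_cancel, lin_zero h]

theorem inner_lin (h : S.SymmetryAssumption) (s : ℝ) (x y : X) :
    inner ℝ ((S.T s).linear x) y = inner ℝ x ((S.T (-s)).linear y) := by
  rw [← h.unitary_X s x, lin_lin_neg h]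

theorem norm_lin (h : S.SymmetryAssumption) (s : ℝ) (x : X) : ‖(S.T s).linear x‖ = ‖x‖ := by
  have := h.unitary_X s x x
  rw [real_inner_self_eq_norm_sq, real_inner_self_eq_norm_sq] at this
  exact (sq_eq_sq₀ (norm_nonneg _) (norm_nonneg _)).1 this

end Group

/-- `TF` is the restriction of the symmetry group to the space `F` embedded in `X` by `j`, and acts
there by isometries, strongly continuously. -/
structure IsRestriction (S : HamiltonianData X V W) (j : F →L[ℝ] X) (TF : ℝ → F → F) : Prop where
  injective : Function.Injective j
  map : ∀ s v, j (TF s v) = S.T s (j v)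
  isometry : ∀ s v, ‖TF s v - TF s 0‖ = ‖v‖
  continuous : ∀ v, Continuous fun s : ℝ => TF s v

theorem injective_iW (h : S.SpacesAssumption) : Function.Injective S.iW :=
  h.injective_iV.comp h.injective_iWV

theorem isRestriction_V (hs : S.SpacesAssumption) (h : S.SymmetryAssumption) :
    S.IsRestriction S.iV S.TV :=
  ⟨hs.injective_iV, h.invariant_V, h.isometry_V, h.continuous_V⟩

theorem isRestriction_W (hs : S.SpacesAssumption) (h : S.SymmetryAssumption) :
    S.IsRestriction S.iW S.TW :=
  ⟨injective_iW hs, h.invariant_W, h.isometry_W, h.continuous_W⟩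

theorem iWV_TW (hs : S.SpacesAssumption) (h : S.SymmetryAssumption) (s : ℝ) (w : W) :
    S.iWV (S.TW s w) = S.TV s (S.iWV w) := by
  apply hs.injective_iV
  rw [h.invariant_V]
  exact h.invariant_W s w

namespace IsRestriction

variable {j : F →L[ℝ] X} {TF : ℝ → F → F}

theorem zero (hr : S.IsRestriction j TF) (h : S.SymmetryAssumption) (v : F) : TF 0 v = v :=
  hr.injective (by rw [hr.map, h.map_zero])

theorem add (hr : S.IsRestriction j TF) (h : S.SymmetryAssumption) (s r : ℝ) (v : F) :
    TF (s + r) v = TF s (TF r v) :=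
  hr.injective (by rw [hr.map, hr.map, hr.map, h.map_add])

theorem neg_apply (hr : S.IsRestriction j TF) (h : S.SymmetryAssumption) (s : ℝ) (v : F) :
    TF (-s) (TF s v) = v := by
  rw [← hr.add h, neg_add_cancel, hr.zero h]

theorem apply_neg (hr : S.IsRestriction j TF) (h : S.SymmetryAssumption) (s : ℝ) (v : F) :
    TF s (TF (-s) v) = v := by
  rw [← hr.add h, add_neg_cancel, hr.zero h]

theorem sub (hr : S.IsRestriction j TF) (s : ℝ) (u v : F) :
    TF s u - TF s v = TF s (u - v) - TF s 0 :=
  hr.injective (by simp only [map_sub, hr.map, T_sub, map_zero, sub_zero])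

theorem norm_sub (hr : S.IsRestriction j TF) (s : ℝ) (u v : F) :
    ‖TF s u - TF s v‖ = ‖u - v‖ := by
  rw [hr.sub, hr.isometry]

theorem norm_sub_comm (hr : S.IsRestriction j TF) (h : S.SymmetryAssumption) (s : ℝ) (u v : F) :
    ‖TF s u - v‖ = ‖u - TF (-s) v‖ := by
  conv_lhs => rw [← hr.apply_neg h s v]
  exact hr.norm_sub s _ _

/-- Each map of the group is an isometry, which upgrades strong continuity to joint continuity. -/
theorem continuous_uncurry (hr : S.IsRestriction j TF) :
    Continuous fun p : ℝ × F => TF p.1 p.2 := by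
  rw [continuous_iff_continuousAt]
  rintro ⟨s, v⟩
  rw [ContinuousAt, tendsto_iff_norm_sub_tendsto_zero]
  have h1 : Tendsto (fun p : ℝ × F => ‖p.2 - v‖ + ‖TF p.1 v - TF s v‖) (𝓝 (s, v)) (𝓝 0) := by
    have : Continuous fun p : ℝ × F => ‖p.2 - v‖ + ‖TF p.1 v - TF s v‖ :=
      (by fun_prop : Continuous fun p : ℝ × F => ‖p.2 - v‖).add
        (((hr.continuous v).comp continuous_fst).sub continuous_const).norm
    simpa using this.tendsto (s, v)
  refine squeeze_zero (fun _ => norm_nonneg _) (fun p => ?_) h1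
  rw [← hr.norm_sub p.1 p.2 v]
  exact norm_sub_le_norm_sub_add_norm_sub _ _ _

/-- The linear part of the restricted group. -/
def lin (hr : S.IsRestriction j TF) (s : ℝ) : F →ₗᵢ[ℝ] F where
  toFun v := TF s v - TF s 0
  map_add' u v := hr.injective (by
    simp only [map_sub, _root_.map_add, hr.map, T_sub, _root_.map_zero, sub_zero])
  map_smul' c v := hr.injective (by
    simp only [map_sub, _root_.map_smul, hr.map, T_sub, _root_.map_zero, sub_zero, RingHom.id_apply])
  norm_map' v := hr.isometry s v

theorem lin_apply (hr : S.IsRestriction j TF) (s : ℝ) (v : F) : hr.lin s v = TF s v - TF s 0 := rfl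

theorem map_lin (hr : S.IsRestriction j TF) (s : ℝ) (v : F) :
    j (hr.lin s v) = (S.T s).linear (j v) := by
  rw [lin_apply, map_sub, hr.map, hr.map, T_sub, _root_.map_zero, sub_zero]

/-- Vectors along which the restricted group is differentiable are dense. -/
theorem dense_differentiable [CompleteSpace F] (hr : S.IsRestriction j TF)
    (h : S.SymmetryAssumption) :
    Dense {v : F | DifferentiableAt ℝ (fun s : ℝ => TF s v) 0} := by
  intro v
  -- Averages of the orbit over `[0, r]` converge to `v`. Applying the group to such an average
  -- shifts the window of integration, up to the affine part, which cancels; the result is a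
  -- difference of primitives and so differentiable in the shift.
  set m : ℝ → F := fun r => r⁻¹ • ∫ s in (0 : ℝ)..r, TF s v with hm
  have hint : ∀ a b : ℝ, IntervalIntegrable (fun s => TF s v) volume a b := fun a b =>
    (hr.continuous v).intervalIntegrable a b
  have hd : ∀ a : ℝ, HasDerivAt (fun x => ∫ s in (0 : ℝ)..x, TF s v) (TF a v) a := fun a =>
    intervalIntegral.integral_hasDerivAt_right (hint _ _)
      (hr.continuous v).stronglyMeasurable.stronglyMeasurableAtFilter (hr.continuous v).continuousAt
  have htend : Tendsto m (𝓝[>] 0) (𝓝 v) := by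
    have h1 := (hd 0).tendsto_slope_zero_right
    rw [hr.zero h] at h1
    simpa [hm] using h1
  refine mem_closure_of_tendsto htend ?_
  filter_upwards [self_mem_nhdsWithin] with r (hr0 : 0 < r)
  have key : ∀ σ, TF σ (m r) = r⁻¹ • ((∫ s in (0 : ℝ)..(r + σ), TF s v) -
      ∫ s in (0 : ℝ)..σ, TF s v) := by
    intro σ
    have e1 : TF σ (m r) = hr.lin σ (m r) + TF σ 0 := by rw [lin_apply]; abel
    have e2 : (hr.lin σ).toContinuousLinearMap (∫ s in (0 : ℝ)..r, TF s v) =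
        ∫ s in (0 : ℝ)..r, hr.lin σ (TF s v) :=
      ((hr.lin σ).toContinuousLinearMap.intervalIntegral_comp_comm (hint 0 r)).symm
    have e3 : ∫ s in (0 : ℝ)..r, hr.lin σ (TF s v) =
        (∫ s in (0 : ℝ)..r, TF (s + σ) v) - r • TF σ 0 := by
      have : r • TF σ 0 = ∫ s in (0 : ℝ)..r, TF σ 0 := by simp
      rw [this, ← intervalIntegral.integral_sub _ intervalIntegrable_const]
      · simp only [lin_apply, add_comm _ σ, hr.add h]
      · exact ((hr.continuous v).comp (continuous_add_const σ)).intervalIntegrable _ _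
    have e4 : ∫ s in (0 : ℝ)..r, TF (s + σ) v = ∫ s in σ..(r + σ), TF s v := by
      simp [intervalIntegral.integral_comp_add_right (fun s => TF s v) σ]
    rw [e1, hm]
    dsimp only
    rw [_root_.map_smul]
    change r⁻¹ • ((hr.lin σ).toContinuousLinearMap (∫ s in (0 : ℝ)..r, TF s v)) + TF σ 0 = _
    rw [e2, e3, e4, smul_sub, smul_smul, inv_mul_cancel₀ hr0.ne', one_smul, sub_add_cancel,
      intervalIntegral.integral_interval_sub_left (hint _ _) (hint _ _)]
  change DifferentiableAt ℝ (fun σ => TF σ (m r)) 0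
  rw [funext key]
  have d1 : HasDerivAt (fun σ => ∫ s in (0 : ℝ)..(r + σ), TF s v) (TF (r + 0) v) 0 :=
    HasDerivAt.comp_const_add r 0 (hd (r + 0))
  exact ((d1.sub (hd 0)).const_smul r⁻¹).differentiableAt

end IsRestriction

/-! ### Generators and the operator `ĴI` -/

section Generators

theorem exists_affine_deriv (h : S.SymmetryAssumption) :
    ∃ a' : X, HasDerivAt (fun s : ℝ => S.T s 0) a' 0 := by
  have h1 : DifferentiableAt ℝ (fun s : ℝ => S.TW s 0) 0 :=
    (h.contDiff_affine.differentiable (by norm_num)).differentiableAt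
  have h2 := S.iW.hasFDerivAt.comp_hasDerivAt 0 h1.hasDerivAt
  refine ⟨_, h2.congr_of_eventuallyEq (Eventually.of_forall fun s => ?_)⟩
  simp [h.invariant_W]

theorem Gen.unique {u y z : X} (hy : S.Gen u y) (hz : S.Gen u z) : y = z := HasDerivAt.unique hy hz

/-- By unitarity the group can be moved onto `x`. Orbits of arbitrary `u` are therefore
differentiable when tested against the domain of the generator; `u` itself needs no regularity. -/
theorem LinGen.hasDerivAt_inner_lin (h : S.SymmetryAssumption) {x x' : X} (hx : S.LinGen x x')
    (u : X) : HasDerivAt (fun s : ℝ => (inner ℝ ((S.T s).linear u) x : ℝ)) (-inner ℝ u x') 0 := by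
  have h1 : HasDerivAt (fun s : ℝ => (S.T (-s)).linear x) (-x') 0 := by
    have h0 : HasDerivAt (fun s : ℝ => (S.T s).linear x) x' (-0) := by rw [neg_zero]; exact hx
    have h1 := h0.scomp (0 : ℝ) (hasDerivAt_neg (0 : ℝ))
    rw [neg_one_smul] at h1
    exact h1
  have h2 := (hasDerivAt_const (0 : ℝ) u).inner ℝ h1
  simpa [inner_lin h] using h2

theorem LinGen.hasDerivAt_inner_T (h : S.SymmetryAssumption) {x x' a' : X} (hx : S.LinGen x x')
    (ha : HasDerivAt (fun s : ℝ => S.T s 0) a' 0) (u : X) (s : ℝ) :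
    HasDerivAt (fun s : ℝ => (inner ℝ (S.T s u) x : ℝ)) (inner ℝ a' x - inner ℝ (S.T s u) x') s := by
  have h1 := (hx.hasDerivAt_inner_lin h (S.T s u)).add
    (ha.inner ℝ (hasDerivAt_const (0 : ℝ) x))
  have h2 : HasDerivAt (fun r : ℝ => (inner ℝ (S.T (r + s) u) x : ℝ))
      (inner ℝ a' x - inner ℝ (S.T s u) x') 0 := by
    refine (h1.congr_of_eventuallyEq (Eventually.of_forall fun r => ?_)).congr_deriv ?_
    · rw [h.map_add, T_eq r, Pi.add_apply, inner_add_left]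
    · simp; ring
  have h3 : HasDerivAt (fun r : ℝ => (inner ℝ (S.T (r + s) u) x : ℝ))
      (inner ℝ a' x - inner ℝ (S.T s u) x') (s - s) := by rwa [sub_self]
  have h4 := h3.comp_sub_const s s
  simpa using h4

/-- Skew-adjointness of the generator, with the contribution `a'` of the affine part. -/
theorem gen_inner (h : S.SymmetryAssumption) {x x' a' u y : X} (hx : S.LinGen x x')
    (ha : HasDerivAt (fun s : ℝ => S.T s 0) a' 0) (hy : S.Gen u y) :
    (inner ℝ a' x - inner ℝ u x' : ℝ) = inner ℝ y x := by
  have h1 := hx.hasDerivAt_inner_T h ha u 0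
  rw [h.map_zero] at h1
  have h2 := HasDerivAt.inner ℝ hy (hasDerivAt_const (0 : ℝ) x)
  simpa using h1.unique h2

theorem exists_linGen_of_domW (h : S.SymmetryAssumption) {k : W} (hk : k ∈ S.domW) :
    ∃ y, S.LinGen (S.iW k) y := by
  obtain ⟨a', ha⟩ := exists_affine_deriv h
  have h2 := (S.iW.hasFDerivAt.comp_hasDerivAt 0 (DifferentiableAt.hasDerivAt hk)).sub ha
  refine ⟨_, HasDerivAt.congr_of_eventuallyEq h2 (Eventually.of_forall fun s => ?_)⟩
  simp [h.invariant_W, T_sub]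

/-- Here the equality of domains in `ĴI dT'(0) = dT'(0) ĴI` is needed: regularity of `ĴIx` under the
group passes back to `x`. -/
theorem exists_linGen_of_JI (h : S.SymmetryAssumption) {k : W} (hk : k ∈ S.domW) {x : X}
    (hx : S.JI x (S.iW k)) : ∃ x', S.LinGen x x' := by
  obtain ⟨z, hz⟩ := exists_linGen_of_domW h hk
  obtain ⟨x', h1, -⟩ := (h.commute_generator x z).2 ⟨_, hx, hz⟩
  exact ⟨x', h1⟩

theorem domV_of_domW (hs : S.SpacesAssumption) (h : S.SymmetryAssumption) {k : W}
    (hk : k ∈ S.domW) : S.iWV k ∈ S.domV := by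
  have h1 := S.iWV.differentiableAt.comp (0 : ℝ) hk
  refine DifferentiableAt.congr_of_eventuallyEq h1 (Eventually.of_forall fun s => ?_)
  exact (iWV_TW hs h s k).symm

theorem isOpen_OV (hs : S.SpacesAssumption) : IsOpen S.OV := hs.isOpen_O.preimage S.iV.continuous

theorem isOpen_OW (hs : S.SpacesAssumption) : IsOpen S.OW := hs.isOpen_O.preimage S.iW.continuous

theorem TV_mem_OV (h : S.SymmetryAssumption) {u : V} (hu : u ∈ S.OV) (s : ℝ) : S.TV s u ∈ S.OV := by
  change S.iV (S.TV s u) ∈ S.O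
  rw [h.invariant_V]; exact h.invariant_O s _ hu

theorem TW_mem_OW (h : S.SymmetryAssumption) {u : W} (hu : u ∈ S.OW) (s : ℝ) : S.TW s u ∈ S.OW := by
  change S.iW (S.TW s u) ∈ S.O
  rw [h.invariant_W]; exact h.invariant_O s _ hu

theorem dense_range_iV (h : S.SymmetryAssumption) : DenseRange S.iV :=
  h.dense_range.mono (by rintro _ ⟨⟨w, -, rfl⟩, -⟩; exact ⟨S.iWV w, rfl⟩)

theorem ext_on_V (h : S.SymmetryAssumption) {f g : StrongDual ℝ X}
    (hfg : ∀ v : V, f (S.iV v) = g (S.iV v)) : f = g :=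
  DFunLike.coe_injective ((dense_range_iV h).equalizer f.continuous g.continuous (funext hfg))

theorem JI.mem {x y : X} (h : S.JI x y) : InnerProductSpace.toDual ℝ X x ∈ S.Jhat.domain :=
  LinearPMap.mem_domain_of_mem_graph h

theorem JI.apply {x y : X} (h : S.JI x y) : S.Jhat ⟨_, h.mem⟩ = y := by
  obtain ⟨z, hz1, hz2⟩ := (LinearPMap.mem_graph_iff _).1 h
  have e : (⟨_, h.mem⟩ : S.Jhat.domain) = z := Subtype.ext hz1.symm
  rw [e]; exact hz2

end Generators

/-! ### Equivariance of `∇E` and invariance of the momentum -/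

section Invariance

theorem differentiableAt_E (hs : S.SpacesAssumption) (hf : S.FunctionalsAssumption) {u : V}
    (hu : u ∈ S.OV) : DifferentiableAt ℝ S.E u :=
  (hf.contDiffOn_E.contDiffAt ((isOpen_OV hs).mem_nhds hu)).differentiableAt (by norm_num)

theorem differentiableAt_P (hs : S.SpacesAssumption) (hf : S.FunctionalsAssumption) {u : V}
    (hu : u ∈ S.OV) : DifferentiableAt ℝ S.P u :=
  (hf.contDiffOn_P.contDiffAt ((isOpen_OV hs).mem_nhds hu)).differentiableAt (by norm_num)

theorem hasFDerivAt_TV (hr : S.IsRestriction S.iV S.TV) (s : ℝ) (u : V) :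
    HasFDerivAt (S.TV s) (hr.lin s).toContinuousLinearMap u := by
  have h1 := ((hr.lin s).toContinuousLinearMap.hasFDerivAt (x := u)).add_const (S.TV s 0)
  refine h1.congr_of_eventuallyEq (Eventually.of_forall fun v => ?_)
  simp [hr.lin_apply]

/-- Equivariance of `∇E`. -/
theorem gradE_lin (hs : S.SpacesAssumption) (hf : S.FunctionalsAssumption)
    (h : S.SymmetryAssumption) {u : V} (hu : u ∈ S.OV) (s : ℝ) (x : X) :
    S.gradE (S.TV s u) ((S.T s).linear x) = S.gradE u x := by
  have hr := isRestriction_V hs h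
  have h1 := (differentiableAt_E hs hf (TV_mem_OV h hu s)).hasFDerivAt.comp u (hasFDerivAt_TV hr s u)
  have h2 : HasFDerivAt S.E ((fderiv ℝ S.E (S.TV s u)).comp (hr.lin s).toContinuousLinearMap) u := by
    refine h1.congr_of_eventuallyEq ?_
    filter_upwards [(isOpen_OV hs).mem_nhds hu] with v hv
    exact (h.energy_invariant v hv s).symm
  have hL : Continuous fun x => (S.T s).linear x :=
    (AddMonoidHomClass.isometry_of_norm (S.T s).linear (norm_lin h s)).continuous
  refine congrFun ((dense_range_iV h).equalizer
    (g := fun x => S.gradE (S.TV s u) ((S.T s).linear x)) (h := fun x => S.gradE u x)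
    ((S.gradE _).continuous.comp hL) (S.gradE u).continuous (funext fun v => ?_)) x
  simp only [Function.comp_apply]
  rw [← hr.map_lin, hf.gradE_extends _ (TV_mem_OV h hu s), hf.gradE_extends _ hu, h2.fderiv]
  rfl

/-- The weak form of `T'(0)v = J(v)∇P(v)`. -/
theorem gen_eq_gradP [CompleteSpace V] (hs : S.SpacesAssumption) (hp : S.PoissonAssumption)
    (hf : S.FunctionalsAssumption)
    (h : S.SymmetryAssumption) {x x' a' y : X} (hx : S.LinGen x x')
    (ha : HasDerivAt (fun s : ℝ => S.T s 0) a' 0) (hJ : S.JI x y) {v : V} (hv : v ∈ S.OV) :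
    (inner ℝ a' x - inner ℝ (S.iV v) x' : ℝ) = -S.gradP v (S.B v y) := by
  have hr := isRestriction_V hs h
  have hd := hr.dense_differentiable h
  have hB : ContinuousOn S.B S.OV := hp.contDiffOn_B.continuousOn
  -- On differentiable vectors the identity is `T'(0)v = J(v)∇P(v)` tested against `x`, with both
  -- operators moved to the other side by skewness. In this form both sides are continuous in `v ∈
  -- V`, so density extends it to all of `O ∩ V`.
  have key : EqOn (fun v => (inner ℝ a' x - inner ℝ (S.iV v) x' : ℝ))
      (fun v => -S.gradP v (S.B v y)) (S.OV ∩ S.domV) := by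
    rintro v ⟨hv, hvd⟩
    obtain ⟨hP, hG⟩ := h.generator v hv hvd
    have h1 := gen_inner h hx ha hG
    dsimp only
    rw [h1, real_inner_comm]
    have h2 := hp.skew v hv ⟨_, hP⟩ ⟨_, hJ.mem⟩
    simp only [InnerProductSpace.toDual_apply_apply] at h2
    rw [h2, J, hJ.apply]
  have hsub : S.OV ⊆ closure (S.OV ∩ S.domV) := hd.open_subset_closure_inter (isOpen_OV hs)
  refine key.of_subset_closure ?_ ?_ inter_subset_left hsub hv
  · fun_prop
  · exact (hf.continuousOn_gradP.clm_apply (hB.clm_apply continuousOn_const)).neg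

/-- The derivative of `P` along the orbit is `∇P(v)` applied to `J(v)∇P(v)`, which vanishes by
skew-symmetry. -/
theorem P_TV_of_domV (hs : S.SpacesAssumption) (hp : S.PoissonAssumption)
    (hf : S.FunctionalsAssumption) (h : S.SymmetryAssumption) {v : V} (hv : v ∈ S.OV)
    (hd : v ∈ S.domV) (s : ℝ) : S.P (S.TV s v) = S.P v := by
  have hr := isRestriction_V hs h
  have hder : ∀ s, HasDerivAt (fun s => S.P (S.TV s v)) 0 s := by
    intro s
    have hsO := TV_mem_OV h hv s
    have d0 : HasDerivAt (fun r => S.TV r v) (deriv (fun r => S.TV r v) 0) 0 :=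
      DifferentiableAt.hasDerivAt hd
    have d1 : HasDerivAt (fun r => S.TV r (S.TV s v)) (hr.lin s (deriv (fun r => S.TV r v) 0)) 0 := by
      have e : (fun r => S.TV r (S.TV s v)) = fun r => S.TV s (S.TV r v) := by
        ext r; rw [← hr.add h, add_comm, hr.add h]
      rw [e]
      exact (hasFDerivAt_TV hr s (S.TV 0 v)).comp_hasDerivAt (0 : ℝ) d0
    set y := hr.lin s (deriv (fun r => S.TV r v) 0)
    obtain ⟨hP, hG⟩ := h.generator _ hsO d1.differentiableAt
    have hy : S.iV y = S.J (S.TV s v) ⟨_, hP⟩ := by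
      have h3 := S.iV.hasFDerivAt.comp_hasDerivAt (0 : ℝ) d1
      refine Gen.unique (S := S) (u := S.iV (S.TV s v)) ?_ hG
      refine HasDerivAt.congr_of_eventuallyEq h3 (Eventually.of_forall fun r => ?_)
      simp [h.invariant_V]
    have h0 : fderiv ℝ S.P (S.TV s v) y = 0 := by
      rw [← hf.gradP_extends _ hsO, hy]
      have := hp.skew _ hsO ⟨_, hP⟩ ⟨_, hP⟩
      simp only at this
      linarith
    have hz : S.TV 0 (S.TV s v) = S.TV s v := hr.zero h _
    have d2 : HasDerivAt (fun r => S.P (S.TV r (S.TV s v))) 0 0 := by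
      have h4 : HasFDerivAt S.P (fderiv ℝ S.P (S.TV s v)) (S.TV 0 (S.TV s v)) := by
        rw [hz]; exact (differentiableAt_P hs hf hsO).hasFDerivAt
      have := h4.comp_hasDerivAt (0 : ℝ) d1
      rwa [h0] at this
    have d3 : HasDerivAt (fun r => S.P (S.TV r (S.TV s v))) 0 (s - s) := by rwa [sub_self]
    have d4 := d3.comp_sub_const s s
    simpa [← hr.add h] using d4
  have hc := is_const_of_deriv_eq_zero (f := fun s => S.P (S.TV s v))
    (fun s => (hder s).differentiableAt) (fun s => (hder s).deriv) s 0
  simpa [hr.zero h] using hc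

/-- Momentum is conserved by the group. -/
theorem P_TV [CompleteSpace V] (hs : S.SpacesAssumption) (hp : S.PoissonAssumption)
    (hf : S.FunctionalsAssumption) (h : S.SymmetryAssumption) {v : V} (hv : v ∈ S.OV)
    (s : ℝ) : S.P (S.TV s v) = S.P v := by
  have hr := isRestriction_V hs h
  have hsub : S.OV ⊆ closure (S.OV ∩ S.domV) :=
    (hr.dense_differentiable h).open_subset_closure_inter (isOpen_OV hs)
  have key : EqOn (fun v => S.P (S.TV s v)) S.P (S.OV ∩ S.domV) := fun v hv =>
    P_TV_of_domV hs hp hf h hv.1 hv.2 s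
  refine key.of_subset_closure ?_ hf.contDiffOn_P.continuousOn inter_subset_left hsub hv
  refine hf.contDiffOn_P.continuousOn.comp (fun v _ => ?_) (fun v hv => TV_mem_OV h hv s)
  exact (hasFDerivAt_TV hr s v).continuousAt.continuousWithinAt

theorem augE_TV [CompleteSpace V] (hs : S.SpacesAssumption) (hp : S.PoissonAssumption)
    (hf : S.FunctionalsAssumption) (h : S.SymmetryAssumption) {v : V} (hv : v ∈ S.OV)
    (c s : ℝ) : S.augE c (S.TV s v) = S.augE c v := by
  rw [augE, augE, h.energy_invariant v hv, P_TV hs hp hf h hv]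

end Invariance

end HamiltonianData

/-! ### Solutions: pointwise form, concatenation, exit in finite time -/

/-- Used at the junction of two solutions, where the derivative is known only on either side but has
a continuous candidate value. -/
theorem hasDerivAt_of_eventually_ne {f g : ℝ → ℝ} {a : ℝ}
    (hd : ∀ᶠ t in 𝓝[≠] a, HasDerivAt f (g t) t) (hf : ContinuousAt f a) (hg : ContinuousAt g a) :
    HasDerivAt f (g a) a := by
  obtain ⟨s, hs, hsd⟩ : ∃ s ∈ 𝓝 a, ∀ t ∈ s, t ≠ a → HasDerivAt f (g t) t := by
    rw [eventually_nhdsWithin_iff] at hd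
    exact ⟨_, hd, fun t ht hne => ht hne⟩
  have h1 : HasDerivWithinAt f (g a) (Ici a) a := by
    refine hasDerivWithinAt_Ici_of_tendsto_deriv (s := s ∩ Ioi a) (fun t ht =>
      (hsd t ht.1 (ne_of_gt ht.2)).differentiableAt.differentiableWithinAt)
      hf.continuousWithinAt (inter_mem (mem_nhdsWithin_of_mem_nhds hs) self_mem_nhdsWithin) ?_
    refine (hg.tendsto.mono_left nhdsWithin_le_nhds).congr' ?_
    filter_upwards [mem_nhdsWithin_of_mem_nhds hs, self_mem_nhdsWithin] with t ht ht'
    exact (hsd t ht (ne_of_gt ht')).deriv.symm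
  have h2 : HasDerivWithinAt f (g a) (Iic a) a := by
    refine hasDerivWithinAt_Iic_of_tendsto_deriv (s := s ∩ Iio a) (fun t ht =>
      (hsd t ht.1 (ne_of_lt ht.2)).differentiableAt.differentiableWithinAt)
      hf.continuousWithinAt (inter_mem (mem_nhdsWithin_of_mem_nhds hs) self_mem_nhdsWithin) ?_
    refine (hg.tendsto.mono_left nhdsWithin_le_nhds).congr' ?_
    filter_upwards [mem_nhdsWithin_of_mem_nhds hs, self_mem_nhdsWithin] with t ht ht'
    exact (hsd t ht (ne_of_lt ht')).deriv.symm
  have := h1.union h2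
  rwa [union_comm, Iic_union_Ici, hasDerivWithinAt_univ] at this

namespace HamiltonianData

variable {X V W F : Type*}
    [NormedAddCommGroup X] [InnerProductSpace ℝ X] [CompleteSpace X]
    [NormedAddCommGroup V] [NormedSpace ℝ V]
    [NormedAddCommGroup W] [NormedSpace ℝ W]
    {S : HamiltonianData X V W}

theorem continuousOn_flux (hp : S.PoissonAssumption) (hf : S.FunctionalsAssumption)
    {u : ℝ → W} {D : Set ℝ} (hu : ContinuousOn u D) (hm : ∀ t ∈ D, u t ∈ S.OW)
    (w : S.Jhat.domain) :
    ContinuousOn (fun t => -(S.gradE (S.iWV (u t)) (S.J (S.iWV (u t)) w))) D := by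
  have h1 : ContinuousOn (fun t => S.iWV (u t)) D := S.iWV.continuous.comp_continuousOn hu
  have h2 : MapsTo (fun t => S.iWV (u t)) D S.OV := fun t ht => hm t ht
  exact ((hf.continuousOn_gradE.comp h1 h2).clm_apply
    ((hp.contDiffOn_B.continuousOn.comp h1 h2).clm_apply continuousOn_const)).neg

theorem IsSolution.hasDerivAt (hp : S.PoissonAssumption) (hf : S.FunctionalsAssumption)
    {t₀ : ℝ} {u₀ : W} {u : ℝ → W} (h : S.IsSolution t₀ u₀ u) (w : S.Jhat.domain) {t : ℝ}
    (ht : t ∈ Ioo 0 t₀) :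
    HasDerivAt (fun t => (w : StrongDual ℝ X) (S.iW (u t)))
      (-(S.gradE (S.iWV (u t)) (S.J (S.iWV (u t)) w))) t := by
  have hc : ContinuousOn u (Ioo 0 t₀) := h.continuousOn.mono Ioo_subset_Ico_self
  refine hasDerivAt_of_weak (g := fun t => -(S.gradE (S.iWV (u t)) (S.J (S.iWV (u t)) w)))
    (ht.1.trans ht.2) ?_ ?_ (h.weak w) t ht
  · exact ((w : StrongDual ℝ X).continuous.comp S.iW.continuous).comp_continuousOn hc
  · exact continuousOn_flux hp hf hc (fun t ht => h.mem t (Ioo_subset_Ico_self ht)) w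

theorem isSolution_of_hasDerivAt (hp : S.PoissonAssumption) (hf : S.FunctionalsAssumption)
    {t₀ : ℝ} {u₀ : W} {u : ℝ → W} (hc : ContinuousOn u (Ico 0 t₀)) (hm : ∀ t ∈ Ico 0 t₀, u t ∈ S.OW)
    (h0 : u 0 = u₀) (hd : ∀ (w : S.Jhat.domain), ∀ t ∈ Ioo 0 t₀,
      HasDerivAt (fun t => (w : StrongDual ℝ X) (S.iW (u t)))
        (-(S.gradE (S.iWV (u t)) (S.J (S.iWV (u t)) w))) t)
    (hE : ∀ t ∈ Ico 0 t₀, S.E (S.iWV (u t)) = S.E (S.iWV u₀))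
    (hP : ∀ t ∈ Ico 0 t₀, S.P (S.iWV (u t)) = S.P (S.iWV u₀)) : S.IsSolution t₀ u₀ u where
  continuousOn := hc
  mem := hm
  initial := h0
  weak w _ hφ hφc hφs := integral_deriv_mul_of_hasDerivAt
    ((continuousOn_flux hp hf hc hm w).mono Ioo_subset_Ico_self) (hd w) hφ hφc hφs
  energy := hE
  momentum := hP

/-- Concatenation of solutions. -/
theorem IsSolution.concat (hp : S.PoissonAssumption) (hf : S.FunctionalsAssumption)
    {t₁ t₀ τ : ℝ} {u₀ : W} {u v : ℝ → W} (hu : S.IsSolution t₁ u₀ u) (h0 : 0 < τ) (h1 : τ < t₁)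
    (hv : S.IsSolution t₀ (u τ) v) :
    S.IsSolution (τ + t₀) u₀ (fun t => if t < τ then u t else v (t - τ)) := by
  set z : ℝ → W := fun t => if t < τ then u t else v (t - τ) with hz
  have zl : ∀ t, t < τ → z t = u t := fun t ht => if_pos ht
  have zr : ∀ t, τ ≤ t → z t = v (t - τ) := fun t ht => if_neg (not_lt.2 ht)
  have hsh : ∀ t, τ ≤ t → t < τ + t₀ → t - τ ∈ Ico 0 t₀ := fun t h2 h3 =>
    ⟨by linarith, by linarith⟩
  have hc : ContinuousOn z (Ico 0 (τ + t₀)) := by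
    refine ContinuousOn.if ?_ ?_ ?_
    · rintro t ⟨-, ht⟩
      rw [show {a | a < τ} = Iio τ from rfl, frontier_Iio, mem_singleton_iff] at ht
      rw [ht, sub_self, hv.initial]
    · refine hu.continuousOn.mono ?_
      rintro t ⟨ht, ht2⟩
      rw [show {a | a < τ} = Iio τ from rfl, closure_Iio, mem_Iic] at ht2
      exact ⟨ht.1, ht2.trans_lt h1⟩
    · refine hv.continuousOn.comp (by fun_prop) ?_
      rintro t ⟨ht, ht2⟩
      rw [show {a | ¬ a < τ} = Ici τ by ext; simp, closure_Ici, mem_Ici] at ht2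
      exact hsh t ht2 ht.2
  have hm : ∀ t ∈ Ico 0 (τ + t₀), z t ∈ S.OW := by
    intro t ht
    rcases lt_or_ge t τ with h | h
    · rw [zl t h]; exact hu.mem t ⟨ht.1, h.trans h1⟩
    · rw [zr t h]; exact hv.mem _ (hsh t h ht.2)
  have hτ : u τ = u τ := rfl
  refine isSolution_of_hasDerivAt hp hf hc hm ?_ ?_ ?_ ?_
  · rw [zl 0 h0, hu.initial]
  · intro w
    have hne : ∀ t ∈ Ioo 0 (τ + t₀), t ≠ τ →
        HasDerivAt (fun t => (w : StrongDual ℝ X) (S.iW (z t)))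
        (-(S.gradE (S.iWV (z t)) (S.J (S.iWV (z t)) w))) t := by
      intro t ht hne
      rcases lt_or_gt_of_ne hne with h | h
      · rw [zl t h]
        refine (hu.hasDerivAt hp hf w ⟨ht.1, h.trans h1⟩).congr_of_eventuallyEq ?_
        filter_upwards [Iio_mem_nhds h] with r hr
        rw [zl r hr]
      · rw [zr t h.le]
        refine ((hv.hasDerivAt hp hf w (t := t - τ)
          ⟨by linarith, by linarith [ht.2]⟩).comp_sub_const t τ).congr_of_eventuallyEq ?_
        filter_upwards [Ioi_mem_nhds h] with r hr
        rw [zr r (le_of_lt hr)]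
    intro t ht
    rcases eq_or_ne t τ with rfl | h
    · have hn : Ico 0 (t + t₀) ∈ 𝓝 t := Ico_mem_nhds ht.1 ht.2
      refine hasDerivAt_of_eventually_ne
        (g := fun t => -(S.gradE (S.iWV (z t)) (S.J (S.iWV (z t)) w))) ?_ ?_ ?_
      · rw [eventually_nhdsWithin_iff]
        filter_upwards [Ioo_mem_nhds ht.1 ht.2] with r hr hrn using hne r hr hrn
      · exact ((w : StrongDual ℝ X).continuous.comp S.iW.continuous).continuousAt.comp
          (hc.continuousAt hn)
      · exact (continuousOn_flux hp hf hc hm w).continuousAt hn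
    · exact hne t ht h
  · intro t ht
    rcases lt_or_ge t τ with h | h
    · rw [zl t h]; exact hu.energy t ⟨ht.1, h.trans h1⟩
    · rw [zr t h, hv.energy _ (hsh t h ht.2), hu.energy τ ⟨h0.le, h1⟩]
  · intro t ht
    rcases lt_or_ge t τ with h | h
    · rw [zl t h]; exact hu.momentum t ⟨ht.1, h.trans h1⟩
    · rw [zr t h, hv.momentum _ (hsh t h ht.2), hu.momentum τ ⟨h0.le, h1⟩]

/-- If solutions can be continued by a uniform amount of time from any point of `K`, and no solution
stays in `K` beyond a fixed time, then solutions starting in `K` exit it in finite time. -/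
theorem exits_of_bounded_stay (hp : S.PoissonAssumption) (hf : S.FunctionalsAssumption)
    {K : Set W} {t₀ : ℝ} (ht₀ : 0 < t₀) (hloc : ∀ u₀ ∈ K, ∃ u, S.IsSolution t₀ u₀ u)
    {u₀ : W} (hu₀ : u₀ ∈ K) {τ₀ : ℝ}
    (hstay : ∀ t t₁ : ℝ, 0 ≤ t → t < t₁ → ∀ u, S.IsSolution t₁ u₀ u → (∀ r ∈ Icc 0 t, u r ∈ K) →
      t ≤ τ₀) : S.ExitsInFiniteTime K u₀ := by
  set Q : Set ℝ := {t | 0 ≤ t ∧ ∃ t₁, t < t₁ ∧ ∃ u, S.IsSolution t₁ u₀ u ∧ ∀ r ∈ Icc 0 t, u r ∈ K}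
    with hQ
  have hQ0 : (0 : ℝ) ∈ Q := by
    obtain ⟨u, hu⟩ := hloc u₀ hu₀
    refine ⟨le_rfl, t₀, ht₀, u, hu, fun r hr => ?_⟩
    rw [Icc_self, mem_singleton_iff] at hr
    rw [hr, hu.initial]; exact hu₀
  have hQb : BddAbove Q := ⟨τ₀, by
    rintro t ⟨h0, t₁, h1, u, hu, hr⟩
    exact hstay t t₁ h0 h1 u hu hr⟩
  have hs0 : 0 ≤ sSup Q := le_csSup hQb hQ0
  -- A solution still in `K` at a time within `t₀/2` of the supremum can be continued by `t₀`, hence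
  -- past `sSup Q + t₀/4`. Any solution remaining in `K` up to that time would contradict the
  -- supremum. The case `t = 0` is separate because concatenation requires a positive junction time.
  obtain ⟨t, htQ, ht⟩ := exists_lt_of_lt_csSup ⟨0, hQ0⟩
    (show sSup Q - t₀ / 2 < sSup Q by linarith)
  refine ⟨sSup Q + t₀ / 4, by linarith, ⟨t + t₀, by linarith, ?_⟩, ?_⟩
  · obtain ⟨h0, t₁, h1, u, hu, hr⟩ := htQ
    rcases h0.eq_or_lt with rfl | h0
    · obtain ⟨v, hv⟩ := hloc u₀ hu₀
      exact ⟨v, by rwa [zero_add]⟩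
    · obtain ⟨v, hv⟩ := hloc (u t) (hr t ⟨h0.le, le_rfl⟩)
      exact ⟨_, hu.concat hp hf h0 h1 hv⟩
  · intro t₁ h1 u hu
    by_contra! hcon
    have : sSup Q + t₀ / 4 ∈ Q := ⟨by linarith, t₁, h1, u, hu, hcon⟩
    linarith [le_csSup hQb this]

end HamiltonianData

/-! ### Bound states as critical points, and the negative direction -/

namespace HamiltonianData

variable {X V W F : Type*}
    [NormedAddCommGroup X] [InnerProductSpace ℝ X] [CompleteSpace X]
    [NormedAddCommGroup V] [NormedSpace ℝ V]
    [NormedAddCommGroup W] [NormedSpace ℝ W]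
    {S : HamiltonianData X V W}

theorem gen_boundState (hs : S.SpacesAssumption) (h : S.SymmetryAssumption) {A : Set ℝ} {U : ℝ → W}
    (hb : S.BoundStateAssumption A U) {c : ℝ} (hc : c ∈ A) :
    ∃ hP : S.gradP (S.iWV (U c)) ∈ S.Jhat.domain,
      S.Gen (S.iW (U c)) (S.J (S.iWV (U c)) ⟨_, hP⟩) :=
  h.generator _ (hb.mem c hc) (domV_of_domW hs h (hb.dom_W c hc))

theorem gradP_J_eq (hs : S.SpacesAssumption) (hp : S.PoissonAssumption) (h : S.SymmetryAssumption)
    {A : Set ℝ} {U : ℝ → W}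
    (hb : S.BoundStateAssumption A U) {c : ℝ} (hc : c ∈ A) {y : X} (hy : S.Gen (S.iW (U c)) y)
    (w : S.Jhat.domain) : (w : StrongDual ℝ X) y =
      -S.gradP (S.iWV (U c)) (S.J (S.iWV (U c)) w) := by
  obtain ⟨hP, hG⟩ := gen_boundState hs h hb hc
  rw [hy.unique hG]
  exact hp.skew _ (hb.mem c hc) ⟨_, hP⟩ w

/-- Bound states are critical points of the augmented Hamiltonian. -/
theorem gradE_boundState (hs : S.SpacesAssumption) (hp : S.PoissonAssumption)
    (hf : S.FunctionalsAssumption) (h : S.SymmetryAssumption) {A : Set ℝ} {U : ℝ → W}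
    (hb : S.BoundStateAssumption A U) {c : ℝ} (hc : c ∈ A) :
    S.gradE (S.iWV (U c)) = c • S.gradP (S.iWV (U c)) := by
  have hr := isRestriction_W hs h
  obtain ⟨hP, hG⟩ := gen_boundState hs h hb hc
  set y := S.J (S.iWV (U c)) ⟨_, hP⟩ with hy
  have hUm := hb.mem c hc
  have key : ∀ w : S.Jhat.domain, S.gradE (S.iWV (U c)) (S.J (S.iWV (U c)) w) =
      c * S.gradP (S.iWV (U c)) (S.J (S.iWV (U c)) w) := by
    intro w
    have hsol := (hb.boundState c hc).2 1 one_pos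
    set u : ℝ → W := fun t => S.TW (c * t) (U c) with hu
    have huc : Continuous u := (hr.continuous (U c)).comp (continuous_const.mul continuous_id)
    have hum : ∀ t ∈ (univ : Set ℝ), u t ∈ S.OW := fun t _ => TW_mem_OW h hUm _
    have hg := (continuousOn_flux hp hf huc.continuousOn hum w).continuousAt (x := 0) univ_mem
    -- The derivative at time `0` is computed twice: from the group (`d1`), and from the equation
    -- (`d2`). The equation is available only for positive times, so the second is a one-sided limit
    -- of derivatives.
    have d1 : HasDerivAt (fun t => (w : StrongDual ℝ X) (S.iW (u t))) (c * (w : StrongDual ℝ X) y) 0 := by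
      have e1 : HasDerivAt (fun t : ℝ => c * t) c 0 := by
        simpa using (hasDerivAt_id (0 : ℝ)).const_mul c
      have e2 : HasDerivAt (fun s : ℝ => S.T s (S.iW (U c))) y (c * 0) := by rw [mul_zero]; exact hG
      have e3 := (w : StrongDual ℝ X).hasFDerivAt.comp_hasDerivAt (0 : ℝ) (e2.scomp (0 : ℝ) e1)
      rw [_root_.map_smul, smul_eq_mul] at e3
      refine e3.congr_of_eventuallyEq (Eventually.of_forall fun t => ?_)
      simp [hu, h.invariant_W]
    have d2 : HasDerivWithinAt (fun t => (w : StrongDual ℝ X) (S.iW (u t)))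
        (-(S.gradE (S.iWV (u 0)) (S.J (S.iWV (u 0)) w))) (Ici 0) 0 := by
      refine hasDerivWithinAt_Ici_of_tendsto_deriv (s := Ioo 0 1) (fun t ht =>
        (hsol.hasDerivAt hp hf w ht).differentiableAt.differentiableWithinAt)
        d1.continuousAt.continuousWithinAt (Ioo_mem_nhdsGT one_pos) ?_
      refine (hg.tendsto.mono_left nhdsWithin_le_nhds).congr' ?_
      filter_upwards [Ioo_mem_nhdsGT (one_pos : (0 : ℝ) < 1)] with t ht
      exact (hsol.hasDerivAt hp hf w ht).deriv.symm
    have e := (uniqueDiffWithinAt_Ici (0 : ℝ)).eq_deriv _ d1.hasDerivWithinAt d2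
    have hu0 : u 0 = U c := by simp [hu, hr.zero h]
    rw [hu0, gradP_J_eq hs hp h hb hc hG] at e
    linarith
  -- The two functionals agree on the range of `J(U_c)`, which is dense because `Ĵ` has dense range
  -- and `B(U_c)` is onto.
  have hdense : Dense (S.B (S.iWV (U c)) '' range S.Jhat) :=
    (hp.bijective_B _ hUm).2.denseRange.dense_image (S.B (S.iWV (U c))).continuous
      (h.dense_range.mono inter_subset_right)
  refine DFunLike.coe_injective (Continuous.ext_on hdense (S.gradE _).continuous
    (c • S.gradP (S.iWV (U c))).continuous ?_)
  rintro _ ⟨_, ⟨w, rfl⟩, rfl⟩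
  exact key w

theorem hasFDerivAt_augE (hs : S.SpacesAssumption) (hf : S.FunctionalsAssumption) (c : ℝ) {u : V}
    (hu : u ∈ S.OV) : HasFDerivAt (S.augE c) (fderiv ℝ S.E u - c • fderiv ℝ S.P u) u :=
  (differentiableAt_E hs hf hu).hasFDerivAt.sub
    ((differentiableAt_P hs hf hu).hasFDerivAt.const_smul c)

theorem contDiffOn_augE (hf : S.FunctionalsAssumption) (c : ℝ) : ContDiffOn ℝ 3 (S.augE c) S.OV :=
  hf.contDiffOn_E.sub (contDiffOn_const.mul hf.contDiffOn_P)

theorem fderiv_augE_apply (hs : S.SpacesAssumption) (hf : S.FunctionalsAssumption) (c : ℝ) {u : V}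
    (hu : u ∈ S.OV) (v : V) :
    fderiv ℝ (S.augE c) u v = S.gradE u (S.iV v) - c * S.gradP u (S.iV v) := by
  rw [(hasFDerivAt_augE hs hf c hu).fderiv, hf.gradE_extends u hu, hf.gradP_extends u hu]
  simp

theorem fderiv_augE_boundState (hs : S.SpacesAssumption) (hp : S.PoissonAssumption)
    (hf : S.FunctionalsAssumption) (h : S.SymmetryAssumption) {A : Set ℝ} {U : ℝ → W}
    (hb : S.BoundStateAssumption A U) {c : ℝ} (hc : c ∈ A) :
    fderiv ℝ (S.augE c) (S.iWV (U c)) = 0 := by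
  ext v
  rw [fderiv_augE_apply hs hf c (u := S.iWV (U c)) (hb.mem c hc), gradE_boundState hs hp hf h hb hc]
  simp

theorem hasDerivAt_iWV_U {A : Set ℝ} {U : ℝ → W} (hb : S.BoundStateAssumption A U) {c : ℝ}
    (hc : c ∈ A) : HasDerivAt (fun c => S.iWV (U c)) (S.iWV (deriv U c)) c := by
  have h1 : DifferentiableAt ℝ U c :=
    (hb.contDiffOn.contDiffAt (hb.isOpen.mem_nhds hc)).differentiableAt (by norm_num)
  exact S.iWV.hasFDerivAt.comp_hasDerivAt c h1.hasDerivAt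

/-- Since `U_c` is critical for `E_c`, only the explicit dependence on `c` survives in the first
derivative: `d'(c) = -P(U_c)`. -/
theorem deriv_deriv_moment (hs : S.SpacesAssumption) (hp : S.PoissonAssumption)
    (hf : S.FunctionalsAssumption) (h : S.SymmetryAssumption) {A : Set ℝ} {U : ℝ → W}
    (hb : S.BoundStateAssumption A U) {c : ℝ} (hc : c ∈ A) :
    deriv (deriv (S.moment U)) c = -fderiv ℝ S.P (S.iWV (U c)) (S.iWV (deriv U c)) := by
  have h1 : ∀ c ∈ A, deriv (S.moment U) c = -S.P (S.iWV (U c)) := by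
    intro c hc
    have hm : S.iWV (U c) ∈ S.OV := hb.mem c hc
    have hU := hasDerivAt_iWV_U hb hc
    have e1 := (differentiableAt_E hs hf hm).hasFDerivAt.comp_hasDerivAt c hU
    have e2 := (differentiableAt_P hs hf hm).hasFDerivAt.comp_hasDerivAt c hU
    have e3 := e1.sub ((hasDerivAt_id c).mul e2)
    have e4 : deriv (S.moment U) c = _ := e3.deriv
    rw [e4]
    have e5 := fderiv_augE_boundState hs hp hf h hb hc
    rw [(hasFDerivAt_augE hs hf c hm).fderiv] at e5
    have e6 := DFunLike.congr_fun e5 (S.iWV (deriv U c))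
    simp at e6 ⊢
    linarith
  have h2 : deriv (S.moment U) =ᶠ[𝓝 c] fun c => -S.P (S.iWV (U c)) := by
    filter_upwards [hb.isOpen.mem_nhds hc] with r hr using h1 r hr
  rw [h2.deriv_eq]
  exact ((differentiableAt_P hs hf (hb.mem c hc)).hasFDerivAt.comp_hasDerivAt c
    (hasDerivAt_iWV_U hb hc)).neg.deriv

/-- Obtained by differentiating `DE(U_c) - c DP(U_c) = 0` in `c`. It ties `d''(c)` to the sign of
the second variation at `U_c'`. -/
theorem second_variation_deriv (hs : S.SpacesAssumption) (hp : S.PoissonAssumption)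
    (hf : S.FunctionalsAssumption) (h : S.SymmetryAssumption) {A : Set ℝ} {U : ℝ → W}
    (hb : S.BoundStateAssumption A U) {c : ℝ} (hc : c ∈ A) :
    fderiv ℝ (fderiv ℝ (S.augE c)) (S.iWV (U c)) (S.iWV (deriv U c)) =
      fderiv ℝ S.P (S.iWV (U c)) := by
  have hm : S.iWV (U c) ∈ S.OV := hb.mem c hc
  have hmn := (isOpen_OV hs).mem_nhds hm
  have dE : DifferentiableAt ℝ (fderiv ℝ S.E) (S.iWV (U c)) :=
    ((hf.contDiffOn_E.contDiffAt hmn).fderiv_right (m := 2) (by norm_num)).differentiableAt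
      (by norm_num)
  have dP : DifferentiableAt ℝ (fderiv ℝ S.P) (S.iWV (U c)) :=
    ((hf.contDiffOn_P.contDiffAt hmn).fderiv_right (m := 2) (by norm_num)).differentiableAt
      (by norm_num)
  have e1 : fderiv ℝ (fderiv ℝ (S.augE c)) (S.iWV (U c)) =
      fderiv ℝ (fderiv ℝ S.E) (S.iWV (U c)) - c • fderiv ℝ (fderiv ℝ S.P) (S.iWV (U c)) := by
    have : fderiv ℝ (S.augE c) =ᶠ[𝓝 (S.iWV (U c))] fun u => fderiv ℝ S.E u - c • fderiv ℝ S.P u := by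
      filter_upwards [hmn] with u hu using (hasFDerivAt_augE hs hf c hu).fderiv
    rw [this.fderiv_eq]
    exact (dE.hasFDerivAt.sub (dP.hasFDerivAt.const_smul c)).fderiv
  have hU := hasDerivAt_iWV_U hb hc
  have e2 := (dE.hasFDerivAt.comp_hasDerivAt c hU).sub
    ((hasDerivAt_id c).smul (dP.hasFDerivAt.comp_hasDerivAt c hU))
  have e3 := e2.congr_of_eventuallyEq (f₁ := fun _ : ℝ => (0 : V →L[ℝ] ℝ)) (by
    filter_upwards [hb.isOpen.mem_nhds hc] with r hr
    have e5 := fderiv_augE_boundState hs hp hf h hb hr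
    rw [(hasFDerivAt_augE hs hf r (u := S.iWV (U r)) (hb.mem r hr)).fderiv] at e5
    exact e5.symm)
  have e4 := e3.unique (hasDerivAt_const c 0)
  rw [e1]
  simp only [Function.comp_apply, id, one_smul] at e4
  rw [_root_.sub_apply, _root_.smul_apply]
  rw [← sub_eq_zero, sub_sub]
  exact e4

/-- The group is affine, yet the domain is a linear space because the affine part `T(s)0` is itself
differentiable in `W`. -/
theorem sub_smul_mem_domW (hs : S.SpacesAssumption) (h : S.SymmetryAssumption) {k l : W}
    (hk : k ∈ S.domW) (hl : l ∈ S.domW) (t : ℝ) : k - t • l ∈ S.domW := by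
  have hr := isRestriction_W hs h
  have h0 : DifferentiableAt ℝ (fun s : ℝ => S.TW s 0) 0 :=
    (h.contDiff_affine.differentiable (by norm_num)).differentiableAt
  have h1 : DifferentiableAt ℝ (fun s : ℝ => (S.TW s k - S.TW s 0) -
      t • (S.TW s l - S.TW s 0) + S.TW s 0) 0 :=
    ((hk.sub h0).sub ((hl.sub h0).const_smul t)).add h0
  refine h1.congr_of_eventuallyEq (Eventually.of_forall fun s => ?_)
  dsimp only
  rw [← hr.lin_apply, ← hr.lin_apply, ← map_smul, ← map_sub, hr.lin_apply]
  abel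

theorem JI.sub_smul {x y x₁ y₁ : X} (h : S.JI x y) (h₁ : S.JI x₁ y₁) (t : ℝ) :
    S.JI (x - t • x₁) (y - t • y₁) := by
  have := S.Jhat.graph.sub_mem h (S.Jhat.graph.smul_mem t h₁)
  simpa [JI] using this

/-- A continuous functional's kernel meets a dense linear set in every open region of the kernel. -/
theorem exists_mem_ker_of_dense {D : Set X} (hD : Dense D)
    (hlin : ∀ d ∈ D, ∀ e ∈ D, ∀ t : ℝ, d - t • e ∈ D) (p : StrongDual ℝ X) {O : Set X}
    (hO : IsOpen O) {z : X} (hz : z ∈ O) (hpz : p z = 0) : ∃ d ∈ D, d ∈ O ∧ p d = 0 := by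
  by_cases hp : ∃ e ∈ D, p e ≠ 0
  · obtain ⟨e, he, hpe⟩ := hp
    -- This map projects onto the kernel of `p`, preserves `D` and fixes `z`, so any point of `D`
    -- close to `z` is sent into `D ∩ O ∩ ker p`.
    have hc : Continuous fun d : X => d - (p d / p e) • e := by fun_prop
    obtain ⟨d, hd, hdD⟩ := hD.inter_open_nonempty _ (hO.preimage hc) ⟨z, by simpa [hpz] using hz⟩
    refine ⟨_, hlin d hdD e he (p d / p e), hd, ?_⟩
    simp [hpe]
  · push Not at hp
    obtain ⟨d, hd, hdD⟩ := hD.inter_open_nonempty _ hO ⟨z, hz⟩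
    exact ⟨d, hdD, hd, hp d hdD⟩

/-- If `d'' < 0` there is an admissible negative direction tangent to the level set of momentum. -/
theorem exists_negative_direction (hs : S.SpacesAssumption) (hp : S.PoissonAssumption)
    (hf : S.FunctionalsAssumption) (h : S.SymmetryAssumption) {I : Set ℝ} {U : ℝ → W}
    (hb : S.BoundStateAssumption I U) {c : ℝ} (hc : c ∈ I)
    (hd : deriv (deriv (S.moment U)) c < 0) {A : X →L[ℝ] X} (hA : IsSelfAdjoint A)
    (hH : ∀ v w : V, inner ℝ (A (S.iV v)) (S.iV w) =
      fderiv ℝ (fderiv ℝ (S.augE c)) (S.iWV (U c)) v w)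
    {μ : ℝ} {χ y : X} (hμ : 0 < μ) (hχ1 : ‖χ‖ = 1) (hχ : A χ = (-μ ^ 2) • χ)
    (hy : S.Gen (S.iW (U c)) y) :
    ∃ (k : W) (x x' : X), S.JI x (S.iW k) ∧ S.LinGen x x' ∧ inner ℝ y x = (0 : ℝ) ∧
      inner ℝ (A (S.B (S.iWV (U c)) (S.iW k))) (S.B (S.iWV (U c)) (S.iW k)) < (0 : ℝ) := by
  have hsym : ∀ x y, inner ℝ (A x) y = inner ℝ x (A y) := hA.isSymmetric
  have hm : S.iWV (U c) ∈ S.OV := hb.mem c hc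
  set u := S.iWV (U c) with hu
  set y0 := S.iV (S.iWV (deriv U c)) with hy0
  have hp0 : ∀ x, inner ℝ (A y0) x = S.gradP u x := by
    have : InnerProductSpace.toDual ℝ X (A y0) = S.gradP u := by
      refine ext_on_V h fun v => ?_
      rw [InnerProductSpace.toDual_apply_apply, hH, second_variation_deriv hs hp hf h hb hc,
        hf.gradP_extends u hm]
    intro x
    rw [← this, InnerProductSpace.toDual_apply_apply]
  set β : ℝ := inner ℝ (A y0) y0 with hβ
  have hβ0 : 0 < β := by
    rw [deriv_deriv_moment hs hp hf h hb hc, ← hf.gradP_extends u hm, ← hp0] at hd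
    linarith
  set b : ℝ := inner ℝ (A y0) χ with hbd
  -- `A y0` represents `∇P(u)`, so being `A`-orthogonal to `y0` is the same as being tangent to the
  -- momentum level. The value of the form at `z` is `-μ² - b²/β`.
  set z := χ - (b / β) • y0 with hz
  have hpz : S.gradP u z = 0 := by
    rw [← hp0, hz, inner_sub_right, inner_smul_right, ← hβ, ← hbd]; field_simp; simp
  have hqz : inner ℝ (A z) z < (0 : ℝ) := by
    have e1 : inner ℝ (A z) z = (inner ℝ (A χ) z : ℝ) := by
      have : (inner ℝ (A y0) z : ℝ) = 0 := by rw [hp0, hpz]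
      conv_lhs => rw [hz, map_sub, map_smul, inner_sub_left, inner_smul_left, ← hz, this]
      simp
    have e2 : (inner ℝ χ y0 : ℝ) * (-μ ^ 2) = b := by
      rw [hbd, hsym, hχ, inner_smul_right, real_inner_comm]; ring
    rw [e1, hχ, inner_smul_left, hz, inner_sub_right, inner_smul_right, real_inner_self_eq_norm_sq,
      hχ1]
    have e3 : (-μ ^ 2) * (1 - b / β * inner ℝ χ y0) = -μ ^ 2 - b ^ 2 / β * 1 + (b / β) * (b -
      inner ℝ χ y0 * (-μ ^ 2)) := by ring
    have : 0 ≤ b ^ 2 / β := by positivity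
    have hμ2 : 0 < μ ^ 2 := by positivity
    simp only [RCLike.conj_to_real, one_pow]
    rw [e3, e2]; linarith
  -- Admissible directions `J(u)Ix`, with `ĴIx` in the domain of the generator on `W`. They are
  -- dense and closed under linear combinations, so one exists near `z` inside the kernel of
  -- `∇P(u)`.
  set D : Set X := S.B u '' (S.iW '' S.domW ∩ range S.Jhat) with hD
  have hDd : Dense D :=
    (hp.bijective_B _ hm).2.denseRange.dense_image (S.B u).continuous h.dense_range
  have hrep : ∀ d ∈ D, ∃ k ∈ S.domW, ∃ x, S.JI x (S.iW k) ∧ d = S.B u (S.iW k) := by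
    rintro _ ⟨_, ⟨⟨k, hk, rfl⟩, ⟨w, hw⟩⟩, rfl⟩
    refine ⟨k, hk, (InnerProductSpace.toDual ℝ X).symm w, ?_, rfl⟩
    rw [JI, LinearIsometryEquiv.apply_symm_apply, ← hw]
    exact S.Jhat.mem_graph w
  have hlin : ∀ d ∈ D, ∀ e ∈ D, ∀ t : ℝ, d - t • e ∈ D := by
    intro d hd e he t
    obtain ⟨k, hk, x, hx, rfl⟩ := hrep d hd
    obtain ⟨l, hl, x₁, hx₁, rfl⟩ := hrep e he
    have hJ := hx.sub_smul hx₁ t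
    refine ⟨S.iW (k - t • l), ⟨⟨_, sub_smul_mem_domW hs h hk hl t, rfl⟩, ?_⟩, by simp⟩
    refine ⟨⟨_, hJ.mem⟩, ?_⟩
    rw [hJ.apply]; simp
  obtain ⟨d, hdD, hdO, hpd⟩ := exists_mem_ker_of_dense hDd hlin (S.gradP u)
    (O := {z | inner ℝ (A z) z < (0 : ℝ)}) (isOpen_lt (by fun_prop) continuous_const) hqz hpz
  obtain ⟨k, hk, x, hx, rfl⟩ := hrep d hdD
  obtain ⟨x', hx'⟩ := exists_linGen_of_JI h hk hx
  refine ⟨k, x, x', hx, hx', ?_, hdO⟩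
  have := gradP_J_eq hs hp h hb hc hy ⟨_, hx.mem⟩
  simp only [InnerProductSpace.toDual_apply_apply] at this
  rw [real_inner_comm, this, J, hx.apply, hpd, neg_zero]

end HamiltonianData

/-! ### Taylor expansion of `E_c` at the bound state and the drift estimate -/

/-- Second-order Taylor estimates at a critical point, for a function and its derivative. -/
theorem taylor_critical {V : Type*} [NormedAddCommGroup V] [NormedSpace ℝ V] {f : V → ℝ} {u : V}
    (hf : ContDiffAt ℝ 3 f u) (h0 : fderiv ℝ f u = 0) :
    ∃ C : ℝ, 0 ≤ C ∧ ∀ᶠ h in 𝓝 (0 : V),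
      |f (u + h) - f u - 1 / 2 * fderiv ℝ (fderiv ℝ f) u h h| ≤ C * ‖h‖ ^ 3 ∧
      ‖fderiv ℝ f (u + h) - fderiv ℝ (fderiv ℝ f) u h‖ ≤ C * ‖h‖ ^ 2 := by
  set G := fderiv ℝ (fderiv ℝ f) with hG
  have hG1 : ContDiffAt ℝ 1 G u :=
    (hf.fderiv_right (m := 2) (by norm_num)).fderiv_right (m := 1) (by norm_num)
  obtain ⟨K, t, ht, hK⟩ := hG1.exists_lipschitzOnWith
  have hev : ∀ᶠ v in 𝓝 u, ContDiffAt ℝ 3 f v := hf.eventually (by simp)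
  obtain ⟨r, hr, hball⟩ := Metric.mem_nhds_iff.1 (inter_mem ht hev)
  have hmem : ∀ h : V, ‖h‖ < r → u + h ∈ Metric.ball u r := fun h hh => by
    simpa [Metric.mem_ball, dist_eq_norm] using hh
  have hC3 : ∀ h : V, ‖h‖ < r → ContDiffAt ℝ 3 f (u + h) := fun h hh => (hball (hmem h hh)).2
  have hd1 : ∀ h : V, ‖h‖ < r → HasFDerivAt (fun h => f (u + h)) (fderiv ℝ f (u + h)) h := by
    intro h hh
    exact (hasFDerivAt_comp_add_left u).2 ((hC3 h hh).differentiableAt (by norm_num)).hasFDerivAt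
  have hd2 : ∀ h : V, ‖h‖ < r → HasFDerivAt (fun h => fderiv ℝ f (u + h)) (G (u + h)) h := by
    intro h hh
    have : ContDiffAt ℝ 2 (fderiv ℝ f) (u + h) :=
      (hC3 h hh).fderiv_right (m := 2) (by norm_num)
    exact (hasFDerivAt_comp_add_left u).2 (this.differentiableAt (by norm_num)).hasFDerivAt
  have hsymm : IsSymmSndFDerivAt ℝ f u := hf.isSymmSndFDerivAt (by simp; norm_num)
  have hut : u ∈ t := mem_of_mem_nhds ht
  have hGl : ∀ h : V, ‖h‖ < r → ‖G (u + h) - G u‖ ≤ K * ‖h‖ := fun h hh => by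
    simpa using hK.norm_sub_le (hball (hmem h hh)).1 hut
  have est2 : ∀ h : V, ‖h‖ < r → ‖fderiv ℝ f (u + h) - G u h‖ ≤ K * ‖h‖ ^ 2 := by
    intro h hh
    have := (convex_closedBall (0 : V) ‖h‖).norm_image_sub_le_of_norm_hasFDerivWithin_le
      (f := fun h => fderiv ℝ f (u + h) - G u h) (f' := fun h => G (u + h) - G u) (C := K * ‖h‖)
      (x := 0) (y := h) (fun k hk => by
        have hk' : ‖k‖ ≤ ‖h‖ := by simpa using hk
        exact ((hd2 k (hk'.trans_lt hh)).sub (G u).hasFDerivAt).hasFDerivWithinAt)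
      (fun k hk => by
        have hk' : ‖k‖ ≤ ‖h‖ := by simpa using hk
        exact (hGl k (hk'.trans_lt hh)).trans (by gcongr)) (by simp) (by simp)
    simp only [add_zero, h0, map_zero, sub_zero] at this
    rw [sq, ← mul_assoc]; exact this
  refine ⟨K, K.coe_nonneg, ?_⟩
  filter_upwards [Metric.ball_mem_nhds (0 : V) hr] with h hh
  have hh : ‖h‖ < r := by simpa using hh
  refine ⟨?_, est2 h hh⟩
  have := (convex_closedBall (0 : V) ‖h‖).norm_image_sub_le_of_norm_hasFDerivWithin_le
    (f := fun h => f (u + h) - 1 / 2 * G u h h)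
    (f' := fun h => fderiv ℝ f (u + h) - G u h) (C := K * ‖h‖ ^ 2)
    (x := 0) (y := h) (fun k hk => by
      have hk' : ‖k‖ ≤ ‖h‖ := by simpa using hk
      have e1 : HasFDerivAt (fun k => G u k k) _ k := (G u).hasFDerivAt.clm_apply (hasFDerivAt_id k)
      have e2 := (hd1 k (hk'.trans_lt hh)).sub (e1.const_mul (1 / 2))
      refine (e2.congr_fderiv ?_).hasFDerivWithinAt
      ext v
      have : G u v k = G u k v := hsymm.eq v k
      simp [this]; ring)
    (fun k hk => by
      have hk' : ‖k‖ ≤ ‖h‖ := by simpa using hk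
      exact (est2 k (hk'.trans_lt hh)).trans (by gcongr)) (by simp) (by simp)
  simp only [add_zero, map_zero, sub_zero, mul_zero] at this
  rw [Real.norm_eq_abs] at this
  calc _ = |f (u + h) - 1 / 2 * G u h h - f u| := by congr 1; ring
    _ ≤ _ := this.trans_eq (by ring)

namespace HamiltonianData

variable {X V W : Type*}
    [NormedAddCommGroup X] [InnerProductSpace ℝ X] [CompleteSpace X]
    [NormedAddCommGroup V] [NormedSpace ℝ V]
    [NormedAddCommGroup W] [NormedSpace ℝ W]
    {S : HamiltonianData X V W}

theorem norm_iW_le (w : W) : ‖S.iW w‖ ≤ (‖S.iW‖ + 1) * ‖w‖ :=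
  (S.iW.le_opNorm w).trans (by gcongr; linarith)

/-- Taylor remainders are cubic or quadratic in the `V`-norm, while coercivity controls only the
`X`-norm. These bounds turn them into `‖h‖_X²` or `‖h‖_X` times a factor `‖h‖_W`, which is small
near the orbit. -/
theorem interpolation_bounds (hs : S.SpacesAssumption) :
    ∃ K : ℝ, 0 < K ∧ ∀ h : W, ‖S.iWV h‖ ^ 3 ≤ K * (‖h‖ * ‖S.iW h‖ ^ 2) ∧
      ‖S.iWV h‖ ^ 2 ≤ K * (‖h‖ * ‖S.iW h‖) := by
  obtain ⟨θ, C, hθ0, hθ1, hC, hint⟩ := hs.interpolation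
  set a := ‖S.iW‖ + 1 with ha
  have ha0 : 0 < a := by positivity
  set K := C * a ^ θ with hK
  have hK0 : 0 < K := by positivity
  have h1 : ∀ h : W, ‖S.iWV h‖ ^ 3 ≤ K * (‖h‖ * ‖S.iW h‖ ^ 2) := by
    intro h
    refine (hint h).trans ?_
    have hn := norm_iW_le (S := S) h
    rw [← ha] at hn
    rcases (norm_nonneg (S.iW h)).eq_or_lt with h0 | h0
    · rw [← h0, Real.zero_rpow (by linarith)]; simp
    · have hw : 0 < ‖h‖ := by
        by_contra! hle
        have : ‖h‖ = 0 := le_antisymm hle (norm_nonneg _)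
        rw [this, mul_zero] at hn; linarith
      have e1 : ‖S.iW h‖ ^ (2 + θ) = ‖S.iW h‖ ^ 2 * ‖S.iW h‖ ^ θ := by
        rw [Real.rpow_add h0]; norm_num
      have e2 : ‖S.iW h‖ ^ θ ≤ a ^ θ * ‖h‖ ^ θ := by
        rw [← Real.mul_rpow ha0.le hw.le]
        exact Real.rpow_le_rpow h0.le hn hθ0.le
      have e3 : ‖h‖ ^ θ * ‖h‖ ^ (1 - θ) = ‖h‖ := by
        rw [← Real.rpow_add hw]; simp
      rw [e1]
      calc C * (‖S.iW h‖ ^ 2 * ‖S.iW h‖ ^ θ) * ‖h‖ ^ (1 - θ)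
          ≤ C * (‖S.iW h‖ ^ 2 * (a ^ θ * ‖h‖ ^ θ)) * ‖h‖ ^ (1 - θ) := by gcongr
        _ = C * a ^ θ * ((‖h‖ ^ θ * ‖h‖ ^ (1 - θ)) * ‖S.iW h‖ ^ 2) := by ring
        _ = _ := by rw [e3]
  set M := K ^ 2 * a + 1 with hM
  have hM1 : 1 ≤ M := by rw [hM]; nlinarith [sq_nonneg K]
  refine ⟨K + M, by positivity, fun h => ⟨(h1 h).trans (by gcongr; linarith), ?_⟩⟩
  have hn := norm_iW_le (S := S) h
  rw [← ha] at hn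
  set n := ‖S.iW h‖
  set w := ‖h‖
  set N := ‖S.iWV h‖
  have hn0 : 0 ≤ n := norm_nonneg _
  have hw0 : 0 ≤ w := norm_nonneg _
  -- The quadratic bound is the square of the cubic one, with one factor `n` traded for `a * w`; `M
  -- ≥ 1` permits `M ≤ M³`.
  have h2 : (N ^ 2) ^ 3 ≤ (M * (w * n)) ^ 3 := by
    calc (N ^ 2) ^ 3 = (N ^ 3) ^ 2 := by ring
      _ ≤ (K * (w * n ^ 2)) ^ 2 := by gcongr; exact h1 h
      _ = K ^ 2 * w ^ 2 * n ^ 3 * n := by ring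
      _ ≤ K ^ 2 * w ^ 2 * n ^ 3 * (a * w) := by gcongr
      _ = K ^ 2 * a * (w * n) ^ 3 := by ring
      _ ≤ M * (w * n) ^ 3 := by gcongr; linarith
      _ ≤ M ^ 3 * (w * n) ^ 3 := by
        gcongr
        calc M = M ^ 1 := (pow_one M).symm
          _ ≤ M ^ 3 := pow_le_pow_right₀ hM1 (by norm_num)
      _ = _ := by ring
  have h3 : N ^ 2 ≤ M * (w * n) := le_of_pow_le_pow_left₀ (by norm_num) (by positivity) h2
  exact h3.trans (by gcongr; linarith)

/-- The differential of the augmented Hamiltonian, extended to `X`. -/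
def gradAug (S : HamiltonianData X V W) (c : ℝ) (u : V) : StrongDual ℝ X :=
  S.gradE u - c • S.gradP u

section Static

variable {c : ℝ} {u : W} {A : X →L[ℝ] X}

theorem tendsto_add_iWV : Tendsto (fun h : W => u + h) (𝓝 0) (𝓝 u) := by
  have : Continuous fun h : W => u + h := by fun_prop
  simpa using this.tendsto 0

theorem eventually_mem_OW (hs : S.SpacesAssumption) (hu : u ∈ S.OW) :
    ∀ᶠ h in 𝓝 (0 : W), u + h ∈ S.OW :=
  tendsto_add_iWV.eventually ((isOpen_OW hs).mem_nhds hu)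

theorem taylor_bounds (hs : S.SpacesAssumption) (hf : S.FunctionalsAssumption) (hu : u ∈ S.OW)
    (h0 : fderiv ℝ (S.augE c) (S.iWV u) = 0)
    (hH : ∀ v w : V, inner ℝ (A (S.iV v)) (S.iV w) =
      fderiv ℝ (fderiv ℝ (S.augE c)) (S.iWV u) v w) :
    ∃ C : ℝ, 0 < C ∧ ∀ᶠ h in 𝓝 (0 : W),
      |S.augE c (S.iWV (u + h)) - S.augE c (S.iWV u) - 1 / 2 * inner ℝ (A (S.iW h)) (S.iW h)| ≤
        C * (‖h‖ * ‖S.iW h‖ ^ 2) ∧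
      ∀ ζ : V, |fderiv ℝ (S.augE c) (S.iWV (u + h)) ζ - inner ℝ (A (S.iW h)) (S.iV ζ)| ≤
        C * (‖h‖ * ‖S.iW h‖) * ‖ζ‖ := by
  obtain ⟨K, hK, hint⟩ := interpolation_bounds hs
  obtain ⟨C, hC, hT⟩ := taylor_critical (u := S.iWV u)
    ((contDiffOn_augE hf c).contDiffAt ((isOpen_OV hs).mem_nhds hu)) h0
  refine ⟨(C + 1) * K, by positivity, ?_⟩
  have hcont : Tendsto S.iWV (𝓝 0) (𝓝 0) := by simpa using S.iWV.continuous.tendsto 0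
  filter_upwards [hcont.eventually hT] with h hh
  have hi : S.iV (S.iWV h) = S.iW h := rfl
  obtain ⟨i1, i2⟩ := hint h
  rw [← map_add, ← hH, hi] at hh
  refine ⟨hh.1.trans ?_, fun ζ => ?_⟩
  · calc C * ‖S.iWV h‖ ^ 3 ≤ (C + 1) * (K * (‖h‖ * ‖S.iW h‖ ^ 2)) := by gcongr; linarith
      _ = _ := by ring
  · rw [← hi, hH, ← Real.norm_eq_abs]
    calc _ = ‖(fderiv ℝ (S.augE c) (S.iWV (u + h)) -
          fderiv ℝ (fderiv ℝ (S.augE c)) (S.iWV u) (S.iWV h)) ζ‖ := by simp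
      _ ≤ C * ‖S.iWV h‖ ^ 2 * ‖ζ‖ := (ContinuousLinearMap.le_opNorm _ _).trans (by gcongr; exact hh.2)
      _ ≤ (C + 1) * (K * (‖h‖ * ‖S.iW h‖)) * ‖ζ‖ := by gcongr; linarith
      _ = _ := by rw [hi]; ring

/-- Since `B(u + h)` acts boundedly on `W`, continuously in `h`, the vector `B(u + h)m` is a bounded
family in `W`. It is thus a legitimate direction in `V` for the expansion of `DE_c`. -/
theorem pairing_bound (hs : S.SpacesAssumption) (hp : S.PoissonAssumption)
    (hf : S.FunctionalsAssumption) (hu : u ∈ S.OW)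
    (h0 : fderiv ℝ (S.augE c) (S.iWV u) = 0)
    (hH : ∀ v w : V, inner ℝ (A (S.iV v)) (S.iV w) =
      fderiv ℝ (fderiv ℝ (S.augE c)) (S.iWV u) v w) (m : W) :
    ∃ C : ℝ, 0 < C ∧ ∀ᶠ h in 𝓝 (0 : W),
      |S.gradAug c (S.iWV (u + h)) (S.B (S.iWV (u + h)) (S.iW m)) -
        inner ℝ (A (S.iW h)) (S.B (S.iWV (u + h)) (S.iW m))| ≤ C * (‖h‖ * ‖S.iW h‖) ∧
      ‖S.B (S.iWV (u + h)) (S.iW m)‖ ≤ C := by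
  obtain ⟨C, hC, hT⟩ := taylor_bounds hs hf hu h0 hH
  obtain ⟨BW, hBW, hBc⟩ := hp.contDiffOn_BW
  have hcont : ContinuousAt (fun v => BW v m) u :=
    (hBc.continuousOn.continuousAt ((isOpen_OW hs).mem_nhds hu)).clm_apply continuousAt_const
  have hev : ∀ᶠ h in 𝓝 (0 : W), ‖BW (u + h) m‖ < ‖BW u m‖ + 1 :=
    tendsto_add_iWV.eventually (hcont.norm.eventually (gt_mem_nhds (lt_add_one _)))
  set M := ‖BW u m‖ + 1 with hM
  have hM0 : 0 < M := by positivity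
  set a := ‖S.iW‖ + 1
  set b := ‖S.iWV‖ + 1
  have ha : 0 < a := by positivity
  have hb : 0 < b := by positivity
  refine ⟨C * (b * M) + a * M, by positivity, ?_⟩
  filter_upwards [hT, hev, eventually_mem_OW hs hu] with h h1 h2 h3
  have e1 := hBW (u + h) h3 m
  rw [← e1]
  have e2 : S.gradAug c (S.iWV (u + h)) (S.iW (BW (u + h) m)) =
      fderiv ℝ (S.augE c) (S.iWV (u + h)) (S.iWV (BW (u + h) m)) := by
    rw [fderiv_augE_apply hs hf c (u := S.iWV (u + h)) h3]; simp [gradAug, iW]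
  refine ⟨?_, ?_⟩
  · rw [e2]
    refine (h1.2 (S.iWV (BW (u + h) m))).trans ?_
    have : ‖S.iWV (BW (u + h) m)‖ ≤ b * M := by
      refine (S.iWV.le_opNorm _).trans ?_
      gcongr; simp [b]
    have h5 : 0 ≤ ‖h‖ * ‖S.iW h‖ := by positivity
    calc _ ≤ C * (‖h‖ * ‖S.iW h‖) * (b * M) := by gcongr
      _ = C * (b * M) * (‖h‖ * ‖S.iW h‖) := by ring
      _ ≤ _ := by gcongr; linarith [mul_pos ha hM0]
  · refine (norm_iW_le _).trans ?_
    have : 0 < C * (b * M) := by positivity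
    calc a * ‖BW (u + h) m‖ ≤ a * M := by gcongr
      _ ≤ _ := by linarith

set_option maxHeartbeats 1000000 in
/-- Near the bound state, on a level of `E_c` below the critical one and transversally to the orbit,
the drift along the negative direction dominates all errors. -/
theorem drift_estimate (hs : S.SpacesAssumption) (hp : S.PoissonAssumption)
    (hf : S.FunctionalsAssumption) (hu : u ∈ S.OW) (hA : IsSelfAdjoint A)
    (h0 : fderiv ℝ (S.augE c) (S.iWV u) = 0)
    (hH : ∀ v w : V, inner ℝ (A (S.iV v)) (S.iV w) =
      fderiv ℝ (fderiv ℝ (S.augE c)) (S.iWV u) v w) {y y' x' z : X} {k l : W} (hy : y ≠ 0)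
    (hz : z = S.B (S.iWV u) (S.iW k)) {κ C : ℝ} (hκ : 0 < κ) (hC : 0 ≤ C)
    (hco : ∀ h, inner ℝ y h = 0 → κ * ‖h‖ ^ 2 - C * inner ℝ (A z) h ^ 2 ≤ inner ℝ (A h) h) :
    ∃ c₁ : ℝ, 0 < c₁ ∧ ∀ᶠ h in 𝓝 (0 : W), u + h ∈ S.OW ∧ ∀ e : ℝ, 0 < e →
      inner ℝ y (S.iW h) = (0 : ℝ) → S.augE c (S.iWV (u + h)) = S.augE c (S.iWV u) - e →
      c₁ * e ≤ inner ℝ (A z) (S.iW h) ^ 2 ∧ 0 < ‖y‖ ^ 2 - inner ℝ (S.iW h) y' ∧ ∀ r : ℝ,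
      r * (‖y‖ ^ 2 - inner ℝ (S.iW h) y') =
        S.gradAug c (S.iWV (u + h)) (S.B (S.iWV (u + h)) (S.iW l)) →
      |-S.gradAug c (S.iWV (u + h)) (S.B (S.iWV (u + h)) (S.iW k)) - r * inner ℝ (S.iW h) x' +
        inner ℝ (A z) (S.iW h)| ≤ |(inner ℝ (A z) (S.iW h) : ℝ)| / 2 := by
  have hsym : ∀ x y, inner ℝ (A x) y = inner ℝ x (A y) := hA.isSymmetric
  -- `η` is chosen so that the energy inequality `hen` yields `2ηn ≤ |b|`. Errors of total size `ηn`
  -- are then at most `|b|/2`; the smallness conditions below split this budget into two halves.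
  set C' := C + 1 with hC'
  have hC'0 : 0 < C' := by positivity
  set η := Real.sqrt (κ / (2 * C')) / 2 with hη
  have hη0 : 0 < η := by positivity
  have hηsq : (2 * η) ^ 2 = κ / (2 * C') := by
    rw [hη, mul_div_cancel₀ _ (two_ne_zero), Real.sq_sqrt (by positivity)]
  obtain ⟨C1, hC1, hT⟩ := taylor_bounds hs hf hu h0 hH
  obtain ⟨Ck, hCk, hk⟩ := pairing_bound hs hp hf hu h0 hH k
  obtain ⟨Cl, hCl, hl⟩ := pairing_bound hs hp hf hu h0 hH l
  set a := ‖S.iW‖ + 1 with ha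
  have ha0 : 0 < a := by positivity
  have hyn : 0 < ‖y‖ ^ 2 := by positivity
  set R := 2 * (Cl + ‖A‖ * Cl) / ‖y‖ ^ 2 with hR
  have hR0 : 0 ≤ R := by positivity
  have hsmall : ∀ b d : ℝ, 0 < d → ∀ᶠ h in 𝓝 (0 : W), b * ‖h‖ < d := fun b d hd => by
    have : Continuous fun h : W => b * ‖h‖ := by fun_prop
    have h1 := this.tendsto 0
    rw [norm_zero, mul_zero] at h1
    exact h1.eventually (gt_mem_nhds hd)
  have hBc : ContinuousAt (fun v : W => S.B (S.iWV v) (S.iW k)) u :=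
    ((hp.contDiffOn_B.continuousOn.continuousAt ((isOpen_OV hs).mem_nhds hu)).comp
      S.iWV.continuous.continuousAt).clm_apply continuousAt_const
  have hBs : ∀ᶠ h in 𝓝 (0 : W), ‖A‖ * ‖S.B (S.iWV (u + h)) (S.iW k) - z‖ < η / 2 := by
    have h1 : ContinuousAt (fun v : W => ‖A‖ * ‖S.B (S.iWV v) (S.iW k) - z‖) u :=
      continuousAt_const.mul (hBc.sub continuousAt_const).norm
    have h2 : Tendsto (fun v : W => ‖A‖ * ‖S.B (S.iWV v) (S.iW k) - z‖) (𝓝 u) (𝓝 0) := by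
      simpa [hz, ContinuousAt] using h1
    exact tendsto_add_iWV.eventually (h2.eventually (gt_mem_nhds (by positivity)))
  refine ⟨2 / C', by positivity, ?_⟩
  filter_upwards [hT, hk, hl, eventually_mem_OW hs hu, hsmall 1 1 one_pos, hBs,
    hsmall (a * ‖y'‖) (‖y‖ ^ 2 / 2) (by positivity), hsmall C1 (κ / 4) (by positivity),
    hsmall (Ck + R * ‖x'‖ * a) (η / 2) (by positivity)] with h hT hk hl hm hs1 hB hs2 hs3 hs4
  refine ⟨hm, fun e he hyh hE => ?_⟩
  set n := ‖S.iW h‖ with hn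
  set w := ‖h‖ with hw
  set b : ℝ := inner ℝ (A z) (S.iW h) with hb
  have hn0 : 0 ≤ n := norm_nonneg _
  have hw0 : 0 ≤ w := norm_nonneg _
  have hnw : n ≤ a * w := norm_iW_le h
  -- On the level `E_c(u) - e` the quadratic form is at most `-2e` plus a remainder absorbed by half
  -- of the coercivity. The bound therefore controls both `e` and `‖h‖_X²` by `⟨Az, h⟩²`.
  have hen : 2 * e + κ / 2 * n ^ 2 ≤ C' * b ^ 2 := by
    have h1 := (abs_le.1 hT.1).1
    have h2 := hco _ hyh
    have h3 : C1 * (w * n ^ 2) ≤ κ / 4 * n ^ 2 := by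
      rw [← mul_assoc]; gcongr
    rw [hE] at h1
    have h4 : C * b ^ 2 ≤ C' * b ^ 2 := by gcongr; linarith
    linarith
  have hbn : 2 * η * n ≤ |b| := by
    rw [← Real.sqrt_sq (show 0 ≤ 2 * η * n by positivity), ← Real.sqrt_sq_eq_abs]
    apply Real.sqrt_le_sqrt
    rw [mul_pow, hηsq, div_mul_eq_mul_div, div_le_iff₀ (by positivity)]
    linarith
  have hy1 : |(inner ℝ (S.iW h) y' : ℝ)| ≤ ‖y‖ ^ 2 / 2 := by
    refine (abs_real_inner_le_norm _ _).trans ?_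
    calc n * ‖y'‖ ≤ a * w * ‖y'‖ := by gcongr
      _ = a * ‖y'‖ * w := by ring
      _ ≤ _ := hs2.le
  have hden : ‖y‖ ^ 2 / 2 ≤ ‖y‖ ^ 2 - inner ℝ (S.iW h) y' := by linarith [(abs_le.1 hy1).2]
  refine ⟨?_, by linarith, fun r hr => ?_⟩
  · rw [div_mul_eq_mul_div, div_le_iff₀ hC'0]
    have : 0 ≤ κ / 2 * n ^ 2 := by positivity
    linarith
  generalize S.B (S.iWV (u + h)) (S.iW l) = ξ at hr hl
  generalize S.gradAug c (S.iWV (u + h)) ξ = gl at hr hl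
  -- The relative phase speed is of first order in `h`, so its product with `⟨h, x'⟩` is quadratic
  -- and harmless.
  have hrb : |r| ≤ R * n := by
    have h3 : |gl| ≤ (Cl + ‖A‖ * Cl) * n := by
      have h4 : |(inner ℝ (A (S.iW h)) ξ : ℝ)| ≤ ‖A‖ * n * Cl :=
        (abs_real_inner_le_norm _ _).trans (mul_le_mul (A.le_opNorm _) hl.2 (norm_nonneg _)
          (by positivity))
      have h5 : Cl * (w * n) ≤ Cl * (1 * n) := by
        have : w ≤ 1 := by linarith
        gcongr
      have h6 := abs_sub_abs_le_abs_sub gl (inner ℝ (A (S.iW h)) ξ)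
      have h8 := hl.1
      linarith
    rw [← hr, abs_mul] at h3
    have h7 : |r| * (‖y‖ ^ 2 / 2) ≤ (Cl + ‖A‖ * Cl) * n :=
      (mul_le_mul_of_nonneg_left (hden.trans (le_abs_self _)) (abs_nonneg r)).trans h3
    rw [hR, div_mul_eq_mul_div, le_div_iff₀ hyn]
    linarith
  generalize S.B (S.iWV (u + h)) (S.iW k) = ζ at hk hB ⊢
  generalize S.gradAug c (S.iWV (u + h)) ζ = gk at hk ⊢
  have e1 : |r * inner ℝ (S.iW h) x'| ≤ R * ‖x'‖ * a * w * n := by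
    rw [abs_mul]
    calc |r| * |(inner ℝ (S.iW h) x' : ℝ)| ≤ (R * n) * (n * ‖x'‖) := by
          gcongr; exact abs_real_inner_le_norm _ _
      _ ≤ (R * n) * (a * w * ‖x'‖) := by gcongr
      _ = _ := by ring
  have e2 : |inner ℝ (A (S.iW h)) ζ - b| ≤ η / 2 * n := by
    have : (b : ℝ) = inner ℝ (A (S.iW h)) z := by rw [hb, hsym, real_inner_comm]
    rw [this, ← inner_sub_right]
    refine (abs_real_inner_le_norm _ _).trans ?_
    calc _ ≤ ‖A‖ * n * ‖ζ - z‖ := by gcongr; exact A.le_opNorm _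
      _ = ‖A‖ * ‖ζ - z‖ * n := by ring
      _ ≤ _ := by gcongr
  have e3 : Ck * (w * n) + R * ‖x'‖ * a * w * n ≤ η / 2 * n := by
    calc _ = (Ck + R * ‖x'‖ * a) * w * n := by ring
      _ ≤ _ := by gcongr
  have e4 := hk.1
  have e5 : |(-gk -
      r * inner ℝ (S.iW h) x' + b)| ≤ η * n := by
    rw [abs_le] at e1 e2 e4 ⊢
    constructor <;> linarith [e1.1, e1.2, e2.1, e2.2, e4.1, e4.2]
  linarith

end Static

end HamiltonianData

/-! ### Modulation: choosing the phase -/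

/-- Derivative of a continuous curve solving a scalar implicit equation. -/
theorem hasDerivAt_of_implicit {F : ℝ × ℝ → ℝ} {d : ℝ → ℝ} {t₀ a b : ℝ}
    (hF : HasFDerivAt F (a • ContinuousLinearMap.fst ℝ ℝ ℝ + b • ContinuousLinearMap.snd ℝ ℝ ℝ)
      (d t₀, t₀)) (ha : a ≠ 0) (hd : ContinuousAt d t₀)
    (hz : ∀ᶠ t in 𝓝 t₀, F (d t, t) = F (d t₀, t₀)) : HasDerivAt d (-b / a) t₀ := by
  rw [hasDerivAt_iff_isLittleO]
  have hc : Tendsto (fun t => (d t, t)) (𝓝 t₀) (𝓝 (d t₀, t₀)) := hd.prodMk_nhds continuousAt_id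
  have h1 := (hasFDerivAt_iff_isLittleO.1 hF).comp_tendsto hc
  rw [Asymptotics.isLittleO_iff] at h1 ⊢
  intro ε hε
  set K := |b / a| + 1 with hK
  have hK0 : 0 < K := by positivity
  -- The remainder is small relative to `max |Δd| |Δt| ≤ |r| + K|Δt|`, which contains the unknown
  -- `r`. The bound `1/2` absorbs that term and `ε/(2K)` handles the rest.
  set ε' := min (1 / 2) (ε / (2 * K)) with hε'
  have hε'0 : 0 < ε' := by positivity
  filter_upwards [h1 (show 0 < ε' * |a| by positivity), hz] with t ht hzt
  set r := d t - d t₀ - (t - t₀) • (-b / a) with hr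
  have e1 : a * r = a * (d t - d t₀) + b * (t - t₀) := by rw [hr, smul_eq_mul]; field_simp; ring
  have e2 : |a| * |r| ≤ ε' * |a| * max |d t - d t₀| |t - t₀| := by
    rw [← abs_mul, e1]
    simpa [hzt, Prod.norm_def, -neg_add_rev] using ht
  have e3 : |r| ≤ ε' * max |d t - d t₀| |t - t₀| := by
    have : 0 < |a| := abs_pos.2 ha
    refine le_of_mul_le_mul_left (e2.trans_eq ?_) this
    ring
  have e4 : max |d t - d t₀| |t - t₀| ≤ |r| + K * |t - t₀| := by
    apply max_le
    · have : d t - d t₀ = r + -(b / a) * (t - t₀) := by rw [hr, smul_eq_mul]; ring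
      rw [this]
      refine (abs_add_le _ _).trans ?_
      rw [abs_mul, abs_neg]
      gcongr; linarith
    · have : 1 * |t - t₀| ≤ K * |t - t₀| := by gcongr; rw [hK]; linarith [abs_nonneg (b / a)]
      linarith [abs_nonneg r]
  have e5 : |r| ≤ ε' * |r| + ε' * (K * |t - t₀|) := by
    rw [← mul_add]; exact e3.trans (by gcongr)
  have e6 : ε' * |r| ≤ 1 / 2 * |r| := by gcongr; exact min_le_left _ _
  have e7 : ε' * (K * |t - t₀|) ≤ ε / (2 * K) * (K * |t - t₀|) := by gcongr; exact min_le_right _ _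
  have e8 : ε / (2 * K) * (K * |t - t₀|) = ε / 2 * |t - t₀| := by field_simp
  rw [Real.norm_eq_abs, Real.norm_eq_abs]
  linarith

namespace HamiltonianData

variable {X V W : Type*}
    [NormedAddCommGroup X] [InnerProductSpace ℝ X] [CompleteSpace X]
    [NormedAddCommGroup V] [NormedSpace ℝ V]
    [NormedAddCommGroup W] [NormedSpace ℝ W]
    {S : HamiltonianData X V W}

/-- Near returns to the starting point of an orbit happen only near its periods. -/
theorem near_return {p : X} (h : S.SymmetryAssumption)
    (hper : (∃ ℓ : ℝ, 0 < ℓ ∧ Function.Periodic (fun s : ℝ => S.T s p) ℓ) ∨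
      (∃ η : ℝ, 0 < η ∧ ∀ᶠ s in cocompact ℝ, η ≤ ‖S.T s p - p‖)) {κ : ℝ} (hκ : 0 < κ) :
    ∃ δ : ℝ, 0 < δ ∧ ∀ s, ‖S.T s p - p‖ < δ → ∃ r, S.T r p = p ∧ |s - r| < κ := by
  -- In either alternative a near return can be translated by a period into a fixed compact set. On
  -- the part of that set at distance at least `κ` from every period, `‖T(s)p - p‖` has a positive
  -- minimum.
  have hred : ∃ C : Set ℝ, IsCompact C ∧ ∃ η : ℝ, 0 < η ∧ ∀ s, ‖S.T s p - p‖ < η →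
      ∃ r, S.T r p = p ∧ s - r ∈ C := by
    rcases hper with ⟨ℓ, hℓ, hp⟩ | ⟨η, hη, hev⟩
    · refine ⟨Icc 0 ℓ, isCompact_Icc, 1, one_pos, fun s _ => ⟨⌊s / ℓ⌋ * ℓ, ?_, ?_⟩⟩
      · have := hp.int_mul_eq ⌊s / ℓ⌋
        simpa [h.map_zero] using this
      · have h1 := Int.floor_le (s / ℓ)
        have h2 := Int.lt_floor_add_one (s / ℓ)
        rw [le_div_iff₀ hℓ] at h1
        rw [div_lt_iff₀ hℓ] at h2
        constructor <;> linarith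
    · obtain ⟨C, hC, hsub⟩ := mem_cocompact.1 hev
      refine ⟨C, hC, η, hη, fun s hs => ⟨0, h.map_zero p, ?_⟩⟩
      by_contra hn
      rw [sub_zero] at hn
      have : η ≤ ‖S.T s p - p‖ := hsub hn
      linarith
  obtain ⟨C, hC, η, hη, hCη⟩ := hred
  set C' := C ∩ ⋂ r ∈ {r | S.T r p = p}, {s | κ ≤ |s - r|} with hC'
  have hC'c : IsCompact C' := hC.inter_right (isClosed_biInter fun r _ =>
    isClosed_le continuous_const (by fun_prop))
  have hcont : Continuous fun s => ‖S.T s p - p‖ := ((h.continuous_X p).sub continuous_const).norm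
  have hmin : ∃ δ : ℝ, 0 < δ ∧ ∀ s ∈ C', δ ≤ ‖S.T s p - p‖ := by
    rcases C'.eq_empty_or_nonempty with he | hne
    · exact ⟨1, one_pos, by simp [he]⟩
    · obtain ⟨s, hs, hmin⟩ := hC'c.exists_isMinOn hne hcont.continuousOn
      refine ⟨_, ?_, hmin⟩
      rw [norm_pos_iff, sub_ne_zero]
      intro heq
      have := mem_iInter₂.1 hs.2 s heq
      simp at this
      linarith
  obtain ⟨δ, hδ, hδC⟩ := hmin
  refine ⟨min η δ, lt_min hη hδ, fun s hs => ?_⟩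
  obtain ⟨r, hr, hsr⟩ := hCη s (hs.trans_le (min_le_left _ _))
  have e1 : S.T (s - r) p = S.T s p := by
    conv_rhs => rw [← sub_add_cancel s r, h.map_add, hr]
  have h1 : s - r ∉ C' := fun hm => by
    have := hδC _ hm
    rw [e1] at this
    linarith [hs.trans_le (min_le_right η δ)]
  have h2 : ∃ r', S.T r' p = p ∧ |s - r - r'| < κ := by
    by_contra! hcon
    exact h1 ⟨hsr, mem_iInter₂.2 hcon⟩
  obtain ⟨r', hr', hlt⟩ := h2
  refine ⟨r + r', by rw [h.map_add, hr', hr], by rwa [← sub_sub]⟩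

section Modulation

variable {u : W} {y y' : X}

theorem hasDerivAt_inner_T_orbit (h : S.SymmetryAssumption) {x x' : X} (hx : S.LinGen x x')
    (hy : S.Gen (S.iW u) y) (p : X) (s : ℝ) :
    HasDerivAt (fun s : ℝ => (inner ℝ (S.T s p) x : ℝ))
      (inner ℝ y x - inner ℝ (S.T s p - S.iW u) x') s := by
  obtain ⟨a', ha⟩ := exists_affine_deriv h
  refine (hx.hasDerivAt_inner_T h ha p s).congr_deriv ?_
  rw [← gen_inner h hx ha hy, inner_sub_left]; ring

/-- Monotonicity of the orthogonality condition along the group, near the bound state. -/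
theorem exists_modulation_mono (h : S.SymmetryAssumption) (hy : S.Gen (S.iW u) y)
    (hy' : S.LinGen y y') (hy0 : y ≠ 0) :
    ∃ κ δ m : ℝ, 0 < κ ∧ 0 < δ ∧ 0 < m ∧ ∀ p : X, ‖p - S.iW u‖ ≤ δ → ∀ d₁ d₂ : ℝ, |d₁| ≤ κ →
      |d₂| ≤ κ → m * |d₂ - d₁| ≤ |(inner ℝ (S.T d₂ p - S.T d₁ p) y : ℝ)| ∧
      (d₁ ≤ d₂ → m * (d₂ - d₁) ≤ inner ℝ (S.T d₂ p - S.T d₁ p) y) := by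
  have hn : 0 < ‖y‖ ^ 2 := by positivity
  -- The function `s ↦ ⟨T(s)p, y⟩` has derivative `‖y‖² - ⟨T(s)p - u, y'⟩`, which is at least
  -- `‖y‖²/2` as long as `T(s)p` is within `2δ` of `u`.
  set δ := ‖y‖ ^ 2 / (4 * (‖y'‖ + 1)) with hδ
  have hδ0 : 0 < δ := by positivity
  have hcont : Continuous fun s => ‖S.T s (S.iW u) - S.iW u‖ :=
    ((h.continuous_X _).sub continuous_const).norm
  have h0 : Tendsto (fun s => ‖S.T s (S.iW u) - S.iW u‖) (𝓝 0) (𝓝 0) := by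
    simpa [h.map_zero] using hcont.tendsto 0
  obtain ⟨κ, hκ, hball⟩ := Metric.eventually_nhds_iff_ball.1 (h0.eventually (gt_mem_nhds hδ0))
  refine ⟨κ / 2, δ, ‖y‖ ^ 2 / 2, by positivity, hδ0, by positivity, fun p hp d₁ d₂ h1 h2 => ?_⟩
  have hder := hasDerivAt_inner_T_orbit h hy' hy p
  have hle : ∀ a b : ℝ, |a| ≤ κ / 2 → |b| ≤ κ / 2 → a ≤ b →
      ‖y‖ ^ 2 / 2 * (b - a) ≤ inner ℝ (S.T b p - S.T a p) y := by
    intro a b ha hb hab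
    have := (convex_Icc (-(κ / 2)) (κ / 2)).mul_sub_le_image_sub_of_le_deriv
      (f := fun s => (inner ℝ (S.T s p) y : ℝ)) (C := ‖y‖ ^ 2 / 2)
      (fun s _ => (hder s).continuousAt.continuousWithinAt)
      (fun s _ => (hder s).differentiableAt.differentiableWithinAt)
      (fun s hs => by
        rw [interior_Icc] at hs
        rw [(hder s).deriv, real_inner_self_eq_norm_sq]
        have hs' : |s| < κ := by rw [abs_lt]; constructor <;> linarith [hs.1, hs.2]
        have e1 : ‖S.T s (S.iW u) - S.iW u‖ < δ := hball s (by simpa [Real.dist_eq] using hs')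
        have e2 : ‖S.T s p - S.iW u‖ ≤ 2 * δ := by
          calc _ ≤ ‖S.T s p - S.T s (S.iW u)‖ + ‖S.T s (S.iW u) - S.iW u‖ :=
                norm_sub_le_norm_sub_add_norm_sub _ _ _
            _ ≤ 2 * δ := by rw [T_sub, norm_lin h]; linarith
        have e3 : |(inner ℝ (S.T s p - S.iW u) y' : ℝ)| ≤ ‖y‖ ^ 2 / 2 := by
          calc _ ≤ 2 * δ * ‖y'‖ := (abs_real_inner_le_norm _ _).trans (by gcongr)
            _ ≤ 2 * δ * (‖y'‖ + 1) := by gcongr; linarith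
            _ = _ := by rw [hδ]; field_simp; ring
        linarith [(abs_le.1 e3).2])
      a (abs_le.1 ha) b (abs_le.1 hb) hab
    rwa [← inner_sub_left] at this
  refine ⟨?_, hle d₁ d₂ h1 h2⟩
  rcases le_total d₁ d₂ with h12 | h12
  · rw [abs_of_nonneg (sub_nonneg.2 h12)]
    exact (hle d₁ d₂ h1 h2 h12).trans (le_abs_self _)
  · rw [abs_sub_comm, abs_of_nonneg (sub_nonneg.2 h12), ← neg_sub (S.T d₁ p), inner_neg_left, abs_neg]
    exact (hle d₂ d₁ h2 h1 h12).trans (le_abs_self _)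

theorem eventually_TW_near (hs : S.SpacesAssumption) (h : S.SymmetryAssumption) (u : W) {ε : ℝ}
    (hε : 0 < ε) : ∃ κ : ℝ, 0 < κ ∧ ∀ d, |d| ≤ κ → ‖S.TW d u - u‖ < ε := by
  have hr := isRestriction_W hs h
  have hcont : Continuous fun s => ‖S.TW s u - u‖ := ((hr.continuous u).sub continuous_const).norm
  have h0 : Tendsto (fun s => ‖S.TW s u - u‖) (𝓝 0) (𝓝 0) := by
    simpa [hr.zero h] using hcont.tendsto 0
  obtain ⟨κ, hκ, hball⟩ := Metric.eventually_nhds_iff_ball.1 (h0.eventually (gt_mem_nhds hε))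
  exact ⟨κ / 2, by positivity, fun d hd => hball d (by
    rw [Metric.mem_ball, Real.dist_eq, sub_zero]; linarith)⟩

/-- Modulation in a neighbourhood of the bound state: the orthogonality condition has a unique small
solution, which depends continuously on the state. -/
theorem exists_modulation (hs : S.SpacesAssumption) (h : S.SymmetryAssumption)
    (hy : S.Gen (S.iW u) y) (hy' : S.LinGen y y') (hy0 : y ≠ 0) :
    ∃ ε₂ κ M : ℝ, 0 < ε₂ ∧ 0 < κ ∧ 0 < M ∧
      (∀ w w' : W, ‖w - u‖ < ε₂ → ∀ d d' : ℝ, |d| ≤ κ → |d'| ≤ κ →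
        inner ℝ (S.T d (S.iW w) - S.iW u) y = (0 : ℝ) →
        inner ℝ (S.T d' (S.iW w') - S.iW u) y = (0 : ℝ) → |d - d'| ≤ M * ‖w - w'‖) ∧
      ∀ ε : ℝ, 0 < ε → ∃ β : ℝ, 0 < β ∧ ∀ w : W, ‖w - u‖ < ε₂ →
        |(inner ℝ (S.iW w - S.iW u) y : ℝ)| ≤ β → ∃ d : ℝ, |d| ≤ κ ∧
          inner ℝ (S.T d (S.iW w) - S.iW u) y = (0 : ℝ) ∧ ‖S.TW d w - u‖ < ‖w - u‖ + ε := by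
  obtain ⟨κ, δ, m, hκ, hδ, hm, hmono⟩ := exists_modulation_mono h hy hy' hy0
  have hr := isRestriction_W hs h
  set a := ‖S.iW‖ + 1 with ha
  have ha0 : 0 < a := by positivity
  have hnear : ∀ w : W, ‖w - u‖ < δ / a → ‖S.iW w - S.iW u‖ ≤ δ := fun w hw => by
    rw [← map_sub]
    refine (norm_iW_le _).trans ?_
    rw [lt_div_iff₀ ha0] at hw
    linarith
  refine ⟨δ / a, κ, a * (‖y‖ + 1) / m, by positivity, hκ, by positivity, ?_, ?_⟩
  · intro w w' hw d d' hd hd' hz hz'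
    have h1 := (hmono _ (hnear w hw) d' d hd' hd).1
    have h2 : (inner ℝ (S.T d (S.iW w) - S.T d' (S.iW w)) y : ℝ) =
        inner ℝ (S.T d' (S.iW w') - S.T d' (S.iW w)) y := by
      rw [inner_sub_left] at hz hz' ⊢
      rw [inner_sub_left]; linarith
    rw [h2, T_sub, ← map_sub] at h1
    have h3 : |(inner ℝ ((S.T d').linear (S.iW (w' - w))) y : ℝ)| ≤
        a * ‖w - w'‖ * (‖y‖ + 1) := by
      refine (abs_real_inner_le_norm _ _).trans ?_
      rw [norm_lin h, norm_sub_rev w w']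
      gcongr
      · exact norm_iW_le _
      · linarith
    rw [div_mul_eq_mul_div, le_div_iff₀ hm]
    calc |d - d'| * m = m * |d - d'| := by ring
      _ ≤ a * ‖w - w'‖ * (‖y‖ + 1) := h1.trans h3
      _ = _ := by ring
  · intro ε hε
    obtain ⟨κ₁, hκ₁, hTW⟩ := eventually_TW_near hs h u hε
    -- On `[-k, k]` the function increases at rate at least `m`, so a value at `0` of size at most
    -- `mk` forces a zero there; `κ₁` keeps the translation by that `d` within `ε`.
    set k := min κ κ₁ with hk
    have hk0 : 0 < k := lt_min hκ hκ₁
    refine ⟨m * k, by positivity, fun w hw hb => ?_⟩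
    have hc : Continuous fun d : ℝ => (inner ℝ (S.T d (S.iW w) - S.iW u) y : ℝ) :=
      ((h.continuous_X _).sub continuous_const).inner continuous_const
    have hkκ : |k| ≤ κ := by rw [abs_of_pos hk0]; exact min_le_left _ _
    have h1 := (hmono _ (hnear w hw) 0 k (by simpa using hκ.le) hkκ).2 hk0.le
    have h2 := (hmono _ (hnear w hw) (-k) 0 (by rwa [abs_neg]) (by simpa using hκ.le)).2 (by linarith)
    rw [h.map_zero, inner_sub_left] at h1 h2
    rw [inner_sub_left] at hb
    have hb' := abs_le.1 hb
    have hivt : (0 : ℝ) ∈ (fun d : ℝ => (inner ℝ (S.T d (S.iW w) - S.iW u) y : ℝ)) '' Icc (-k) k := by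
      apply intermediate_value_Icc (by linarith) hc.continuousOn
      constructor <;> (rw [inner_sub_left]; linarith)
    obtain ⟨d, hd, hz⟩ := hivt
    have hdk : |d| ≤ k := abs_le.2 hd
    refine ⟨d, hdk.trans (min_le_left _ _), hz, ?_⟩
    calc ‖S.TW d w - u‖ ≤ ‖S.TW d w - S.TW d u‖ + ‖S.TW d u - u‖ :=
          norm_sub_le_norm_sub_add_norm_sub _ _ _
      _ < ‖w - u‖ + ε := by
        rw [hr.norm_sub]
        linarith [hTW d (hdk.trans (min_le_right _ _))]

/-- Orthogonality improves closeness: if `w` lies in a thin tube around the orbit, a translate of `w`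
that is orthogonal and fairly close to the bound state is in fact very close. -/
theorem exists_self_improvement (hs : S.SpacesAssumption) (h : S.SymmetryAssumption)
    (hy : S.Gen (S.iW u) y) (hy' : S.LinGen y y') (hy0 : y ≠ 0)
    (hper : (∃ ℓ : ℝ, 0 < ℓ ∧ Function.Periodic (fun s : ℝ => S.T s (S.iW u)) ℓ) ∨
      (∃ η : ℝ, 0 < η ∧ ∀ᶠ s in cocompact ℝ, η ≤ ‖S.T s (S.iW u) - S.iW u‖)) :
    ∃ ε₁ : ℝ, 0 < ε₁ ∧ ∀ ε : ℝ, 0 < ε → ε ≤ ε₁ → ∃ ν : ℝ, 0 < ν ∧ ∀ (w : W) (σ s : ℝ),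
      ‖S.TW σ w - u‖ < ν → inner ℝ (S.T s (S.iW w) - S.iW u) y = (0 : ℝ) →
      ‖S.TW s w - u‖ < 2 * ε → ‖S.TW s w - u‖ < ε := by
  obtain ⟨κ, δ, m, hκ, hδ, hm, hmono⟩ := exists_modulation_mono h hy hy' hy0
  obtain ⟨δ₂, hδ₂, hret⟩ := near_return h hper hκ
  have hr := isRestriction_W hs h
  set a := ‖S.iW‖ + 1 with ha
  have ha0 : 0 < a := by positivity
  have hnorm : ∀ (w : W) (s : ℝ), ‖S.T s (S.iW w) - S.iW u‖ ≤ a * ‖S.TW s w - u‖ := fun w s => by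
    rw [← h.invariant_W, ← map_sub]; exact norm_iW_le _
  refine ⟨δ₂ / (4 * a), by positivity, fun ε hε hε1 => ?_⟩
  rw [le_div_iff₀ (by positivity)] at hε1
  obtain ⟨κ₁, hκ₁, hTW⟩ := eventually_TW_near hs h u (half_pos hε)
  set ν := min (ε / 2) (min (δ₂ / (4 * a)) (min (δ / a) (m * κ₁ / (a * (‖y‖ + 1))))) with hν
  have hν0 : 0 < ν := by positivity
  have n1 : ν ≤ ε / 2 := min_le_left _ _
  have n2 : ν ≤ δ₂ / (4 * a) := (min_le_right _ _).trans (min_le_left _ _)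
  have n3 : ν ≤ δ / a := (min_le_right _ _).trans ((min_le_right _ _).trans (min_le_left _ _))
  have n4 : ν ≤ m * κ₁ / (a * (‖y‖ + 1)) :=
    (min_le_right _ _).trans ((min_le_right _ _).trans (min_le_right _ _))
  rw [le_div_iff₀ (by positivity)] at n2 n3 n4
  refine ⟨ν, hν0, fun w σ s h1 h2 h3 => ?_⟩
  -- Both `T(σ)w` and `T(s)w` are near `u`, hence `T(s - σ)u` is near `u` and `s - σ` is near a
  -- period `r`. Replacing `σ` by `r + σ` costs nothing, and the remaining shift `d` is small
  -- because both `w₁` is near `u` and `T(d)w₁` is orthogonal.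
  have e1 : ‖S.T (s - σ) (S.iW u) - S.iW u‖ < δ₂ := by
    have e2 : S.T s (S.iW w) = S.T (s - σ) (S.T σ (S.iW w)) := by
      rw [← h.map_add, sub_add_cancel]
    have e3 : ‖S.T (s - σ) (S.iW u) - S.T s (S.iW w)‖ ≤ a * ‖S.TW σ w - u‖ := by
      rw [e2, T_sub, norm_lin h, norm_sub_rev]; exact hnorm w σ
    have e4 := hnorm w s
    have e5 := norm_sub_le_norm_sub_add_norm_sub (S.T (s - σ) (S.iW u)) (S.T s (S.iW w)) (S.iW u)
    nlinarith
  obtain ⟨r, hrp, hrs⟩ := hret _ e1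
  have hrW : S.TW r u = u := hr.injective (by rw [hr.map, hrp])
  set d := s - σ - r with hd
  set w₁ := S.TW (r + σ) w with hw₁
  have f1 : ‖w₁ - u‖ < ν := by
    calc ‖w₁ - u‖ = ‖S.TW r (S.TW σ w) - S.TW r u‖ := by rw [hw₁, hr.add h, hrW]
      _ = ‖S.TW σ w - u‖ := hr.norm_sub _ _ _
      _ < ν := h1
  have f2 : S.TW s w = S.TW d w₁ := by rw [hw₁, ← hr.add h]; congr 1; rw [hd]; ring
  have f3 : ‖S.iW w₁ - S.iW u‖ ≤ δ := by
    rw [← map_sub]; refine (norm_iW_le _).trans ?_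
    rw [← ha]; nlinarith
  have f4 := (hmono _ f3 0 d (by simpa using hκ.le) hrs.le).1
  have f5 : (inner ℝ (S.T d (S.iW w₁) - S.T 0 (S.iW w₁)) y : ℝ) = -inner ℝ (S.iW (w₁ - u)) y := by
    rw [← h.invariant_W, f2, h.invariant_W, inner_sub_left] at h2
    rw [h.map_zero, map_sub, inner_sub_left, inner_sub_left]; linarith
  rw [f5, abs_neg, sub_zero] at f4
  have f6 : |(inner ℝ (S.iW (w₁ - u)) y : ℝ)| ≤ a * ν * (‖y‖ + 1) := by
    refine (abs_real_inner_le_norm _ _).trans ?_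
    gcongr
    · exact (norm_iW_le _).trans (by gcongr)
    · linarith
  have f7 : |d| ≤ κ₁ := by
    refine le_of_mul_le_mul_left ?_ hm
    linarith
  rw [f2]
  calc ‖S.TW d w₁ - u‖ ≤ ‖S.TW d w₁ - S.TW d u‖ + ‖S.TW d u - u‖ :=
        norm_sub_le_norm_sub_add_norm_sub _ _ _
    _ < ε := by rw [hr.norm_sub]; linarith [hTW d f7]

/-- Differentiability of `(s, t) ↦ ⟨T(s)u(t), x⟩` along a solution. -/
theorem IsSolution.hasFDerivAt_inner (hs : S.SpacesAssumption) (hp : S.PoissonAssumption)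
    (hf : S.FunctionalsAssumption) (h : S.SymmetryAssumption)
    (hy : S.Gen (S.iW u) y) {x x' : X} {k : W} (hx : S.LinGen x x') (hJ : S.JI x (S.iW k))
    {t₁ : ℝ} {u₀ : W} {w : ℝ → W} (hw : S.IsSolution t₁ u₀ w) {t : ℝ} (ht : t ∈ Ioo 0 t₁) (s : ℝ) :
    HasFDerivAt (fun p : ℝ × ℝ => (inner ℝ (S.T p.1 (S.iW (w p.2))) x : ℝ))
      ((inner ℝ y x - inner ℝ (S.iW (S.TW s (w t) - u)) x' : ℝ) • ContinuousLinearMap.fst ℝ ℝ ℝ +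
        (-S.gradE (S.iWV (S.TW s (w t))) (S.B (S.iWV (S.TW s (w t))) (S.iW k))) •
          ContinuousLinearMap.snd ℝ ℝ ℝ) (s, t) := by
  have hr := isRestriction_W hs h
  have htm : t ∈ Ico 0 t₁ := Ioo_subset_Ico_self ht
  have hwm : S.iWV (w t) ∈ S.OV := hw.mem t htm
  have hwc : ContinuousAt w t := hw.continuousOn.continuousAt (Ico_mem_nhds ht.1 ht.2)
  set L := fun s : ℝ => (S.T (-s)).linear x with hL
  have d1 : HasFDerivAt (fun p : ℝ × ℝ => (inner ℝ (S.T p.1 (S.iW (w t))) x : ℝ))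
      ((inner ℝ y x - inner ℝ (S.iW (S.TW s (w t) - u)) x' : ℝ) •
        ContinuousLinearMap.fst ℝ ℝ ℝ) (s, t) := by
    have e := hasDerivAt_inner_T_orbit h hx hy (S.iW (w t)) s
    rw [← h.invariant_W, ← map_sub] at e
    exact (e.comp_hasFDerivAt (s, t) (hasFDerivAt_fst (𝕜 := ℝ) (p := (s, t))))
  have d2 : HasFDerivAt (fun p : ℝ × ℝ => (inner ℝ (L s) (S.iW (w p.2)) : ℝ))
      ((-S.gradE (S.iWV (S.TW s (w t))) (S.B (S.iWV (S.TW s (w t))) (S.iW k))) •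
          ContinuousLinearMap.snd ℝ ℝ ℝ) (s, t) := by
    -- With `s` fixed, the weak equation is tested against `dT(-s)x`. The equivariance of `Ĵ`, `B`
    -- and `∇E` rewrites the flux at the translated state `T(s)w(t)`.
    have hJ' := h.commute_Jhat (-s) _ _ hJ
    have e := hw.hasDerivAt hp hf ⟨_, hJ'.mem⟩ ht
    simp only [InnerProductSpace.toDual_apply_apply] at e
    have e2 : S.J (S.iWV (w t)) ⟨_, hJ'.mem⟩ =
        (S.T (-s)).linear (S.B (S.iWV (S.TW s (w t))) (S.iW k)) := by
      rw [J, hJ'.apply, iWV_TW hs h, h.commute_B (-s) _ (TV_mem_OV h hwm s),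
        (isRestriction_V hs h).neg_apply h]
    rw [e2, ← gradE_lin hs hf h hwm s, lin_lin_neg h, ← iWV_TW hs h] at e
    exact (e.comp_hasFDerivAt (s, t) (hasFDerivAt_snd (𝕜 := ℝ) (p := (s, t))))
  -- The mixed increment has zero derivative: one factor is Lipschitz because `x` lies in the domain
  -- of the generator, and the other tends to zero by mere continuity of `w`. No joint continuity of
  -- partial derivatives is required.
  have d3 : HasFDerivAt (fun p : ℝ × ℝ => (inner ℝ (L p.1 - L s) (S.iW (w p.2 - w t)) : ℝ))
      (0 : ℝ × ℝ →L[ℝ] ℝ) (s, t) := by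
    rw [hasFDerivAt_iff_isLittleO]
    have b1 : (fun p : ℝ × ℝ => L p.1 - L s) =O[𝓝 (s, t)] fun p => p - (s, t) := by
      have hLd : HasDerivAt L (-((S.T (-s)).linear x')) s := by
        have e0 : HasDerivAt (fun r : ℝ => (S.T r).linear x) x' (s - s) := by rw [sub_self]; exact hx
        have e1 : HasDerivAt (fun r : ℝ => (S.T (s - r)).linear x) (-x') s := by
          have := e0.scomp s ((hasDerivAt_id s).const_sub s)
          rw [neg_one_smul] at this
          exact this
        let Ls : X →ₗᵢ[ℝ] X := ⟨(S.T (-s)).linear, norm_lin h (-s)⟩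
        have hLi := Ls.toContinuousLinearMap.hasFDerivAt (x := (S.T (s - s)).linear x)
        have e2 := hLi.comp_hasDerivAt s e1
        refine (e2.congr_of_eventuallyEq (Eventually.of_forall fun r => ?_)).congr_deriv ?_
        · change (S.T (-r)).linear x = (S.T (-s)).linear ((S.T (s - r)).linear x)
          rw [← lin_add h]; congr 3; ring
        · exact map_neg (S.T (-s)).linear x'
      have e3 := hLd.hasFDerivAt.isBigO_sub
      have e4 : Tendsto Prod.fst (𝓝 (s, t)) (𝓝 s) := continuous_fst.tendsto (s, t)
      exact (e3.comp_tendsto e4).trans (Asymptotics.isBigO_of_le _ fun p => by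
        simpa using norm_fst_le (p - (s, t)))
    have b2 : (fun p : ℝ × ℝ => S.iW (w p.2 - w t)) =o[𝓝 (s, t)] fun _ => (1 : ℝ) := by
      rw [Asymptotics.isLittleO_one_iff]
      have e4 : Tendsto Prod.snd (𝓝 (s, t)) (𝓝 t) := continuous_snd.tendsto (s, t)
      have e5 : ContinuousAt (fun r => S.iW (w r - w t)) t :=
        S.iW.continuous.continuousAt.comp (hwc.sub continuousAt_const)
      have e6 : Tendsto (fun r => S.iW (w r - w t)) (𝓝 t) (𝓝 0) := by
        simpa [ContinuousAt] using e5
      exact e6.comp e4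
    have b3 : (fun p : ℝ × ℝ => (inner ℝ (L p.1 - L s) (S.iW (w p.2 - w t)) : ℝ)) =O[𝓝 (s, t)]
        fun p => ‖L p.1 - L s‖ * ‖S.iW (w p.2 - w t)‖ :=
      Asymptotics.isBigO_of_le _ fun p => by
        rw [Real.norm_eq_abs, Real.norm_of_nonneg (by positivity)]; exact abs_real_inner_le_norm _ _
    have b4 := b3.trans_isLittleO (b1.norm_norm.mul_isLittleO b2.norm_left)
    simp only [mul_one] at b4
    simpa using Asymptotics.isLittleO_norm_right.1 b4
  have hsum := (d1.add d2).add d3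
  rw [add_zero] at hsum
  have hconst := hsum.sub_const (inner ℝ (L s) (S.iW (w t)) : ℝ)
  refine hconst.congr_of_eventuallyEq (Eventually.of_forall fun p => ?_)
  have g : ∀ r v, (inner ℝ (S.T r v) x : ℝ) = inner ℝ (L r) v + inner ℝ (S.T r 0) x := fun r v => by
    rw [T_eq, inner_add_left, inner_lin h, real_inner_comm]
  simp only [Pi.add_apply, map_sub, inner_sub_left, inner_sub_right]
  rw [g p.1 (S.iW (w p.2)), g p.1 (S.iW (w t))]
  ring

end Modulation

end HamiltonianData

/-! ### Monotone growth along modulated solutions -/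

namespace HamiltonianData

variable {X V W : Type*}
    [NormedAddCommGroup X] [InnerProductSpace ℝ X] [CompleteSpace X]
    [NormedAddCommGroup V] [NormedSpace ℝ V] [CompleteSpace V]
    [NormedAddCommGroup W] [NormedSpace ℝ W]
    {S : HamiltonianData X V W}

section Growth

variable {u : W} {y y' : X}

/-- The left side is the phase derivative in `IsSolution.hasDerivAt_inner`. Rewriting it through
`∇P` is what allows `∇E` and `∇P` to be combined into the differential of `E_c`. -/
theorem inner_gen_eq_gradP (hs : S.SpacesAssumption) (hp : S.PoissonAssumption)
    (hf : S.FunctionalsAssumption) (h : S.SymmetryAssumption) (hy : S.Gen (S.iW u) y) {x x' : X}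
    {m : W} (hx : S.LinGen x x') (hJ : S.JI x (S.iW m)) {v : W} (hv : v ∈ S.OW) :
    (inner ℝ y x - inner ℝ (S.iW (v - u)) x' : ℝ) =
      -S.gradP (S.iWV v) (S.B (S.iWV v) (S.iW m)) := by
  obtain ⟨a', ha⟩ := exists_affine_deriv h
  rw [← gen_eq_gradP hs hp hf h hx ha hJ (v := S.iWV v) hv, ← gen_inner h hx ha hy, map_sub,
    inner_sub_left]
  change _ = _ - inner ℝ (S.iW v) x'
  ring

/-- Along a modulated solution, `⟨T(s(t))u(t), x⟩` moves at the rate controlled by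
`drift_estimate`. -/
theorem IsSolution.hasDerivAt_modulated (hs : S.SpacesAssumption) (hp : S.PoissonAssumption)
    (hf : S.FunctionalsAssumption) (h : S.SymmetryAssumption) (hy : S.Gen (S.iW u) y)
    (hy' : S.LinGen y y') {l k : W} (hl : S.JI y (S.iW l)) {x x' : X} (hx : S.LinGen x x')
    (hk : S.JI x (S.iW k)) (hyx : inner ℝ y x = (0 : ℝ)) (c : ℝ) {t₁ : ℝ} {u₀ : W} {w : ℝ → W}
    (hw : S.IsSolution t₁ u₀ w) {t : ℝ} (ht : t ∈ Ioo 0 t₁) {s : ℝ → ℝ} (hsc : ContinuousAt s t)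
    (hz : ∀ᶠ r in 𝓝 t, inner ℝ (S.T (s r) (S.iW (w r)) - S.iW u) y = (0 : ℝ))
    (hden : 0 < ‖y‖ ^ 2 - inner ℝ (S.iW (S.TW (s t) (w t) - u)) y') :
    ∃ r : ℝ, r * (‖y‖ ^ 2 - inner ℝ (S.iW (S.TW (s t) (w t) - u)) y') =
        S.gradAug c (S.iWV (S.TW (s t) (w t))) (S.B (S.iWV (S.TW (s t) (w t))) (S.iW l)) ∧
      HasDerivAt (fun t => (inner ℝ (S.T (s t) (S.iW (w t))) x : ℝ))
        (-S.gradAug c (S.iWV (S.TW (s t) (w t))) (S.B (S.iWV (S.TW (s t) (w t))) (S.iW k)) -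
          r * inner ℝ (S.iW (S.TW (s t) (w t) - u)) x') t := by
  have hvm : S.TW (s t) (w t) ∈ S.OW := TW_mem_OW h (hw.mem t (Ioo_subset_Ico_self ht)) _
  have d1 := hw.hasFDerivAt_inner hs hp hf h hy hy' hl ht (s t)
  have t1 := inner_gen_eq_gradP hs hp hf h hy hy' hl hvm
  have t2 := inner_gen_eq_gradP hs hp hf h hy hx hk hvm
  rw [real_inner_self_eq_norm_sq] at d1 t1
  rw [hyx] at t2
  have ds := hasDerivAt_of_implicit d1 hden.ne' hsc (by
    filter_upwards [hz] with r hr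
    have h0 := hz.self_of_nhds
    rw [inner_sub_left] at hr h0
    linarith)
  have d2 := hw.hasFDerivAt_inner hs hp hf h hy hx hk ht (s t)
  rw [hyx] at d2
  set v := S.TW (s t) (w t)
  set den : ℝ := ‖y‖ ^ 2 - inner ℝ (S.iW (v - u)) y' with hdd
  set s' := -(-S.gradE (S.iWV v) (S.B (S.iWV v) (S.iW l))) / den with hs'
  have e1 : s' * den = S.gradE (S.iWV v) (S.B (S.iWV v) (S.iW l)) := by
    rw [hs', div_mul_cancel₀ _ hden.ne', neg_neg]
  -- For the bound state itself the phase is `-ct`, so `s' + c` measures the deviation from its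
  -- motion. The shift by `c` turns `∇E` into `∇E - c∇P` in both formulas.
  refine ⟨s' + c, ?_, ?_⟩
  · rw [add_mul, e1, t1]
    simp [gradAug, sub_eq_add_neg]
  · have dc : HasDerivAt (fun r => (s r, r)) (s', 1) t := ds.prodMk (hasDerivAt_id t)
    have hcomp := HasFDerivAt.comp_hasDerivAt_of_eq t d2 dc rfl
    refine hcomp.congr_deriv ?_
    have e2 : S.gradAug c (S.iWV v) (S.B (S.iWV v) (S.iW k)) =
        S.gradE (S.iWV v) (S.B (S.iWV v) (S.iW k)) - c * S.gradP (S.iWV v) (S.B (S.iWV v) (S.iW k)) := by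
      simp [gradAug]
    have e3 : S.gradP (S.iWV v) (S.B (S.iWV v) (S.iW k)) = inner ℝ (S.iW (v - u)) x' := by linarith
    rw [e2, e3]
    simp
    ring

/-- One continuation step of the modulated solution, with linear growth of the functional
`⟨T(s)u, x⟩`. -/
theorem IsSolution.growth_step (hs : S.SpacesAssumption) (hp : S.PoissonAssumption)
    (hf : S.FunctionalsAssumption) (h : S.SymmetryAssumption) (hy : S.Gen (S.iW u) y)
    (hy' : S.LinGen y y') {l k : W} (hl : S.JI y (S.iW l)) {x x' z : X} (hx : S.LinGen x x')
    (hk : S.JI x (S.iW k)) (hyx : inner ℝ y x = (0 : ℝ)) {c : ℝ} {A : X →L[ℝ] X}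
    {ε₀ c₁ e : ℝ} (hc₁ : 0 < c₁) (he : 0 < e)
    (hdrift : ∀ h : W, ‖h‖ < ε₀ → u + h ∈ S.OW ∧ ∀ e : ℝ, 0 < e →
      inner ℝ y (S.iW h) = (0 : ℝ) → S.augE c (S.iWV (u + h)) = S.augE c (S.iWV u) - e →
      c₁ * e ≤ inner ℝ (A z) (S.iW h) ^ 2 ∧ 0 < ‖y‖ ^ 2 - inner ℝ (S.iW h) y' ∧ ∀ r : ℝ,
      r * (‖y‖ ^ 2 - inner ℝ (S.iW h) y') =
        S.gradAug c (S.iWV (u + h)) (S.B (S.iWV (u + h)) (S.iW l)) →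
      |-S.gradAug c (S.iWV (u + h)) (S.B (S.iWV (u + h)) (S.iW k)) - r * inner ℝ (S.iW h) x' +
        inner ℝ (A z) (S.iW h)| ≤ |(inner ℝ (A z) (S.iW h) : ℝ)| / 2)
    {ε₂ κ M : ℝ} (hκ : 0 < κ)
    (hmod : ∀ w w' : W, ‖w - u‖ < ε₂ → ∀ d d' : ℝ, |d| ≤ κ → |d'| ≤ κ →
        inner ℝ (S.T d (S.iW w) - S.iW u) y = (0 : ℝ) →
        inner ℝ (S.T d' (S.iW w') - S.iW u) y = (0 : ℝ) → |d - d'| ≤ M * ‖w - w'‖)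
    {ε β β' ν : ℝ} (hε0 : ε ≤ ε₀) (hε2 : 2 * ε ≤ ε₂) (hβε : β' ≤ ε / 2)
    (hββ : (‖S.iW‖ + 1) * β' * ‖y‖ ≤ β)
    (hzero : ∀ w : W, ‖w - u‖ < ε₂ →
        |(inner ℝ (S.iW w - S.iW u) y : ℝ)| ≤ β → ∃ d : ℝ, |d| ≤ κ ∧
          inner ℝ (S.T d (S.iW w) - S.iW u) y = (0 : ℝ) ∧ ‖S.TW d w - u‖ < ‖w - u‖ + ε / 2)
    (hself : ∀ (w : W) (σ s : ℝ),
      ‖S.TW σ w - u‖ < ν → inner ℝ (S.T s (S.iW w) - S.iW u) y = (0 : ℝ) →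
      ‖S.TW s w - u‖ < 2 * ε → ‖S.TW s w - u‖ < ε)
    {t₁ : ℝ} {u₀ : W} {w : ℝ → W} (hw : S.IsSolution t₁ u₀ w)
    (hE : S.augE c (S.iWV u₀) = S.augE c (S.iWV u) - e)
    {a b : ℝ} (ha : 0 ≤ a) (hab : a ≤ b) (hb : b < t₁)
    (hclose : ∀ t ∈ Icc a b, ‖w t - w a‖ ≤ β') (htube : ∀ t ∈ Icc a b, ∃ σ, ‖S.TW σ (w t) - u‖ < ν)
    {sg : ℝ} (hsg : |sg| = 1) {s₀ : ℝ}
    (hs₀ : inner ℝ (S.T s₀ (S.iW (w a)) - S.iW u) y = (0 : ℝ)) (hs₀ε : ‖S.TW s₀ (w a) - u‖ < ε)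
    (hs₀g : 0 < sg * inner ℝ (A z) (S.iW (S.TW s₀ (w a) - u))) :
    ∃ s₁ : ℝ, inner ℝ (S.T s₁ (S.iW (w b)) - S.iW u) y = (0 : ℝ) ∧ ‖S.TW s₁ (w b) - u‖ < ε ∧
      0 < sg * inner ℝ (A z) (S.iW (S.TW s₁ (w b) - u)) ∧
      Real.sqrt (c₁ * e) / 2 * (b - a) ≤
        sg * (inner ℝ (S.T s₀ (S.iW (w a))) x - inner ℝ (S.T s₁ (S.iW (w b))) x) := by
  have hr := isRestriction_W hs h
  have haI : a ∈ Icc a b := ⟨le_rfl, hab⟩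
  have hbI : b ∈ Icc a b := ⟨hab, le_rfl⟩
  have hwcI : ContinuousOn w (Icc a b) :=
    hw.continuousOn.mono fun t ht => ⟨ha.trans ht.1, ht.2.trans_lt hb⟩
  -- The initial phase is frozen during the short step and only a small correction `d` is sought.
  -- The path stays within `3ε/2` of `u`, the correction costs `ε/2`, and `hself` brings the
  -- resulting `2ε` back to `ε`.
  set q : ℝ → W := fun t => S.TW s₀ (w t) with hq
  have hqa : ∀ t ∈ Icc a b, ‖q t - q a‖ ≤ β' := fun t ht => by
    rw [hq]; dsimp only; rw [hr.norm_sub]; exact hclose t ht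
  have hqu : ∀ t ∈ Icc a b, ‖q t - u‖ < 3 / 2 * ε := fun t ht => by
    have := norm_sub_le_norm_sub_add_norm_sub (q t) (q a) u
    have h2 := hqa t ht
    change ‖q a - u‖ < ε at hs₀ε
    linarith
  have hε : 0 < ε := (norm_nonneg _).trans_lt hs₀ε
  have hqε : ∀ t ∈ Icc a b, ‖q t - u‖ < ε₂ := fun t ht => by linarith [hqu t ht]
  have hqi : ∀ t, S.iW (q t) = S.T s₀ (S.iW (w t)) := fun t => h.invariant_W _ _
  have hex : ∀ t ∈ Icc a b, ∃ d : ℝ, |d| ≤ κ ∧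
      inner ℝ (S.T d (S.iW (q t)) - S.iW u) y = (0 : ℝ) ∧ ‖S.TW d (q t) - u‖ < 2 * ε := by
    intro t ht
    obtain ⟨d, h1, h2, h3⟩ := hzero (q t) (hqε t ht) (by
      have e1 : (inner ℝ (S.iW (q t) - S.iW u) y : ℝ) = inner ℝ (S.iW (q t - q a)) y := by
        rw [← hqi, inner_sub_left] at hs₀
        rw [map_sub, inner_sub_left, inner_sub_left]; linarith
      rw [e1]
      refine (abs_real_inner_le_norm _ _).trans (le_trans ?_ hββ)
      gcongr
      exact (norm_iW_le _).trans (by gcongr; exact hqa t ht))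
    exact ⟨d, h1, h2, by linarith [hqu t ht]⟩
  choose! d hdκ hdz hdε using hex
  set s : ℝ → ℝ := fun t => d t + s₀ with hsd
  have hTs : ∀ t v, S.T (s t) v = S.T (d t) (S.T s₀ v) := fun t v => h.map_add _ _ _
  have hTWs : ∀ t, S.TW (s t) (w t) = S.TW (d t) (q t) := fun t => hr.add h _ _ _
  have hsz : ∀ t ∈ Icc a b, inner ℝ (S.T (s t) (S.iW (w t)) - S.iW u) y = (0 : ℝ) := fun t ht => by
    rw [hTs, ← hqi]; exact hdz t ht
  have hsε : ∀ t ∈ Icc a b, ‖S.TW (s t) (w t) - u‖ < ε := fun t ht => by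
    obtain ⟨σ, hσ⟩ := htube t ht
    exact hself _ σ _ hσ (hsz t ht) (by rw [hTWs]; exact hdε t ht)
  have hsa : s a = s₀ := by
    have := hmod (q a) (q a) (hqε a haI) (d a) 0 (hdκ a haI) (by simpa using hκ.le) (hdz a haI) (by
      rw [h.map_zero, hqi]; exact hs₀)
    rw [sub_self, norm_zero, mul_zero, sub_zero] at this
    have h0 : d a = 0 := abs_eq_zero.1 (le_antisymm this (abs_nonneg _))
    rw [hsd]; dsimp only; rw [h0, zero_add]
  -- The phases were chosen pointwise; continuity comes from the Lipschitz bound `hmod`, which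
  -- includes their uniqueness.
  have hsc : ContinuousOn s (Icc a b) := by
    refine ContinuousOn.add (fun t ht => ?_) continuousOn_const
    rw [ContinuousWithinAt, tendsto_iff_norm_sub_tendsto_zero]
    have h1 : Tendsto (fun r => M * ‖w r - w t‖) (𝓝[Icc a b] t) (𝓝 0) := by
      have : ContinuousWithinAt (fun r => M * ‖w r - w t‖) (Icc a b) t :=
        continuousWithinAt_const.mul ((hwcI t ht).sub continuousWithinAt_const).norm
      simpa [ContinuousWithinAt] using this
    refine squeeze_zero' (Eventually.of_forall fun _ => norm_nonneg _) ?_ h1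
    filter_upwards [self_mem_nhdsWithin] with r hrI
    have := hmod (q r) (q t) (hqε r hrI) (d r) (d t) (hdκ r hrI) (hdκ t ht) (hdz r hrI) (hdz t ht)
    rwa [hq, hr.norm_sub] at this
  have hvc : ContinuousOn (fun t => S.TW (s t) (w t)) (Icc a b) :=
    hr.continuous_uncurry.comp_continuousOn (hsc.prodMk hwcI)
  set bb : ℝ → ℝ := fun t => inner ℝ (A z) (S.iW (S.TW (s t) (w t) - u)) with hbb
  have hbbc : ContinuousOn bb (Icc a b) :=
    continuousOn_const.inner (S.iW.continuous.comp_continuousOn (hvc.sub continuousOn_const))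
  have hadd : ∀ t, u + (S.TW (s t) (w t) - u) = S.TW (s t) (w t) := fun t => by abel
  have hen : ∀ t ∈ Icc a b, S.augE c (S.iWV (S.TW (s t) (w t))) = S.augE c (S.iWV u) - e := by
    intro t ht
    have htm : t ∈ Ico 0 t₁ := ⟨ha.trans ht.1, ht.2.trans_lt hb⟩
    rw [iWV_TW hs h, augE_TV hs hp hf h (v := S.iWV (w t)) (hw.mem t htm), ← hE, augE, augE,
      hw.energy t htm, hw.momentum t htm]
  have hdr : ∀ t ∈ Icc a b, _ := fun t ht => (hdrift (S.TW (s t) (w t) - u)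
    ((hsε t ht).trans_le hε0)).2 e he (by
      rw [real_inner_comm, map_sub, h.invariant_W]; exact hsz t ht) (by rw [hadd]; exact hen t ht)
  simp only [hadd] at hdr
  have hce : 0 < c₁ * e := mul_pos hc₁ he
  have hbne : ∀ t ∈ Icc a b, bb t ≠ 0 := fun t ht h0 => by
    have := (hdr t ht).1
    change c₁ * e ≤ bb t ^ 2 at this
    rw [h0] at this; norm_num at this; linarith
  -- The energy deficit keeps `⟨Az, h⟩` away from zero, so by the intermediate value theorem its
  -- sign persists.
  have hbpos : ∀ t ∈ Icc a b, 0 < sg * bb t := by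
    intro t ht
    by_contra! hneg
    have hsub : Icc a t ⊆ Icc a b := Icc_subset_Icc_right ht.2
    have hcont : ContinuousOn (fun t => sg * bb t) (Icc a t) :=
      (continuousOn_const.mul hbbc).mono hsub
    have h0 : (0 : ℝ) ∈ Icc (sg * bb t) (sg * bb a) := ⟨hneg, by
      simp only [hbb, hsa]; exact hs₀g.le⟩
    obtain ⟨r, hrI, hr0⟩ := intermediate_value_Icc' ht.1 hcont h0
    have hsg0 : sg ≠ 0 := by rintro rfl; simp at hsg
    exact hbne r (hsub hrI) ((mul_eq_zero.1 hr0).resolve_left hsg0)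
  refine ⟨s b, hsz b hbI, hsε b hbI, hbpos b hbI, ?_⟩
  set Φ : ℝ → ℝ := fun t => -sg * inner ℝ (S.T (s t) (S.iW (w t))) x with hΦ
  have hΦc : ContinuousOn Φ (Icc a b) := by
    have : ContinuousOn (fun t => (inner ℝ (S.iW (S.TW (s t) (w t))) x : ℝ)) (Icc a b) :=
      (S.iW.continuous.comp_continuousOn hvc).inner continuousOn_const
    simp only [h.invariant_W] at this
    exact continuousOn_const.mul this
  have hΦd : ∀ t ∈ Ioo a b, ∃ D, HasDerivAt Φ D t ∧ Real.sqrt (c₁ * e) / 2 ≤ D := by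
    intro t ht
    have htI : t ∈ Icc a b := Ioo_subset_Icc_self ht
    have hn : Icc a b ∈ 𝓝 t := Icc_mem_nhds ht.1 ht.2
    obtain ⟨h1, h2, h3⟩ := hdr t htI
    obtain ⟨r, hr1, hr2⟩ := hw.hasDerivAt_modulated hs hp hf h hy hy' hl hx hk hyx c
      (t := t) ⟨ha.trans_lt ht.1, ht.2.trans hb⟩ (hsc.continuousAt hn)
      (by filter_upwards [hn] with r hr using hsz r hr) h2
    have h4 := h3 r hr1
    refine ⟨_, hr2.const_mul (-sg), ?_⟩
    set D := -S.gradAug c (S.iWV (S.TW (s t) (w t))) (S.B (S.iWV (S.TW (s t) (w t))) (S.iW k)) -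
      r * inner ℝ (S.iW (S.TW (s t) (w t) - u)) x'
    change |D + bb t| ≤ |bb t| / 2 at h4
    change c₁ * e ≤ bb t ^ 2 at h1
    have h5 : Real.sqrt (c₁ * e) ≤ |bb t| := by
      rw [← Real.sqrt_sq_eq_abs]; exact Real.sqrt_le_sqrt h1
    have h6 : sg * bb t = |bb t| := by
      rw [← abs_of_pos (hbpos t htI), abs_mul, hsg, one_mul]
    have h7 : |sg * (D + bb t)| ≤ |bb t| / 2 := by rw [abs_mul, hsg, one_mul]; exact h4
    have h8 := (abs_le.1 h7).2
    rw [mul_add, h6] at h8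
    linarith
  have := (convex_Icc a b).mul_sub_le_image_sub_of_le_deriv (f := Φ) (C := Real.sqrt (c₁ * e) / 2)
    hΦc (fun t ht => by
      rw [interior_Icc] at ht
      obtain ⟨D, hD, -⟩ := hΦd t ht
      exact hD.differentiableAt.differentiableWithinAt)
    (fun t ht => by
      rw [interior_Icc] at ht
      obtain ⟨D, hD, hle⟩ := hΦd t ht
      rwa [hD.deriv]) a haI b hbI hab
  refine this.trans_eq ?_
  simp only [hΦ, hsa]; ring

end Growth

end HamiltonianData

/-! ### Chaining the steps; choice of the initial data and conclusion -/

/-- Chaining of short steps along a path that is uniformly continuous. -/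
theorem exists_of_short_steps {W : Type*} [NormedAddCommGroup W] {w : ℝ → W} {t β ρ : ℝ}
    (ht : 0 ≤ t) (hc : ContinuousOn w (Icc 0 t)) (hβ : 0 < β) {G : ℝ → ℝ → Prop} {a : ℝ → ℝ → ℝ}
    (hstep : ∀ r r' : ℝ, 0 ≤ r → r ≤ r' → r' ≤ t → (∀ q ∈ Icc r r', ‖w q - w r‖ ≤ β) →
      ∀ s, G r s → ∃ s', G r' s' ∧ ρ * (r' - r) ≤ a r s - a r' s') {s₀ : ℝ} (h0 : G 0 s₀) :
    ∃ s', G t s' ∧ ρ * t ≤ a 0 s₀ - a t s' := by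
  obtain ⟨δ, hδ, hunif⟩ := Metric.uniformContinuousOn_iff.1
    (isCompact_Icc.uniformContinuousOn_of_continuous hc) β hβ
  obtain ⟨N, hN⟩ := exists_nat_gt (t / δ)
  have hN0 : (0 : ℝ) < N := (div_nonneg ht hδ.le).trans_lt hN
  set m := t / N with hm
  have hm0 : 0 ≤ m := div_nonneg ht hN0.le
  have hmδ : m < δ := by
    rw [hm, div_lt_iff₀ hN0]; rwa [div_lt_iff₀ hδ, mul_comm] at hN
  have hNm : N * m = t := by rw [hm]; field_simp
  have key : ∀ i : ℕ, i ≤ N → ∃ s', G (i * m) s' ∧ ρ * (i * m) ≤ a 0 s₀ - a (i * m) s' := by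
    intro i
    induction i with
    | zero => intro _; exact ⟨s₀, by simpa using h0, by simp⟩
    | succ i ih =>
      intro hi
      obtain ⟨s, hs, hle⟩ := ih (by omega)
      have hit : ((i + 1 : ℕ) : ℝ) * m ≤ t := by
        rw [← hNm]; gcongr
      have hi0 : 0 ≤ (i : ℝ) * m := by positivity
      have hii : ((i + 1 : ℕ) : ℝ) * m = i * m + m := by push_cast; ring
      obtain ⟨s', hs', hle'⟩ := hstep (i * m) ((i + 1 : ℕ) * m) hi0 (by linarith) hit (fun q hq => by
        rw [← dist_eq_norm]
        refine (hunif q ⟨hi0.trans hq.1, hq.2.trans hit⟩ (i * m) ⟨hi0, by linarith⟩ ?_).le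
        rw [Real.dist_eq, abs_of_nonneg (by linarith [hq.1])]
        linarith [hq.2]) s hs
      refine ⟨s', hs', ?_⟩
      have : ρ * (((i + 1 : ℕ) : ℝ) * m) = ρ * (i * m) + ρ * (((i + 1 : ℕ) : ℝ) * m - i * m) := by ring
      linarith
  have := key N le_rfl
  rwa [hNm] at this

namespace HamiltonianData

variable {X V W : Type*}
    [NormedAddCommGroup X] [InnerProductSpace ℝ X] [CompleteSpace X]
    [NormedAddCommGroup V] [NormedSpace ℝ V] [CompleteSpace V]
    [NormedAddCommGroup W] [NormedSpace ℝ W]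
    {S : HamiltonianData X V W}

theorem exists_translate_of_tube (hs : S.SpacesAssumption) (h : S.SymmetryAssumption) {u v : W}
    {ν : ℝ} (hv : v ∈ S.tubeW u ν) : ∃ σ, ‖S.TW σ v - u‖ < ν := by
  obtain ⟨s, hlt⟩ := exists_lt_of_ciInf_lt hv.2
  exact ⟨-s, by rwa [(isRestriction_W hs h).norm_sub_comm h, neg_neg]⟩

theorem mem_tubeW (hs : S.SpacesAssumption) (h : S.SymmetryAssumption) {u v : W}
    {ν : ℝ} (hv : v ∈ S.OW) (hd : ‖v - u‖ < ν) : v ∈ S.tubeW u ν := by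
  refine ⟨hv, lt_of_le_of_lt (ciInf_le ⟨0, ?_⟩ 0) (by rwa [(isRestriction_W hs h).zero h])⟩
  rintro _ ⟨s, rfl⟩
  exact norm_nonneg _

/-- Perturbing the bound state in a negative direction lowers the augmented Hamiltonian. -/
theorem eventually_augE_lt (hs : S.SpacesAssumption) (hf : S.FunctionalsAssumption) {c : ℝ} {u : W}
    {A : X →L[ℝ] X} (hu : u ∈ S.OW) (h0 : fderiv ℝ (S.augE c) (S.iWV u) = 0)
    (hH : ∀ v w : V, inner ℝ (A (S.iV v)) (S.iV w) =
      fderiv ℝ (fderiv ℝ (S.augE c)) (S.iWV u) v w) {k : W}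
    (hk : inner ℝ (A (S.iW k)) (S.iW k) < (0 : ℝ)) :
    ∀ᶠ r in 𝓝[>] (0 : ℝ), S.augE c (S.iWV (u + r • k)) < S.augE c (S.iWV u) := by
  obtain ⟨C, hC, hT⟩ := taylor_bounds hs hf hu h0 hH
  have hlim : Tendsto (fun r : ℝ => r • k) (𝓝[>] 0) (𝓝 0) := by
    have : Continuous fun r : ℝ => r • k := by fun_prop
    have h1 := this.tendsto 0
    rw [zero_smul] at h1
    exact h1.mono_left nhdsWithin_le_nhds
  have hsm : ∀ᶠ r in 𝓝[>] (0 : ℝ), C * (‖r • k‖ * ‖S.iW k‖ ^ 2) <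
      -(1 / 2 * inner ℝ (A (S.iW k)) (S.iW k)) := by
    have h1 : Tendsto (fun r : ℝ => C * (‖r • k‖ * ‖S.iW k‖ ^ 2)) (𝓝[>] 0)
        (𝓝 (C * (‖(0 : W)‖ * ‖S.iW k‖ ^ 2))) :=
      (hlim.norm.mul_const _).const_mul C
    rw [norm_zero, zero_mul, mul_zero] at h1
    exact h1.eventually (gt_mem_nhds (by linarith))
  filter_upwards [hlim.eventually hT, hsm, self_mem_nhdsWithin] with r h1 h2 (h3 : 0 < r)
  have h4 := (abs_le.1 h1.1).2
  rw [map_smul, map_smul, inner_smul_left, inner_smul_right, norm_smul r (S.iW k),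
    Real.norm_of_nonneg h3.le, RCLike.conj_to_real] at h4
  have h5 : r ^ 2 * (C * (‖r • k‖ * ‖S.iW k‖ ^ 2)) <
      r ^ 2 * -(1 / 2 * inner ℝ (A (S.iW k)) (S.iW k)) := by gcongr
  have h6 : C * (‖r • k‖ * (r * ‖S.iW k‖) ^ 2) = r ^ 2 * (C * (‖r • k‖ * ‖S.iW k‖ ^ 2)) := by ring
  linarith

end HamiltonianData

open HamiltonianData

theorem mainTheorem3 {X V W : Type*}
    [NormedAddCommGroup X] [InnerProductSpace ℝ X] [CompleteSpace X]
    [NormedAddCommGroup V] [NormedSpace ℝ V] [CompleteSpace V]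
    [NormedAddCommGroup W] [NormedSpace ℝ W] [CompleteSpace W]
    (S : HamiltonianData X V W)
    (hSpaces : S.SpacesAssumption) (hPoisson : S.PoissonAssumption)
    (hFun : S.FunctionalsAssumption) (hSym : S.SymmetryAssumption)
    (A : Set ℝ) (U : ℝ → W) (hBound : S.BoundStateAssumption A U)
    (c : ℝ) (hc : c ∈ A) (hSpec : S.SpectralAssumption c (U c))
    (hLocal : S.LocalExistence (U c))
    (hd : deriv (deriv (S.moment U)) c < 0) :
    ∃ ν₀ : ℝ, 0 < ν₀ ∧ ∀ ν : ℝ, 0 < ν → ν < ν₀ →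
      ∃ u₀ ∈ S.tubeW (U c) ν, S.ExitsInFiniteTime (S.tubeW (U c) ν₀) u₀ := by
  obtain ⟨H, L, hHD, hHL, hL, μ, χ, y, Sig, δ, hμ, hχ1, hy, hδ, hSig, hsp, hχ, hker⟩ := hSpec
  have hH : ∀ v w : V, inner ℝ (L (S.iV v)) (S.iV w) =
      fderiv ℝ (fderiv ℝ (S.augE c)) (S.iWV (U c)) v w := fun v w => by
    rw [← hHD, ← hHL, InnerProductSpace.toDual_apply_apply]
  have hLχ : L χ = (-μ ^ 2) • χ := by
    have : χ ∈ Module.End.eigenspace (L : X →ₗ[ℝ] X) (-μ ^ 2) := by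
      rw [hχ]; exact Submodule.mem_span_singleton_self χ
    exact Module.End.mem_eigenspace_iff.1 this
  have hu : U c ∈ S.OW := hBound.mem c hc
  have hy0 : y ≠ 0 := by rintro rfl; exact hBound.nondegenerate c hc hy
  have hcrit := fderiv_augE_boundState hSpaces hPoisson hFun hSym hBound hc
  obtain ⟨k, x, x', hJx, hx, hyx, hneg⟩ := exists_negative_direction hSpaces hPoisson hFun hSym
    hBound hc hd hL hH hμ hχ1 hLχ hy
  obtain ⟨y₁, hy₁, l, hl, hJl⟩ := hBound.dom_JI c hc
  obtain rfl : y₁ = y := Gen.unique hy₁ hy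
  obtain ⟨y', hy'⟩ := exists_linGen_of_JI hSym hl hJl
  have hper := hBound.periodic_or c hc
  set u := U c with hu_def
  set z := S.B (S.iWV u) (S.iW k) with hz
  obtain ⟨κ₀, C, hκ₀, hC, hco⟩ := coercive_of_negative_direction hL hμ hδ hSig hsp hχ1 hχ hker hy0 hneg
  obtain ⟨c₁, hc₁, hdrift⟩ := drift_estimate (x' := x') (y' := y') (l := l) hSpaces hPoisson hFun hu
    hL hcrit hH hy0 hz hκ₀ hC hco
  obtain ⟨ε₀, hε₀, hdrift⟩ := Metric.eventually_nhds_iff.1 hdrift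
  replace hdrift := fun (h : W) (hh : ‖h‖ < ε₀) => hdrift (y := h) (by rwa [dist_zero_right])
  obtain ⟨ε₂, κ, M, hε₂, hκ, -, hmod, hzero⟩ := exists_modulation hSpaces hSym hy hy' hy0
  obtain ⟨ε₁, hε₁, hself⟩ := exists_self_improvement hSpaces hSym hy hy' hy0 hper
  -- `ε₀` serves the drift estimate, `ε₂ / 2` lets modulation work up to distance `2ε`, and `ε₁`
  -- admits self-improvement.
  set ε := min ε₀ (min (ε₂ / 2) ε₁) with hε_def
  have hε : 0 < ε := by positivity
  have hεε₀ : ε ≤ ε₀ := min_le_left _ _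
  have hεε₂ : 2 * ε ≤ ε₂ := by
    have : ε ≤ ε₂ / 2 := (min_le_right _ _).trans (min_le_left _ _)
    linarith
  obtain ⟨ν, hν, hself⟩ := hself ε hε ((min_le_right _ _).trans (min_le_right _ _))
  obtain ⟨β, hβ, hzero⟩ := hzero (ε / 2) (half_pos hε)
  set a := ‖S.iW‖ + 1 with ha
  have ha0 : 0 < a := by positivity
  set β' := min (ε / 2) (β / (a * (‖y₁‖ + 1))) with hβ'
  have hβ'0 : 0 < β' := by positivity
  have hββ : a * β' * ‖y₁‖ ≤ β := by
    have h1 : β' ≤ β / (a * (‖y₁‖ + 1)) := min_le_right _ _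
    rw [le_div_iff₀ (by positivity)] at h1
    have : 0 ≤ a * β' := by positivity
    linarith
  obtain ⟨ν₁, t₀, hν₁, ht₀, hloc⟩ := hLocal
  -- The exit tube must be thin enough both for self-improvement (`ν`) and for local existence
  -- (`ν₁`).
  refine ⟨min ν ν₁, lt_min hν hν₁, fun ν' hν' hν'lt => ?_⟩
  obtain ⟨BW, hBW, -⟩ := hPoisson.contDiffOn_BW
  have hzk : S.iW (BW u k) = z := hBW u hu k
  have hlim : Tendsto (fun r : ℝ => r • BW u k) (𝓝[>] 0) (𝓝 0) := by
    have : Continuous fun r : ℝ => r • BW u k := by fun_prop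
    have h1 := this.tendsto 0
    rw [zero_smul] at h1
    exact h1.mono_left nhdsWithin_le_nhds
  have hball : ∀ η : ℝ, 0 < η → ∀ᶠ r in 𝓝[>] (0 : ℝ), ‖r • BW u k‖ < η := fun η hη =>
    hlim.norm.eventually (by rw [norm_zero]; exact gt_mem_nhds hη)
  -- The data are `u + rz`; `z` lies in `W` because `B(u)` preserves `W`. The step `r` is small
  -- enough to lower `E_c`, to start in the `ν'`-tube, and to allow an initial phase.
  obtain ⟨r, hr1, hr2, hr3, hr4⟩ := ((eventually_augE_lt hSpaces hFun hu hcrit hH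
    (k := BW u k) (by rw [hzk]; exact hneg)).and ((hball ν' hν').and ((hball β' hβ'0).and
    (hlim.eventually (eventually_mem_OW hSpaces hu))))).exists
  set u₀ := u + r • BW u k with hu₀
  have hu₀u : u₀ - u = r • BW u k := by rw [hu₀]; abel
  rw [← hu₀u] at hr2 hr3
  refine ⟨u₀, mem_tubeW hSpaces hSym hr4 hr2, ?_⟩
  set e := S.augE c (S.iWV u) - S.augE c (S.iWV u₀) with he_def
  have he : 0 < e := sub_pos.2 hr1
  have hE : S.augE c (S.iWV u₀) = S.augE c (S.iWV u) - e := by rw [he_def]; ring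
  have hβ'ε : β' ≤ ε / 2 := min_le_left _ _
  obtain ⟨d, -, hdz, hdε⟩ := hzero u₀ (by linarith) (by
    rw [← map_sub]
    refine (abs_real_inner_le_norm _ _).trans (le_trans ?_ hββ)
    gcongr
    exact (norm_iW_le _).trans (by gcongr))
  have hdε : ‖S.TW d u₀ - u‖ < ε := by linarith
  set b : ℝ := inner ℝ (L z) (S.iW (S.TW d u₀ - u)) with hb
  have hb0 : b ≠ 0 := by
    intro h0
    have h1 := ((hdrift (S.TW d u₀ - u) (hdε.trans_le hεε₀)).2 e he (by
      rw [real_inner_comm, map_sub, hSym.invariant_W]; exact hdz) (by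
      rw [add_sub_cancel, iWV_TW hSpaces hSym,
        augE_TV hSpaces hPoisson hFun hSym (v := S.iWV u₀) hr4, hE])).1
    rw [← hb, h0] at h1
    have : 0 < c₁ * e := mul_pos hc₁ he
    norm_num at h1; linarith
  -- The sign of `⟨Az, h⟩` at time zero fixes the direction of the monotone drift.
  set sg := b / |b| with hsg_def
  have hsg : |sg| = 1 := by rw [hsg_def, abs_div, abs_abs, div_self (abs_ne_zero.2 hb0)]
  have hsgb : 0 < sg * b := by
    rw [hsg_def, div_mul_eq_mul_div]
    exact div_pos (mul_self_pos.2 hb0) (abs_pos.2 hb0)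
  set ρ := Real.sqrt (c₁ * e) / 2 with hρ
  have hρ0 : 0 < ρ := by
    have : 0 < c₁ * e := mul_pos hc₁ he
    positivity
  set R := (‖S.iW u‖ + a * ε) * ‖x‖ with hR
  have hbd : ∀ (s : ℝ) (v : W), ‖S.TW s v - u‖ < ε → |(inner ℝ (S.T s (S.iW v)) x : ℝ)| ≤ R := by
    intro s v hv
    refine (abs_real_inner_le_norm _ _).trans ?_
    rw [hR]
    gcongr
    rw [← hSym.invariant_W]
    calc ‖S.iW (S.TW s v)‖ = ‖S.iW u + S.iW (S.TW s v - u)‖ := by rw [map_sub]; congr 1; abel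
      _ ≤ ‖S.iW u‖ + ‖S.iW (S.TW s v - u)‖ := norm_add_le _ _
      _ ≤ ‖S.iW u‖ + a * ε := by gcongr; exact (norm_iW_le _).trans (by gcongr)
  have hKsub : ∀ v ∈ S.tubeW u (min ν ν₁), v ∈ S.tubeW u ν₁ := fun v hv =>
    ⟨hv.1, hv.2.trans_le (min_le_right _ _)⟩
  -- The functional takes values in `[-R, R]` at the phases used and moves with speed at least `ρ`,
  -- so a stay lasts at most `2R/ρ`.
  refine exits_of_bounded_stay hPoisson hFun ht₀ (fun v hv => (hloc v (hKsub v hv)).1)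
    (mem_tubeW hSpaces hSym hr4 (hr2.trans hν'lt)) (τ₀ := 2 * R / ρ) ?_
  intro t t₁ ht htt₁ w hw hwK
  have hwc : ContinuousOn w (Icc 0 t) :=
    hw.continuousOn.mono fun q hq => ⟨hq.1, hq.2.trans_lt htt₁⟩
  obtain ⟨s', ⟨-, hs'ε, -⟩, hgrow⟩ := exists_of_short_steps (ρ := ρ) ht hwc hβ'0
    (G := fun r s => inner ℝ (S.T s (S.iW (w r)) - S.iW u) y₁ = (0 : ℝ) ∧ ‖S.TW s (w r) - u‖ < ε ∧
      0 < sg * inner ℝ (L z) (S.iW (S.TW s (w r) - u)))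
    (a := fun r s => sg * inner ℝ (S.T s (S.iW (w r))) x)
    (fun q q' hq hqq' hq't hclose s hs => by
      obtain ⟨s₁, g1, g2, g3, g4⟩ := hw.growth_step hSpaces hPoisson hFun hSym hy hy' hJl hx hJx hyx
        hc₁ he hdrift hκ hmod hεε₀ hεε₂ hβ'ε hββ hzero hself hE hq hqq' (hq't.trans_lt htt₁)
        hclose (fun p hp => by
          obtain ⟨σ, hσ⟩ := exists_translate_of_tube hSpaces hSym
            (hwK p ⟨hq.trans hp.1, hp.2.trans hq't⟩)
          exact ⟨σ, hσ.trans_le (min_le_left _ _)⟩) hsg hs.1 hs.2.1 hs.2.2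
      refine ⟨s₁, ⟨g1, g2, g3⟩, ?_⟩
      rw [← mul_sub]; exact g4) (s₀ := d) (by
      rw [hw.initial]; exact ⟨hdz, hdε, hsgb⟩)
  rw [le_div_iff₀ hρ0]
  have h1 : |sg * inner ℝ (S.T d (S.iW (w 0))) x| ≤ R := by
    rw [abs_mul, hsg, one_mul, hw.initial]; exact hbd _ _ hdε
  have h2 : |sg * inner ℝ (S.T s' (S.iW (w t))) x| ≤ R := by
    rw [abs_mul, hsg, one_mul]; exact hbd _ _ hs'ε
  have h3 := (abs_le.1 h1).2
  have h4 := (abs_le.1 h2).1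
  linarith
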